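/- Let $A$ be a separable $C^*$-algebra, $G$ a second countable, compact (Hausdorff) group with normalized Haar measure $\mu$, and $\alpha: G\curvearrowright A$ a point-norm continuous action by $*$-automorphisms. Notation. For a $C^*$-algebra $B$ let $B_\infty=\ell^\infty(\mathbb N,B)/\{(b_n)_n : \lim_{n\to\infty}\|b_n\|=0\}$, into which $B$ embeds canonically as constant sequences. A $*$-homomorphism $\varphi: B\to C$ of $C^*$-algebras is called sequentially split if there is a $*$-homomorphism $\psi: C\to B_\infty$ such that $\psi\circ\varphi$ is the canonical embedding $B\hookrightarrow B_\infty$. Let $F_\infty(A)=(A_\infty\cap A')/\{x\in A_\infty : xa=ax=0 \text{ for all } a\in A\}$, a unital $C^*$-algebra on which $G$ acts by $\tilde\alpha_\infty$, the action induced by applying $\alpha$ componentwise to sequences, and let $F_{\infty,\alpha}(A)\subset F_\infty(A)$ be the $C^*$-subalgebra of those $x$ for which $g\mapsto\tilde\alpha_{\infty,g}(x)$ is norm-continuous. Let $\sigma: G\curvearrowright C(G)$ be the shift $\sigma_g(f)=f(g^{-1}\,\cdot\,)$. The action $\alpha$ has the Rokhlin property if there is a unital, equivariant $*$-homomorphism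 $(C(G),\sigma)\to(F_{\infty,\alpha}(A),\tilde\alpha_\infty)$. Assume that $\alpha$ has the Rokhlin property. Then: (i) The inclusion map $A^\alpha\hookrightarrow A$ of the fixed point algebra is sequentially split. (ii) Identify $C(G)\otimes A$ with $C(G,A)$, with the action $(\sigma\otimes\alpha)_g(f)(t)=\alpha_g(f(g^{-1}t))$. There is a unique $*$-isomorphism $\Phi: (C(G)\otimes A)\rtimes_{\sigma\otimes\alpha}G\to A\otimes\mathcal K(L^2(G))$ which, for all $a\in A$ and $\xi,\eta\in C(G)$, sends the function $s\mapsto\big(t\mapsto\xi(t)\overline{\eta(s^{-1}t)}\,\alpha_t(a)\big)$ in $C(G,C(G,A))$ to $a\otimes|\xi\rangle\langle\eta|$, where $|\xi\rangle\langle\eta|$ is the operator $\zeta\mapsto\langle\eta,\zeta\rangle\,\xi$, with $\langle\eta,\zeta\rangle=\int_G\overline{\eta}\,\zeta\,d\mu$. The canonical embedding $$A\rtimes_\alpha G\to (C(G)\otimes A)\rtimes_{\sigma\otimes\alpha}G\xrightarrow{\ \Phi\ }A\otimes\mathcal K(L^2(G)),$$ whose first map is induced by the equivariant second-factor embedding $A\to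 C(G)\otimes A$, $a\mapsto \mathbf 1\otimes a$, is sequentially split. -/

import Mathlib

noncomputable section

namespace RokhlinSplit

open scoped ENNReal TensorProduct
open MeasureTheory Topology


/-! ### Quotients by two-sided `*`-ideals -/

section Quotients

/-- A two-sided self-adjoint ideal of a complex `*`-algebra. -/
structure StarIdeal (X : Type*) [NonUnitalRing X] [StarRing X] [Module ℂ X] extends
    Submodule ℂ X where
  mul_mem_left' : ∀ x y, y ∈ carrier → x * y ∈ carrier
  mul_mem_right' : ∀ x y, x ∈ carrier → x * y ∈ carrier
  star_mem' : ∀ x, x ∈ carrier → star x ∈ carrier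

variable {X : Type*} [NonUnitalSeminormedRing X] [StarRing X] [NormedSpace ℂ X]

/-- The quotient `X / I`, with the quotient norm. -/
def StarIdeal.Quotient (I : StarIdeal X) : Type _ := X ⧸ I.toSubmodule

namespace StarIdeal.Quotient

variable (I : StarIdeal X)

instance : SeminormedAddCommGroup I.Quotient :=
  inferInstanceAs (SeminormedAddCommGroup (X ⧸ I.toSubmodule))

instance : NormedSpace ℂ I.Quotient :=
  inferInstanceAs (NormedSpace ℂ (X ⧸ I.toSubmodule))

variable {I} in
/-- The class of an element. -/
def mk (x : X) : I.Quotient := Submodule.Quotient.mk (p := I.toSubmodule) x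

variable {I}

theorem mk_surjective : Function.Surjective (mk : X → I.Quotient) :=
  Submodule.Quotient.mk_surjective _

theorem mk_eq_mk {x y : X} : (mk x : I.Quotient) = mk y ↔ x - y ∈ I.toSubmodule :=
  Submodule.Quotient.eq _

theorem mk_add (x y : X) : (mk (x + y) : I.Quotient) = mk x + mk y := rfl

theorem mk_zero : (mk 0 : I.Quotient) = 0 := rfl

theorem mk_smul (c : ℂ) (x : X) : (mk (c • x) : I.Quotient) = c • mk x := rfl

instance : Mul I.Quotient where
  mul := Quotient.map₂ (· * ·) (by
    intro x x' hx y y' hy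
    have hx' : x - x' ∈ I.toSubmodule := (Submodule.quotientRel_def _).1 hx
    have hy' : y - y' ∈ I.toSubmodule := (Submodule.quotientRel_def _).1 hy
    refine (Submodule.quotientRel_def _).2 ?_
    have h : x * y - x' * y' = (x - x') * y + x' * (y - y') := by noncomm_ring
    rw [h]
    exact I.add_mem (I.mul_mem_right' _ _ hx') (I.mul_mem_left' _ _ hy'))

theorem mk_mul (x y : X) : (mk (x * y) : I.Quotient) = mk x * mk y := rfl

instance : Star I.Quotient where
  star := Quotient.map star (by
    intro x x' hx
    have hx' : x - x' ∈ I.toSubmodule := (Submodule.quotientRel_def _).1 hx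
    refine (Submodule.quotientRel_def _).2 ?_
    rw [← star_sub]
    exact I.star_mem' _ hx')

theorem mk_star (x : X) : (mk (star x) : I.Quotient) = star (mk x) := rfl

theorem norm_mk_le (x : X) : ‖(mk x : I.Quotient)‖ ≤ ‖x‖ :=
  Submodule.Quotient.norm_mk_le _ x

theorem exists_norm_lt (x : I.Quotient) {ε : ℝ} (hε : 0 < ε) :
    ∃ y : X, mk y = x ∧ ‖y‖ < ‖x‖ + ε :=
  Submodule.Quotient.norm_mk_lt (S := I.toSubmodule) x hε

instance : NonUnitalRing I.Quotient where
  __ : AddCommGroup I.Quotient := inferInstance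
  left_distrib x y z := by
    obtain ⟨x, rfl⟩ := mk_surjective x
    obtain ⟨y, rfl⟩ := mk_surjective y
    obtain ⟨z, rfl⟩ := mk_surjective z
    simp only [← mk_add, ← mk_mul, mul_add]
  right_distrib x y z := by
    obtain ⟨x, rfl⟩ := mk_surjective x
    obtain ⟨y, rfl⟩ := mk_surjective y
    obtain ⟨z, rfl⟩ := mk_surjective z
    simp only [← mk_add, ← mk_mul, add_mul]
  zero_mul x := by
    obtain ⟨x, rfl⟩ := mk_surjective x
    simp only [← mk_zero, ← mk_mul, zero_mul]
  mul_zero x := by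
    obtain ⟨x, rfl⟩ := mk_surjective x
    simp only [← mk_zero, ← mk_mul, mul_zero]
  mul_assoc x y z := by
    obtain ⟨x, rfl⟩ := mk_surjective x
    obtain ⟨y, rfl⟩ := mk_surjective y
    obtain ⟨z, rfl⟩ := mk_surjective z
    simp only [← mk_mul, mul_assoc]

theorem norm_mul_le_aux (x y : I.Quotient) : ‖x * y‖ ≤ ‖x‖ * ‖y‖ := by
  refine le_of_forall_gt fun c hc => ?_
  have hcont : Filter.Tendsto (fun ε : ℝ => (‖x‖ + ε) * (‖y‖ + ε)) (𝓝[>] 0)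
      (𝓝 (‖x‖ * ‖y‖)) := by
    have h : Continuous fun ε : ℝ => (‖x‖ + ε) * (‖y‖ + ε) := by fun_prop
    have h0 := h.tendsto 0
    simp only [add_zero] at h0
    exact h0.mono_left nhdsWithin_le_nhds
  obtain ⟨ε, hε, hpos⟩ :=
    ((hcont.eventually (gt_mem_nhds hc)).and self_mem_nhdsWithin).exists
  obtain ⟨x', rfl, hx'⟩ := exists_norm_lt x hpos
  obtain ⟨y', rfl, hy'⟩ := exists_norm_lt y hpos
  calc ‖(mk x' * mk y' : I.Quotient)‖ ≤ ‖x' * y'‖ := by rw [← mk_mul]; exact norm_mk_le _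
    _ ≤ ‖x'‖ * ‖y'‖ := norm_mul_le _ _
    _ ≤ _ := mul_le_mul hx'.le hy'.le (norm_nonneg _)
        ((norm_nonneg _).trans hx'.le)
    _ < c := hε

instance : NonUnitalSeminormedRing I.Quotient :=
  { (inferInstance : SeminormedAddCommGroup I.Quotient),
    (inferInstance : NonUnitalRing I.Quotient) with
    norm_mul_le := norm_mul_le_aux }

instance : StarRing I.Quotient where
  star_involutive x := by
    obtain ⟨x, rfl⟩ := mk_surjective x
    simp only [← mk_star, star_star]
  star_mul x y := by
    obtain ⟨x, rfl⟩ := mk_surjective x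
    obtain ⟨y, rfl⟩ := mk_surjective y
    simp only [← mk_star, ← mk_mul, star_mul]
  star_add x y := by
    obtain ⟨x, rfl⟩ := mk_surjective x
    obtain ⟨y, rfl⟩ := mk_surjective y
    simp only [← mk_star, ← mk_add, star_add]

instance [IsScalarTower ℂ X X] : IsScalarTower ℂ I.Quotient I.Quotient where
  smul_assoc c x y := by
    obtain ⟨x, rfl⟩ := mk_surjective x
    obtain ⟨y, rfl⟩ := mk_surjective y
    simp only [← mk_smul, ← mk_mul, smul_eq_mul, smul_mul_assoc]

instance [SMulCommClass ℂ X X] : SMulCommClass ℂ I.Quotient I.Quotient where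
  smul_comm c x y := by
    obtain ⟨x, rfl⟩ := mk_surjective x
    obtain ⟨y, rfl⟩ := mk_surjective y
    simp only [← mk_smul, ← mk_mul, smul_eq_mul, mul_smul_comm]

instance [StarModule ℂ X] : StarModule ℂ I.Quotient where
  star_smul c x := by
    obtain ⟨x, rfl⟩ := mk_surjective x
    simp only [← mk_smul, ← mk_star, star_smul]

instance [NormedStarGroup X] : NormedStarGroup I.Quotient where
  norm_star_le x := by
    refine le_of_forall_pos_lt_add fun ε hε => ?_
    obtain ⟨x', rfl, hx'⟩ := exists_norm_lt x hε
    calc ‖star (mk x' : I.Quotient)‖ ≤ ‖star x'‖ := by rw [← mk_star]; exact norm_mk_le _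
      _ = ‖x'‖ := norm_star _
      _ < _ := hx'

/-- The quotient map as a `*`-homomorphism. -/
def mkHom (I : StarIdeal X) : X →⋆ₙₐ[ℂ] I.Quotient where
  toFun := mk
  map_smul' _ _ := rfl
  map_zero' := rfl
  map_add' _ _ := rfl
  map_mul' _ _ := rfl
  map_star' _ := rfl

section Map

variable {Y : Type*} [NonUnitalSeminormedRing Y] [StarRing Y] [NormedSpace ℂ Y]
  {J : StarIdeal Y}

/-- The map between quotients induced by a `*`-homomorphism that respects the ideals. -/
def mapFun (θ : X →⋆ₙₐ[ℂ] Y) (h : ∀ x ∈ I.toSubmodule, θ x ∈ J.toSubmodule) :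
    I.Quotient → J.Quotient :=
  Quotient.map θ (by
    intro x x' hx
    have hx' : x - x' ∈ I.toSubmodule := (Submodule.quotientRel_def _).1 hx
    refine (Submodule.quotientRel_def _).2 ?_
    rw [← map_sub]
    exact h _ hx')

theorem mapFun_mk (θ : X →⋆ₙₐ[ℂ] Y) (h : ∀ x ∈ I.toSubmodule, θ x ∈ J.toSubmodule) (x : X) :
    mapFun θ h (mk x : I.Quotient) = mk (θ x) := rfl

/-- The `*`-homomorphism between quotients induced by a `*`-homomorphism that respects the
ideals. -/
def map (θ : X →⋆ₙₐ[ℂ] Y) (h : ∀ x ∈ I.toSubmodule, θ x ∈ J.toSubmodule) :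
    I.Quotient →⋆ₙₐ[ℂ] J.Quotient where
  toFun := mapFun θ h
  map_smul' c x := by
    obtain ⟨x, rfl⟩ := mk_surjective x
    simp only [MonoidHom.id_apply, ← mk_smul, mapFun_mk, map_smul]
  map_zero' := by
    rw [← mk_zero, mapFun_mk, map_zero, mk_zero]
  map_add' x y := by
    obtain ⟨x, rfl⟩ := mk_surjective x
    obtain ⟨y, rfl⟩ := mk_surjective y
    simp only [← mk_add, mapFun_mk, map_add]
  map_mul' x y := by
    obtain ⟨x, rfl⟩ := mk_surjective x
    obtain ⟨y, rfl⟩ := mk_surjective y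
    simp only [← mk_mul, mapFun_mk, map_mul]
  map_star' x := by
    obtain ⟨x, rfl⟩ := mk_surjective x
    simp only [← mk_star, mapFun_mk, map_star]

theorem map_mk (θ : X →⋆ₙₐ[ℂ] Y) (h : ∀ x ∈ I.toSubmodule, θ x ∈ J.toSubmodule) (x : X) :
    map θ h (mk x : I.Quotient) = mk (θ x) := rfl

end Map

end StarIdeal.Quotient

end Quotients

/-! ### Sequence algebras and sequentially split `*`-homomorphisms -/

section SequenceAlgebra

variable (A : Type*) [NonUnitalCStarAlgebra A]

/-- The ideal of null sequences in the `C*`-algebra of bounded sequences in `A`. -/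
def nullSequences : StarIdeal (lp (fun _ : ℕ => A) ∞) where
  carrier := {x | Filter.Tendsto (fun n => ‖x n‖) Filter.atTop (𝓝 0)}
  zero_mem' := by simp
  add_mem' {x y} hx hy := by
    have h := Filter.Tendsto.add hx hy
    rw [add_zero] at h
    exact squeeze_zero (fun n => norm_nonneg _) (fun n => norm_add_le (x n) (y n)) h
  smul_mem' c x hx := by
    have h := Filter.Tendsto.const_mul ‖c‖ hx
    rw [mul_zero] at h
    exact squeeze_zero (fun n => norm_nonneg _) (fun n => (norm_smul c (x n)).le) h
  mul_mem_left' x y hy := by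
    have h := Filter.Tendsto.const_mul ‖x‖ hy
    rw [mul_zero] at h
    refine squeeze_zero (fun n => norm_nonneg _) (fun n => ?_) h
    exact (norm_mul_le (x n) (y n)).trans
      (mul_le_mul_of_nonneg_right (lp.norm_apply_le_norm ENNReal.top_ne_zero x n) (norm_nonneg _))
  mul_mem_right' x y hx := by
    have h := Filter.Tendsto.mul_const ‖y‖ hx
    rw [zero_mul] at h
    refine squeeze_zero (fun n => norm_nonneg _) (fun n => ?_) h
    exact (norm_mul_le (x n) (y n)).trans
      (mul_le_mul_of_nonneg_left (lp.norm_apply_le_norm ENNReal.top_ne_zero y n) (norm_nonneg _))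
  star_mem' x hx := by
    refine squeeze_zero (fun n => norm_nonneg _) (fun n => ?_) hx
    exact (norm_star (x n)).le

/-- The sequence algebra `A_∞ = ℓ^∞(ℕ, A) / c₀(ℕ, A)`. -/
abbrev SeqAlgebra : Type _ := (nullSequences A).Quotient

/-- Constant sequences. -/
def constSeq : A →⋆ₙₐ[ℂ] lp (fun _ : ℕ => A) ∞ where
  toFun a := ⟨fun _ => a, memℓp_infty ⟨‖a‖, by rintro _ ⟨i, rfl⟩; exact le_rfl⟩⟩
  map_smul' _ _ := rfl
  map_zero' := rfl
  map_add' _ _ := rfl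
  map_mul' _ _ := rfl
  map_star' _ := rfl

/-- The canonical inclusion `A → A_∞` as (classes of) constant sequences. -/
def toSeqAlgebra : A →⋆ₙₐ[ℂ] SeqAlgebra A :=
  (StarIdeal.Quotient.mkHom (nullSequences A)).comp (constSeq A)

variable {A} {B : Type*} [NonUnitalCStarAlgebra B]

/-- A `*`-homomorphism `φ : A → B` is sequentially split if there is a `*`-homomorphism
`ψ : B → A_∞` such that `ψ ∘ φ` is the canonical inclusion `A → A_∞`. -/
def SequentiallySplit (φ : A →⋆ₙₐ[ℂ] B) : Prop :=
  ∃ ψ : B →⋆ₙₐ[ℂ] SeqAlgebra A, ψ.comp φ = toSeqAlgebra A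

/-- Componentwise application of a `*`-homomorphism to bounded sequences. -/
def seqMap (θ : A →⋆ₙₐ[ℂ] B) : lp (fun _ : ℕ => A) ∞ →⋆ₙₐ[ℂ] lp (fun _ : ℕ => B) ∞ where
  toFun x := ⟨fun n => θ (x n), memℓp_infty ⟨‖x‖, by
    rintro _ ⟨n, rfl⟩
    exact (NonUnitalStarAlgHom.norm_apply_le θ (x n)).trans
      (lp.norm_apply_le_norm ENNReal.top_ne_zero x n)⟩⟩
  map_smul' c x := lp.ext (funext fun n => map_smul θ c (x n))
  map_zero' := lp.ext (funext fun _ => map_zero θ)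
  map_add' x y := lp.ext (funext fun n => map_add θ (x n) (y n))
  map_mul' x y := lp.ext (funext fun n => map_mul θ (x n) (y n))
  map_star' x := lp.ext (funext fun n => map_star θ (x n))

/-- The `*`-homomorphism `A_∞ → B_∞` induced by componentwise application. -/
def SeqAlgebra.map (θ : A →⋆ₙₐ[ℂ] B) : SeqAlgebra A →⋆ₙₐ[ℂ] SeqAlgebra B :=
  StarIdeal.Quotient.map (seqMap θ) fun x hx =>
    squeeze_zero (fun _ => norm_nonneg _)
      (fun n => NonUnitalStarAlgHom.norm_apply_le θ (x n)) hx

theorem SeqAlgebra.map_toSeqAlgebra (θ : A →⋆ₙₐ[ℂ] B) (a : A) :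
    SeqAlgebra.map θ (toSeqAlgebra A a) = toSeqAlgebra B (θ a) := rfl

variable (A)

/-- The relative commutant `A_∞ ∩ A'`. -/
def relCommutant : NonUnitalStarSubalgebra ℂ (SeqAlgebra A) :=
  NonUnitalStarSubalgebra.centralizer ℂ (Set.range (toSeqAlgebra A))

instance : NormedStarGroup (relCommutant A) where
  norm_star_le x := (norm_star (x : SeqAlgebra A)).le

/-- The two-sided annihilator `Ann(A, A_∞)` as an ideal of `A_∞ ∩ A'`. -/
def annihilator : StarIdeal (relCommutant A) where
  carrier := {x | ∀ a : A, (x : SeqAlgebra A) * toSeqAlgebra A a = 0 ∧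
    toSeqAlgebra A a * (x : SeqAlgebra A) = 0}
  zero_mem' a := by simp
  add_mem' {x y} hx hy a := by
    simp [add_mul, mul_add, (hx a).1, (hx a).2, (hy a).1, (hy a).2]
  smul_mem' c x hx a := by
    simp [smul_mul_assoc, mul_smul_comm, (hx a).1, (hx a).2]
  mul_mem_left' x y hy a := by
    have hx := ((NonUnitalStarSubalgebra.mem_centralizer_iff ℂ).1 x.2 _ ⟨a, rfl⟩).1
    refine ⟨?_, ?_⟩
    · simp [mul_assoc, (hy a).1]
    · rw [NonUnitalStarSubalgebra.coe_mul, ← mul_assoc, hx, mul_assoc, (hy a).2, mul_zero]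
  mul_mem_right' x y hx a := by
    have hy := ((NonUnitalStarSubalgebra.mem_centralizer_iff ℂ).1 y.2 _ ⟨a, rfl⟩).1
    refine ⟨?_, ?_⟩
    · rw [NonUnitalStarSubalgebra.coe_mul, mul_assoc, ← hy, ← mul_assoc, (hx a).1, zero_mul]
    · rw [NonUnitalStarSubalgebra.coe_mul, ← mul_assoc, (hx a).2, zero_mul]
  star_mem' x hx a := by
    refine ⟨?_, ?_⟩
    · have h := congrArg star (hx (star a)).2
      rwa [star_mul, ← map_star, star_star, star_zero] at h
    · have h := congrArg star (hx (star a)).1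
      rwa [star_mul, ← map_star, star_star, star_zero] at h

/-- The central sequence algebra `F_∞(A) = (A_∞ ∩ A') / Ann(A, A_∞)`. -/
abbrev CentralSeqAlgebra : Type _ := (annihilator A).Quotient

end SequenceAlgebra

/-! ### Actions and the Rokhlin property -/

/-- A point-norm continuous action of a topological group on a `C*`-algebra. -/
structure CStarAction (G A : Type*) [Group G] [TopologicalSpace G] [NonUnitalCStarAlgebra A] where
  /-- The action by `*`-automorphisms. -/
  toMonoidHom : G →* (A ≃⋆ₐ[ℂ] A)
  continuous_apply' : ∀ a : A, Continuous fun g => toMonoidHom g a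

namespace CStarAction

variable {G A : Type*} [Group G] [TopologicalSpace G] [NonUnitalCStarAlgebra A]
  (α : CStarAction G A)

/-- The `*`-automorphism `α_g`, as a `*`-homomorphism. -/
def aut (g : G) : A →⋆ₙₐ[ℂ] A := (α.toMonoidHom g : A →⋆ₙₐ[ℂ] A)

theorem aut_mul (g h : G) (a : A) : α.aut (g * h) a = α.aut g (α.aut h a) := by
  simp [aut, map_mul]

theorem aut_one (a : A) : α.aut 1 a = a := by
  simp [aut]

theorem norm_aut (g : G) (a : A) : ‖α.aut g a‖ = ‖a‖ :=
  StarAlgEquiv.norm_map (α.toMonoidHom g) a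

theorem continuous_aut (a : A) : Continuous fun g => α.aut g a := α.continuous_apply' a

theorem continuous_aut_uncurry : Continuous fun p : G × A => α.aut p.1 p.2 := by
  rw [continuous_iff_continuousAt]
  rintro ⟨g, a⟩
  rw [ContinuousAt, tendsto_iff_norm_sub_tendsto_zero]
  have h1 : Filter.Tendsto (fun p : G × A => ‖p.2 - a‖ + ‖α.aut p.1 a - α.aut g a‖)
      (𝓝 (g, a)) (𝓝 0) := by
    have hc : Continuous fun p : G × A => ‖p.2 - a‖ + ‖α.aut p.1 a - α.aut g a‖ := by
      have := (α.continuous_aut a).comp (continuous_fst (X := G) (Y := A))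
      exact ((continuous_snd.sub continuous_const).norm).add ((this.sub continuous_const).norm)
    simpa using hc.tendsto (g, a)
  refine squeeze_zero (fun p => norm_nonneg _) (fun p => ?_) h1
  calc ‖α.aut p.1 p.2 - α.aut g a‖
      = ‖α.aut p.1 (p.2 - a) + (α.aut p.1 a - α.aut g a)‖ := by rw [map_sub]; abel_nf
    _ ≤ ‖α.aut p.1 (p.2 - a)‖ + ‖α.aut p.1 a - α.aut g a‖ := norm_add_le _ _
    _ = _ := by rw [norm_aut]

theorem continuous_aut_comp {Y : Type*} [TopologicalSpace Y]
    {u : Y → G} {v : Y → A} (hu : Continuous u) (hv : Continuous v) :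
    Continuous fun y => α.aut (u y) (v y) := α.continuous_aut_uncurry.comp (hu.prodMk hv)

/-- The fixed point algebra `A^α`. -/
def fixedPoints : NonUnitalStarSubalgebra ℂ A where
  carrier := {a | ∀ g, α.aut g a = a}
  zero_mem' g := map_zero _
  add_mem' ha hb g := by rw [map_add, ha g, hb g]
  smul_mem' c a ha g := by rw [map_smul, ha g]
  mul_mem' ha hb g := by rw [map_mul, ha g, hb g]
  star_mem' ha g := by rw [map_star, ha g]

instance : IsClosed (α.fixedPoints : Set A) := by
  have h : (α.fixedPoints : Set A) = ⋂ g, {a | α.aut g a = a} := by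
    ext a
    rw [Set.mem_iInter]
    exact Iff.rfl
  rw [h]
  refine isClosed_iInter fun g => isClosed_eq ?_ continuous_id
  exact α.continuous_aut_uncurry.comp (Continuous.prodMk_right g)

/-- The inclusion `A^α → A`. -/
def fixedPointsInclusion : α.fixedPoints →⋆ₙₐ[ℂ] A :=
  NonUnitalStarSubalgebraClass.subtype α.fixedPoints

/-- The (in general discontinuous) action `α_∞` on `A_∞`. -/
def seqAut (g : G) : SeqAlgebra A →⋆ₙₐ[ℂ] SeqAlgebra A := SeqAlgebra.map (α.aut g)

theorem toSeqAlgebra_eq_seqAut (g : G) (a : A) :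
    toSeqAlgebra A a = α.seqAut g (toSeqAlgebra A (α.aut g⁻¹ a)) := by
  rw [seqAut, SeqAlgebra.map_toSeqAlgebra, ← aut_mul, mul_inv_cancel, aut_one]

theorem seqAut_mem_relCommutant (g : G) (x : relCommutant A) :
    α.seqAut g (x : SeqAlgebra A) ∈ relCommutant A := by
  have key : ∀ a : A, toSeqAlgebra A a * α.seqAut g (x : SeqAlgebra A) =
      α.seqAut g (x : SeqAlgebra A) * toSeqAlgebra A a := fun a => by
    have hx := ((NonUnitalStarSubalgebra.mem_centralizer_iff ℂ).1 x.2 _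
      ⟨α.aut g⁻¹ a, rfl⟩).1
    rw [α.toSeqAlgebra_eq_seqAut g a, ← map_mul, ← map_mul, hx]
  refine (NonUnitalStarSubalgebra.mem_centralizer_iff ℂ).2 ?_
  rintro _ ⟨a, rfl⟩
  refine ⟨key a, ?_⟩
  rw [← map_star]
  exact key (star a)

/-- The restriction of `α_∞` to `A_∞ ∩ A'`. -/
def commutantAut (g : G) : relCommutant A →⋆ₙₐ[ℂ] relCommutant A :=
  NonUnitalStarAlgHom.codRestrict
    ((α.seqAut g).comp (NonUnitalStarSubalgebraClass.subtype (relCommutant A)))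
    (relCommutant A) (α.seqAut_mem_relCommutant g)

/-- The induced (in general discontinuous) action on `F_∞(A)`. -/
def centralAut (g : G) : CentralSeqAlgebra A →⋆ₙₐ[ℂ] CentralSeqAlgebra A :=
  StarIdeal.Quotient.map (α.commutantAut g) fun x hx a => by
    have h := hx (α.aut g⁻¹ a)
    have e : ((α.commutantAut g x : relCommutant A) : SeqAlgebra A) =
      α.seqAut g (x : SeqAlgebra A) := rfl
    rw [e, α.toSeqAlgebra_eq_seqAut g a, ← map_mul, ← map_mul, h.1, h.2, map_zero]
    exact ⟨rfl, rfl⟩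

/-- The continuous part `F_{∞,α}(A)` of `F_∞(A)`: the elements with norm-continuous orbit maps. -/
def continuousCentral : NonUnitalStarSubalgebra ℂ (CentralSeqAlgebra A) where
  carrier := {x | Continuous fun g => α.centralAut g x}
  zero_mem' := by simpa using continuous_const
  add_mem' {x y} hx hy := by
    simp only [Set.mem_ofPred_eq, map_add] at *
    exact hx.add hy
  smul_mem' c x hx := by
    simp only [Set.mem_ofPred_eq, map_smul] at *
    exact hx.const_smul c
  mul_mem' {x y} hx hy := by
    simp only [Set.mem_ofPred_eq, map_mul] at *
    exact hx.mul hy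
  star_mem' {x} hx := by
    simp only [Set.mem_ofPred_eq, map_star] at *
    exact hx.star

variable [IsTopologicalGroup G]

/-- The shift `σ_g(f) = f(g⁻¹ ·)` on `C(G)`. -/
def shift (g : G) (f : C(G, ℂ)) : C(G, ℂ) := f.comp ⟨fun t => g⁻¹ * t, by fun_prop⟩

/-- The Rokhlin property: there is a unital equivariant `*`-homomorphism from `(C(G), σ)` to
`F_{∞,α}(A)`. -/
def RokhlinProperty [CompactSpace G] : Prop :=
  ∃ φ : C(G, ℂ) →⋆ₙₐ[ℂ] α.continuousCentral,
    (∀ x, φ 1 * x = x ∧ x * φ 1 = x) ∧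
    ∀ g f, (φ (shift g f) : CentralSeqAlgebra A) = α.centralAut g (φ f)

end CStarAction

/-! ### Enveloping `C*`-algebras -/

section Enveloping

/-- A `C*`-seminorm on a complex `*`-algebra. -/
structure CStarSeminorm (X : Type*) [NonUnitalRing X] [StarRing X] [Module ℂ X] extends
    Seminorm ℂ X where
  mul_le' : ∀ x y, toFun (x * y) ≤ toFun x * toFun y
  star_mul_self' : ∀ x, toFun (star x * x) = toFun x * toFun x

/-- A pointwise bounded set of `C*`-seminorms. -/
structure SeminormFamily (X : Type*) [NonUnitalRing X] [StarRing X] [Module ℂ X] where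
  /-- The members of the family. -/
  seminorms : Set (CStarSeminorm X)
  bounded : ∀ x, ∃ C, ∀ p ∈ seminorms, p.toSeminorm x ≤ C

namespace SeminormFamily

variable {X : Type*} [NonUnitalRing X] [StarRing X] [Module ℂ X] (S : SeminormFamily X)

/-- The pointwise supremum of the family. -/
def sup (x : X) : ℝ := ⨆ p : S.seminorms, p.1.toSeminorm x

theorem le_sup {p : CStarSeminorm X} (hp : p ∈ S.seminorms) (x : X) :
    p.toSeminorm x ≤ S.sup x := by
  refine le_ciSup (f := fun p : S.seminorms => p.1.toSeminorm x) ?_ ⟨p, hp⟩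
  obtain ⟨C, hC⟩ := S.bounded x
  refine ⟨C, ?_⟩
  rintro _ ⟨q, rfl⟩
  exact hC q.1 q.2

theorem sup_nonneg (x : X) : 0 ≤ S.sup x := Real.iSup_nonneg fun _ => apply_nonneg _ _

theorem sup_le {x : X} {C : ℝ} (hC : 0 ≤ C) (h : ∀ p ∈ S.seminorms, p.toSeminorm x ≤ C) :
    S.sup x ≤ C := Real.iSup_le (fun p => h p.1 p.2) hC

/-- The supremum of the family is a `C*`-seminorm. -/
def supSeminorm : CStarSeminorm X where
  toSeminorm := Seminorm.ofSMulLE S.sup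
    (le_antisymm (S.sup_le le_rfl fun p _ => (map_zero p.toSeminorm).le) (S.sup_nonneg 0))
    (fun x y => S.sup_le (add_nonneg (S.sup_nonneg x) (S.sup_nonneg y)) fun p hp =>
      (map_add_le_add p.toSeminorm x y).trans (add_le_add (S.le_sup hp x) (S.le_sup hp y)))
    (fun c x => S.sup_le (mul_nonneg (norm_nonneg c) (S.sup_nonneg x)) fun p hp =>
      (map_smul_eq_mul p.toSeminorm c x).le.trans
        (mul_le_mul_of_nonneg_left (S.le_sup hp x) (norm_nonneg c)))
  mul_le' x y := S.sup_le (mul_nonneg (S.sup_nonneg x) (S.sup_nonneg y)) fun p hp =>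
    (p.mul_le' x y).trans (mul_le_mul (S.le_sup hp x) (S.le_sup hp y)
      (apply_nonneg p.toSeminorm y) (S.sup_nonneg x))
  star_mul_self' x := by
    refine le_antisymm ?_ ?_
    · exact S.sup_le (mul_nonneg (S.sup_nonneg x) (S.sup_nonneg x)) fun p hp =>
        (p.star_mul_self' x).le.trans (mul_le_mul (S.le_sup hp x) (S.le_sup hp x)
          (apply_nonneg p.toSeminorm x) (S.sup_nonneg x))
    · change S.sup x * S.sup x ≤ S.sup (star x * x)
      rw [← sq, ← Real.le_sqrt (S.sup_nonneg x) (S.sup_nonneg _)]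
      refine S.sup_le (Real.sqrt_nonneg _) fun p hp => Real.le_sqrt_of_sq_le ?_
      rw [sq]
      exact (p.star_mul_self' x).ge.trans (S.le_sup hp _)

/-- The `*`-algebra `X` with the supremum of the family as its seminorm. -/
def Pre (_S : SeminormFamily X) : Type _ := X

namespace Pre

instance : NonUnitalRing S.Pre := inferInstanceAs (NonUnitalRing X)
instance : StarRing S.Pre := inferInstanceAs (StarRing X)
instance : Module ℂ S.Pre := inferInstanceAs (Module ℂ X)
instance [IsScalarTower ℂ X X] : IsScalarTower ℂ S.Pre S.Pre :=
  inferInstanceAs (IsScalarTower ℂ X X)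
instance [SMulCommClass ℂ X X] : SMulCommClass ℂ S.Pre S.Pre :=
  inferInstanceAs (SMulCommClass ℂ X X)
instance [StarModule ℂ X] : StarModule ℂ S.Pre := inferInstanceAs (StarModule ℂ X)

instance : SeminormedAddCommGroup S.Pre :=
  AddGroupSeminorm.toSeminormedAddCommGroup (E := S.Pre) S.supSeminorm.toAddGroupSeminorm

theorem norm_def (x : S.Pre) : ‖x‖ = S.supSeminorm.toSeminorm x := rfl

instance : NonUnitalSeminormedRing S.Pre :=
  { (inferInstance : SeminormedAddCommGroup S.Pre), (inferInstance : NonUnitalRing S.Pre) with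
    norm_mul_le := S.supSeminorm.mul_le' }

instance : NormedSpace ℂ S.Pre where
  norm_smul_le c x := (map_smul_eq_mul S.supSeminorm.toSeminorm c x).le

theorem norm_star_mul_self (x : S.Pre) : ‖star x * x‖ = ‖x‖ * ‖x‖ :=
  S.supSeminorm.star_mul_self' x

instance : NormedStarGroup S.Pre where
  norm_star_le x := by
    have key : ∀ y : S.Pre, ‖y‖ ≤ ‖star y‖ := fun y => by
      rcases (norm_nonneg y).eq_or_lt with h | h
      · rw [← h]; exact norm_nonneg _
      · have := (norm_star_mul_self S y).symm.le.trans (norm_mul_le (star y) y)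
        exact le_of_mul_le_mul_right this h
    simpa using key (star x)

end Pre

/-- The enveloping `C*`-algebra: the Hausdorff completion of `X` with respect to the supremum of
the family of `C*`-seminorms. -/
def Env : Type _ := UniformSpace.Completion S.Pre

namespace Env

open UniformSpace

instance : NormedAddCommGroup S.Env := inferInstanceAs (NormedAddCommGroup (Completion S.Pre))
instance : CompleteSpace S.Env := inferInstanceAs (CompleteSpace (Completion S.Pre))
instance : NormedSpace ℂ S.Env := inferInstanceAs (NormedSpace ℂ (Completion S.Pre))

theorem continuous_smul_left (c : ℂ) : Continuous fun x : S.Env => c • x :=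
  continuous_const_smul c

variable {S} in
/-- The canonical map from `X` to its enveloping `C*`-algebra. -/
def of (x : S.Pre) : S.Env := (x : Completion S.Pre)

theorem norm_of (x : S.Pre) : ‖of x‖ = ‖x‖ := Completion.norm_coe x

theorem continuous_of : Continuous (of : S.Pre → S.Env) := Completion.continuous_coe _

theorem denseRange_of : DenseRange (of : S.Pre → S.Env) := Completion.denseRange_coe

theorem isDenseInducing_of : IsDenseInducing (of : S.Pre → S.Env) := Completion.isDenseInducing_coe

theorem of_add (x y : S.Pre) : of (x + y) = of x + of y := Completion.coe_add x y

theorem of_zero : of (0 : S.Pre) = 0 := Completion.coe_zero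

theorem of_smul (c : ℂ) (x : S.Pre) : of (c • x) = c • of x := Completion.coe_smul c x

/-- The canonical map as an additive homomorphism. -/
def ofAddHom : S.Pre →+ S.Env where
  toFun := of
  map_zero' := of_zero S
  map_add' := of_add S

instance : Mul S.Env where
  mul := Function.curry (((isDenseInducing_of S).prodMap (isDenseInducing_of S)).extend
    (of ∘ Function.uncurry (· * ·)))

theorem of_mul (x y : S.Pre) : of (x * y) = of x * of y :=
  (((isDenseInducing_of S).prodMap (isDenseInducing_of S)).extend_eq
    ((continuous_of S).comp (continuous_mul (M := S.Pre))) (x, y)).symm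

instance : ContinuousMul S.Env where
  continuous_mul := by
    let m := (AddMonoidHom.mul : S.Pre →+ S.Pre →+ S.Pre).compr₂ (ofAddHom S)
    have h : Continuous fun p : S.Pre × S.Pre => m p.1 p.2 :=
      (continuous_of S).comp continuous_mul
    have di : IsDenseInducing (ofAddHom S) := isDenseInducing_of S
    exact (di.extend_Z_bilin di h :)

instance : Star S.Env where
  star := (isDenseInducing_of S).extend (of ∘ star)

theorem of_star (x : S.Pre) : of (star x) = star (of x) :=
  ((isDenseInducing_of S).extend_eq ((continuous_of S).comp continuous_star) x).symm

theorem isometry_of_star : Isometry (of ∘ star : S.Pre → S.Env) := by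
  refine Isometry.of_dist_eq fun x y => ?_
  have h : ∀ u v : S.Pre, dist (of u) (of v) = dist u v := fun u v => Completion.dist_eq u v
  rw [Function.comp_apply, Function.comp_apply, h, dist_eq_norm, dist_eq_norm, ← star_sub,
    norm_star]

instance : ContinuousStar S.Env where
  continuous_star :=
    (uniformContinuous_uniformly_extend
      (Completion.isUniformInducing_coe S.Pre) (denseRange_of S)
      (isometry_of_star S).uniformContinuous).continuous

variable {S} in
@[elab_as_elim]
theorem induction_on {P : S.Env → Prop} (x : S.Env) (hP : IsClosed {x | P x})
    (h : ∀ x : S.Pre, P (of x)) : P x := Completion.induction_on x hP h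

variable {S} in
@[elab_as_elim]
theorem induction_on₂ {P : S.Env → S.Env → Prop} (x y : S.Env)
    (hP : IsClosed {q : S.Env × S.Env | P q.1 q.2})
    (h : ∀ x y : S.Pre, P (of x) (of y)) : P x y := Completion.induction_on₂ x y hP h

variable {S} in
@[elab_as_elim]
theorem induction_on₃ {P : S.Env → S.Env → S.Env → Prop} (x y z : S.Env)
    (hP : IsClosed {q : S.Env × S.Env × S.Env | P q.1 q.2.1 q.2.2})
    (h : ∀ x y z : S.Pre, P (of x) (of y) (of z)) : P x y z :=
  Completion.induction_on₃ x y z hP h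

instance : NonUnitalRing S.Env where
  __ : AddCommGroup S.Env := inferInstance
  left_distrib x y z := induction_on₃ x y z (isClosed_eq (by fun_prop) (by fun_prop))
    fun x y z => by simp only [← of_add, ← of_mul, mul_add]
  right_distrib x y z := induction_on₃ x y z (isClosed_eq (by fun_prop) (by fun_prop))
    fun x y z => by simp only [← of_add, ← of_mul, add_mul]
  zero_mul x := induction_on x (isClosed_eq (by fun_prop) (by fun_prop))
    fun x => by rw [← of_zero, ← of_mul, zero_mul]
  mul_zero x := induction_on x (isClosed_eq (by fun_prop) (by fun_prop))
    fun x => by rw [← of_zero, ← of_mul, mul_zero]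
  mul_assoc x y z := induction_on₃ x y z (isClosed_eq (by fun_prop) (by fun_prop))
    fun x y z => by simp only [← of_mul, mul_assoc]

theorem norm_mul_le_aux (x y : S.Env) : ‖x * y‖ ≤ ‖x‖ * ‖y‖ :=
  induction_on₂ x y (isClosed_le (by fun_prop) (by fun_prop))
    fun x y => by rw [← of_mul, norm_of, norm_of, norm_of]; exact norm_mul_le x y

instance : NonUnitalNormedRing S.Env :=
  { (inferInstance : NormedAddCommGroup S.Env), (inferInstance : NonUnitalRing S.Env) with
    norm_mul_le := norm_mul_le_aux S }

instance : StarRing S.Env where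
  star_involutive x := induction_on x (isClosed_eq (by fun_prop) (by fun_prop))
    fun x => by rw [← of_star, ← of_star, star_star]
  star_mul x y := induction_on₂ x y (isClosed_eq (by fun_prop) (by fun_prop))
    fun x y => by rw [← of_mul, ← of_star, star_mul, of_mul, of_star, of_star]
  star_add x y := induction_on₂ x y (isClosed_eq (by fun_prop) (by fun_prop))
    fun x y => by rw [← of_add, ← of_star, star_add, of_add, of_star, of_star]

instance : CStarRing S.Env where
  norm_mul_self_le x := induction_on x (isClosed_le (by fun_prop) (by fun_prop))
    fun x => by
      rw [← of_star, ← of_mul, norm_of, norm_of]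
      exact (Pre.norm_star_mul_self S x).ge

variable [IsScalarTower ℂ X X] [SMulCommClass ℂ X X] [StarModule ℂ X]

instance : IsScalarTower ℂ S.Env S.Env where
  smul_assoc c x y := by
    rw [smul_eq_mul, smul_eq_mul]
    induction x, y using induction_on₂ with
    | hP => 
      have hs := continuous_smul_left S c
      exact isClosed_eq ((hs.comp continuous_fst).mul continuous_snd)
        (hs.comp (continuous_fst.mul continuous_snd))
    | h x y => rw [← of_smul, ← of_mul, ← of_mul, ← of_smul, smul_mul_assoc]

instance : SMulCommClass ℂ S.Env S.Env where
  smul_comm c x y := by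
    rw [smul_eq_mul, smul_eq_mul]
    induction x, y using induction_on₂ with
    | hP => 
      have hs := continuous_smul_left S c
      exact isClosed_eq (hs.comp (continuous_fst.mul continuous_snd))
        (continuous_fst.mul (hs.comp continuous_snd))
    | h x y => rw [← of_smul, ← of_mul, ← of_mul, ← of_smul, mul_smul_comm]

instance : StarModule ℂ S.Env where
  star_smul c x := by
    induction x using induction_on with
    | hP => 
      exact isClosed_eq (continuous_star.comp (continuous_smul_left S c))
        ((continuous_smul_left S (star c)).comp continuous_star)
    | h x => rw [← of_smul, ← of_star, star_smul, of_smul, of_star]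

instance : NonUnitalCStarAlgebra S.Env where

/-- The canonical map as a `*`-homomorphism. -/
def ofHom : S.Pre →⋆ₙₐ[ℂ] S.Env where
  toFun := of
  map_smul' := of_smul S
  map_zero' := of_zero S
  map_add' := of_add S
  map_mul' := of_mul S
  map_star' := of_star S

section Map

variable {S}
variable {Y : Type*} [NonUnitalRing Y] [StarRing Y] [Module ℂ Y] [IsScalarTower ℂ Y Y]
  [SMulCommClass ℂ Y Y] [StarModule ℂ Y] {T : SeminormFamily Y}

/-- The extension of a map by continuity. -/
def mapFun (θ : S.Pre →⋆ₙₐ[ℂ] T.Pre) : S.Env → T.Env :=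
  Completion.map (α := S.Pre) (β := T.Pre) θ

/-- The `*`-homomorphism between the enveloping algebras that extends a contractive
`*`-homomorphism. -/
def map (θ : S.Pre →⋆ₙₐ[ℂ] T.Pre) (h : ∀ x, ‖θ x‖ ≤ ‖x‖) : S.Env →⋆ₙₐ[ℂ] T.Env :=
  have hu : UniformContinuous θ :=
    LipschitzWith.uniformContinuous (K := 1) (LipschitzWith.of_dist_le_mul fun x y => by
      rw [dist_eq_norm, dist_eq_norm, NNReal.coe_one, one_mul, ← map_sub]
      exact h _)
  have hc : Continuous (mapFun θ) :=
    Completion.continuous_map (α := S.Pre) (β := T.Pre)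
  have hof : ∀ x, mapFun θ (of x) = of (θ x) :=
    fun x => Completion.map_coe hu x
  { toFun := mapFun θ
    map_smul' := fun c x => by
      rw [MonoidHom.id_apply]
      induction x using induction_on with
      | hP => 
        exact isClosed_eq (hc.comp (continuous_smul_left S c))
          ((continuous_smul_left T c).comp hc)
      | h x => rw [← of_smul, hof, hof, map_smul, of_smul]
    map_zero' := by rw [← of_zero, hof, map_zero, of_zero]
    map_add' := fun x y => by
      induction x, y using induction_on₂ with
      | hP => exact isClosed_eq (by fun_prop) (by fun_prop)
      | h x y => rw [← of_add, hof, hof, hof, map_add, of_add]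
    map_mul' := fun x y => by
      induction x, y using induction_on₂ with
      | hP => exact isClosed_eq (by fun_prop) (by fun_prop)
      | h x y => rw [← of_mul, hof, hof, hof, map_mul, of_mul]
    map_star' := fun x => by
      induction x using induction_on with
      | hP => exact isClosed_eq (by fun_prop) (by fun_prop)
      | h x => rw [← of_star, hof, hof, map_star, of_star] }

end Map

end Env

end SeminormFamily

/-- The pull-back of a `C*`-seminorm along a `*`-homomorphism. -/
def CStarSeminorm.comp {X Y : Type*} [NonUnitalRing X] [StarRing X] [Module ℂ X]
    [NonUnitalRing Y] [StarRing Y] [Module ℂ Y] (p : CStarSeminorm Y) (θ : X →⋆ₙₐ[ℂ] Y) :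
    CStarSeminorm X where
  toSeminorm := p.toSeminorm.comp
    ({ toFun := θ, map_add' := map_add θ, map_smul' := fun c x => map_smul θ c x } : X →ₗ[ℂ] Y)
  mul_le' x y := by
    change p.toSeminorm (θ (x * y)) ≤ p.toSeminorm (θ x) * p.toSeminorm (θ y)
    rw [map_mul]
    exact p.mul_le' _ _
  star_mul_self' x := by
    change p.toSeminorm (θ (star x * x)) = p.toSeminorm (θ x) * p.toSeminorm (θ x)
    rw [map_mul, map_star]
    exact p.star_mul_self' _

/-- A `*`-homomorphism `X → Y`, regarded as one between the seminormed algebras. -/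
def SeminormFamily.Pre.map {X Y : Type*} [NonUnitalRing X] [StarRing X] [Module ℂ X]
    [NonUnitalRing Y] [StarRing Y] [Module ℂ Y] (S : SeminormFamily X) (T : SeminormFamily Y)
    (θ : X →⋆ₙₐ[ℂ] Y) : S.Pre →⋆ₙₐ[ℂ] T.Pre := θ

theorem SeminormFamily.Pre.norm_map_le {X Y : Type*} [NonUnitalRing X] [StarRing X] [Module ℂ X]
    [NonUnitalRing Y] [StarRing Y] [Module ℂ Y] (S : SeminormFamily X) (T : SeminormFamily Y)
    (θ : X →⋆ₙₐ[ℂ] Y) (h : ∀ p ∈ T.seminorms, p.comp θ ∈ S.seminorms) (x : S.Pre) :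
    ‖SeminormFamily.Pre.map S T θ x‖ ≤ ‖x‖ := by
  have key : ∀ x : X, T.sup (θ x) ≤ S.sup x := fun x =>
    T.sup_le (S.sup_nonneg x) fun p hp => S.le_sup (h p hp) x
  exact key x

end Enveloping

/-! ### Crossed products by compact groups -/

section CrossedProduct

variable {G A : Type*} [Group G] [TopologicalSpace G] [IsTopologicalGroup G] [CompactSpace G]
  [SecondCountableTopology G] [MeasurableSpace G] [BorelSpace G] [NonUnitalCStarAlgebra A]

/-- The convolution algebra `C(G, A)` of a dynamical system `(A, α, G)` over a compact group. -/
def ConvAlg (_α : CStarAction G A) (_μ : Measure G) : Type _ := C(G, A)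

namespace ConvAlg

variable (α : CStarAction G A) (μ : Measure G)

instance : AddCommGroup (ConvAlg α μ) := inferInstanceAs (AddCommGroup C(G, A))
instance : Module ℂ (ConvAlg α μ) := inferInstanceAs (Module ℂ C(G, A))
instance : FunLike (ConvAlg α μ) G A := inferInstanceAs (FunLike C(G, A) G A)

/-- A continuous function, as an element of the convolution algebra. -/
def mk (f : C(G, A)) : ConvAlg α μ := f

variable {α μ}

@[ext]
theorem ext {f g : ConvAlg α μ} (h : ∀ t, f t = g t) : f = g := DFunLike.ext f g h

theorem mk_apply (f : C(G, A)) (t : G) : mk α μ f t = f t := rfl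

theorem add_apply (f g : ConvAlg α μ) (t : G) : (f + g) t = f t + g t := rfl

theorem zero_apply (t : G) : (0 : ConvAlg α μ) t = 0 := rfl

theorem smul_apply (c : ℂ) (f : ConvAlg α μ) (t : G) : (c • f) t = c • f t := rfl

theorem continuous_coe (f : ConvAlg α μ) : Continuous f :=
  ContinuousMap.continuous (show C(G, A) from f)

end ConvAlg

/-- A `*`-homomorphism between `C*`-algebras as a continuous linear map. -/
def homL {B : Type*} [NonUnitalCStarAlgebra B] (φ : A →⋆ₙₐ[ℂ] B) : A →L[ℂ] B :=
  LinearMap.mkContinuous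
    { toFun := φ, map_add' := map_add φ, map_smul' := fun c x => map_smul φ c x } 1
    fun a => by
      rw [one_mul]
      exact NonUnitalStarAlgHom.norm_apply_le φ a

namespace ConvAlg

variable {α : CStarAction G A} {μ : Measure G}

theorem continuous_integrand {Y : Type*} [TopologicalSpace Y] (f g : ConvAlg α μ)
    {u v w : Y → G} (hu : Continuous u) (hv : Continuous v) (hw : Continuous w) :
    Continuous fun y => f (u y) * α.aut (v y) (g (w y)) :=
  (f.continuous_coe.comp hu).mul (α.continuous_aut_comp hv (g.continuous_coe.comp hw))

variable [μ.IsHaarMeasure]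

theorem integrable_of_continuous {E : Type*} [NormedAddCommGroup E] {F : G → E}
    (h : Continuous F) : Integrable F μ :=
  h.integrable_of_hasCompactSupport (HasCompactSupport.of_compactSpace F)

/-- The convolution product `(f * g)(t) = ∫ f(s) α_s(g(s⁻¹ t)) ds`. -/
instance : Mul (ConvAlg α μ) where
  mul f g := mk α μ
    { toFun := fun t => ∫ s, f s * α.aut s (g (s⁻¹ * t)) ∂μ
      continuous_toFun := by
        have h := continuous_parametric_integral_of_continuous (μ := μ) (s := Set.univ)
          (f := fun t s => f s * α.aut s (g (s⁻¹ * t)))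
          (continuous_integrand f g continuous_snd continuous_snd
            (continuous_snd.inv.mul continuous_fst)) isCompact_univ
        simpa only [Measure.restrict_univ] using h }

theorem mul_apply (f g : ConvAlg α μ) (t : G) :
    (f * g) t = ∫ s, f s * α.aut s (g (s⁻¹ * t)) ∂μ := rfl

/-- The involution `f^*(t) = α_t(f(t⁻¹)^*)` (compact groups are unimodular). -/
instance : Star (ConvAlg α μ) where
  star f := mk α μ
    { toFun := fun t => α.aut t (star (f t⁻¹))
      continuous_toFun := α.continuous_aut_comp continuous_id
        (f.continuous_coe.comp continuous_inv).star }

theorem star_apply (f : ConvAlg α μ) (t : G) : star f t = α.aut t (star (f t⁻¹)) := rfl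

theorem integrable_integrand (f g : ConvAlg α μ) (t : G) :
    Integrable (fun s => f s * α.aut s (g (s⁻¹ * t))) μ :=
  integrable_of_continuous
    (continuous_integrand f g continuous_id continuous_id (continuous_inv.mul continuous_const))

theorem mul_assoc_aux (f g h : ConvAlg α μ) : f * g * h = f * (g * h) := by
  ext t
  have e1 : ∀ s, (f * g) s * α.aut s (h (s⁻¹ * t)) =
      ∫ r, f r * α.aut r (g (r⁻¹ * s)) * α.aut s (h (s⁻¹ * t)) ∂μ := fun s =>
    (((ContinuousLinearMap.mul ℂ A).flip (α.aut s (h (s⁻¹ * t)))).integral_comp_comm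
      (integrable_integrand f g s)).symm
  have e2 : ∀ r, f r * α.aut r ((g * h) (r⁻¹ * t)) =
      ∫ s, f r * α.aut r (g (r⁻¹ * s)) * α.aut s (h (s⁻¹ * t)) ∂μ := fun r => by
    have i1 := (((ContinuousLinearMap.mul ℂ A (f r)).comp (homL (α.aut r))).integral_comp_comm
      (integrable_integrand g h (r⁻¹ * t))).symm
    have i2 := integral_mul_left_eq_self (μ := μ)
      (fun s => f r * α.aut r (g s * α.aut s (h (s⁻¹ * (r⁻¹ * t))))) r⁻¹
    refine i1.trans (i2.symm.trans (integral_congr_ae (Filter.Eventually.of_forall fun s => ?_)))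
    change f r * α.aut r (g (r⁻¹ * s) * α.aut (r⁻¹ * s) (h ((r⁻¹ * s)⁻¹ * (r⁻¹ * t)))) =
      f r * α.aut r (g (r⁻¹ * s)) * α.aut s (h (s⁻¹ * t))
    have eg : (r⁻¹ * s)⁻¹ * (r⁻¹ * t) = s⁻¹ * t := by group
    rw [map_mul, ← α.aut_mul, mul_inv_cancel_left, mul_assoc, eg]
  rw [mul_apply, mul_apply]
  simp_rw [e1, e2]
  refine integral_integral_swap_of_hasCompactSupport ?_ (HasCompactSupport.of_compactSpace _)
  exact (continuous_integrand f g continuous_snd continuous_snd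
    (continuous_snd.inv.mul continuous_fst)).mul
    (α.continuous_aut_comp continuous_fst (h.continuous_coe.comp
      (continuous_fst.inv.mul continuous_const)))

instance : NonUnitalRing (ConvAlg α μ) where
  __ : AddCommGroup (ConvAlg α μ) := inferInstance
  left_distrib f g h := by
    ext t
    rw [add_apply, mul_apply, mul_apply, mul_apply,
      ← integral_add (integrable_integrand f g t) (integrable_integrand f h t)]
    simp only [add_apply, map_add, mul_add]
  right_distrib f g h := by
    ext t
    rw [add_apply, mul_apply, mul_apply, mul_apply,
      ← integral_add (integrable_integrand f h t) (integrable_integrand g h t)]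
    simp only [add_apply, add_mul]
  zero_mul f := by
    ext t
    simp only [mul_apply, zero_apply, zero_mul, integral_zero]
  mul_zero f := by
    ext t
    simp only [mul_apply, zero_apply, map_zero, mul_zero, integral_zero]
  mul_assoc := mul_assoc_aux

theorem star_mul_aux (f g : ConvAlg α μ) : star (f * g) = star g * star f := by
  ext t
  have i1 : star (∫ s, f s * α.aut s (g (s⁻¹ * t⁻¹)) ∂μ) =
      ∫ s, star (f s * α.aut s (g (s⁻¹ * t⁻¹))) ∂μ :=
    ((starL' ℝ : A ≃L[ℝ] A).toContinuousLinearMap.integral_comp_comm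
      (integrable_integrand f g t⁻¹)).symm
  have i2 := ((homL (α.aut t)).integral_comp_comm (μ := μ)
    (φ := fun s => star (f s * α.aut s (g (s⁻¹ * t⁻¹))))
      (integrable_of_continuous (continuous_integrand f g continuous_id continuous_id
        (continuous_inv.mul continuous_const)).star)).symm
  have i3 := integral_mul_left_eq_self (μ := μ)
      (fun s => α.aut t (star (f s * α.aut s (g (s⁻¹ * t⁻¹))))) t⁻¹
  rw [star_apply, mul_apply, mul_apply, i1]
  refine i2.trans (i3.symm.trans (integral_congr_ae (Filter.Eventually.of_forall fun s => ?_)))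
  change α.aut t (star (f (t⁻¹ * s) * α.aut (t⁻¹ * s) (g ((t⁻¹ * s)⁻¹ * t⁻¹)))) =
    α.aut s (star (g s⁻¹)) * α.aut s (α.aut (s⁻¹ * t) (star (f (s⁻¹ * t)⁻¹)))
  rw [star_mul, map_mul, ← map_star, ← α.aut_mul, ← α.aut_mul, mul_inv_cancel_left,
    mul_inv_cancel_left]
  congr 4 <;> group

instance : StarRing (ConvAlg α μ) where
  star_involutive f := by
    ext t
    rw [star_apply, star_apply, ← map_star, ← α.aut_mul, mul_inv_cancel, α.aut_one, star_star,
      inv_inv]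
  star_mul := star_mul_aux
  star_add f g := by
    ext t
    simp only [star_apply, add_apply, star_add, map_add]

instance : IsScalarTower ℂ (ConvAlg α μ) (ConvAlg α μ) where
  smul_assoc c f g := by
    ext t
    rw [smul_eq_mul, smul_eq_mul, smul_apply, mul_apply, mul_apply, ← integral_smul]
    simp only [smul_apply, smul_mul_assoc]

instance : SMulCommClass ℂ (ConvAlg α μ) (ConvAlg α μ) where
  smul_comm c f g := by
    ext t
    rw [smul_eq_mul, smul_eq_mul, smul_apply, mul_apply, mul_apply, ← integral_smul]
    simp only [smul_apply, map_smul, mul_smul_comm]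

instance : StarModule ℂ (ConvAlg α μ) where
  star_smul c f := by
    ext t
    simp only [star_apply, smul_apply, star_smul, map_smul]

variable (α μ)

/-- The `C*`-seminorms on `C(G, A)` that are dominated by the `L¹`-norm. -/
def seminormFamily : SeminormFamily (ConvAlg α μ) where
  seminorms := {p | ∀ f, p.toSeminorm f ≤ ∫ t, ‖f t‖ ∂μ}
  bounded f := ⟨_, fun _ hp => hp f⟩

end ConvAlg

namespace CStarAction

variable (α : CStarAction G A) (μ : Measure G) [μ.IsHaarMeasure]

/-- The (full) crossed product `A ⋊_α G`, as the enveloping `C*`-algebra of the convolution algebra: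
the completion of `C(G, A)` in the largest `C*`-seminorm dominated by the `L¹`-norm. -/
abbrev CrossedProduct : Type _ := (ConvAlg.seminormFamily α μ).Env

/-- The canonical `*`-homomorphism from the convolution algebra to the crossed product. -/
def toCrossedProduct : ConvAlg α μ →⋆ₙₐ[ℂ] α.CrossedProduct μ :=
  SeminormFamily.Env.ofHom (ConvAlg.seminormFamily α μ)

variable {B : Type*} [NonUnitalCStarAlgebra B] {α} {β : CStarAction G B}

/-- The map `f ↦ φ ∘ f` on convolution algebras induced by an equivariant `*`-homomorphism. -/
def convMap (φ : A →⋆ₙₐ[ℂ] B) (hφ : ∀ g a, φ (α.aut g a) = β.aut g (φ a)) :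
    ConvAlg α μ →⋆ₙₐ[ℂ] ConvAlg β μ where
  toFun f := ConvAlg.mk β μ ⟨fun t => φ (f t),
    (homL φ).continuous.comp f.continuous_coe⟩
  map_smul' c f := ConvAlg.ext fun t => map_smul φ c (f t)
  map_zero' := ConvAlg.ext fun _ => map_zero φ
  map_add' f g := ConvAlg.ext fun t => map_add φ (f t) (g t)
  map_mul' f g := ConvAlg.ext fun t => by
    refine ((homL φ).integral_comp_comm (ConvAlg.integrable_integrand f g t)).symm.trans
      (integral_congr_ae (Filter.Eventually.of_forall fun s => ?_))
    change φ (f s * α.aut s (g (s⁻¹ * t))) = φ (f s) * β.aut s (φ (g (s⁻¹ * t)))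
    rw [map_mul, hφ]
  map_star' f := ConvAlg.ext fun t => by
    change φ (α.aut t (star (f t⁻¹))) = β.aut t (star (φ (f t⁻¹)))
    rw [hφ, map_star]

/-- The `*`-homomorphism `φ ⋊ G : A ⋊_α G → B ⋊_β G` induced by an equivariant `*`-homomorphism
`φ : (A, α) → (B, β)`. -/
def crossedProductMap (φ : A →⋆ₙₐ[ℂ] B) (hφ : ∀ g a, φ (α.aut g a) = β.aut g (φ a)) :
    α.CrossedProduct μ →⋆ₙₐ[ℂ] β.CrossedProduct μ :=
  SeminormFamily.Env.map (SeminormFamily.Pre.map _ _ (convMap μ φ hφ))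
    (SeminormFamily.Pre.norm_map_le _ _ _ fun p hp f => by
      refine (hp (convMap μ φ hφ f)).trans ?_
      refine integral_mono (ConvAlg.integrable_of_continuous (ConvAlg.continuous_coe _).norm)
        (ConvAlg.integrable_of_continuous (ConvAlg.continuous_coe _).norm) fun t => ?_
      exact NonUnitalStarAlgHom.norm_apply_le φ (f t))

end CStarAction

end CrossedProduct

/-! ### The system `(C(G) ⊗ A, σ ⊗ α)` -/

namespace CStarAction

section ShiftTensor

variable {G A : Type*} [Group G] [TopologicalSpace G] [IsTopologicalGroup G] [CompactSpace G]
  [NonUnitalCStarAlgebra A] (α : CStarAction G A)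

/-- The automorphism `(σ ⊗ α)_g` of `C(G) ⊗ A = C(G, A)`, given by `f ↦ (t ↦ α_g(f(g⁻¹ t)))`. -/
def shiftTensorFun (g : G) (f : C(G, A)) : C(G, A) where
  toFun t := α.aut g (f (g⁻¹ * t))
  continuous_toFun := α.continuous_aut_comp continuous_const
    (f.continuous.comp (continuous_const.mul continuous_id))

/-- The action `σ ⊗ α` of `G` on `C(G) ⊗ A = C(G, A)`. -/
def shiftTensor : CStarAction G C(G, A) where
  toMonoidHom :=
    { toFun := fun g =>
        { toFun := α.shiftTensorFun g
          invFun := α.shiftTensorFun g⁻¹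
          left_inv := fun f => ContinuousMap.ext fun t => by
            simp [shiftTensorFun, ← aut_mul, aut_one]
          right_inv := fun f => ContinuousMap.ext fun t => by
            simp [shiftTensorFun, ← aut_mul, aut_one]
          map_mul' := fun f h => ContinuousMap.ext fun t => map_mul (α.aut g) _ _
          map_add' := fun f h => ContinuousMap.ext fun t => map_add (α.aut g) _ _
          map_star' := fun f => ContinuousMap.ext fun t => map_star (α.aut g) _
          map_smul' := fun c f => ContinuousMap.ext fun t => map_smul (α.aut g) c _ }
      map_one' := StarAlgEquiv.ext fun f => ContinuousMap.ext fun t => by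
        change α.aut 1 (f (1⁻¹ * t)) = f t
        rw [aut_one, inv_one, one_mul]
      map_mul' := fun g h => StarAlgEquiv.ext fun f => ContinuousMap.ext fun t => by
        change α.aut (g * h) (f ((g * h)⁻¹ * t)) = α.aut g (α.aut h (f (h⁻¹ * (g⁻¹ * t))))
        rw [aut_mul, mul_inv_rev, mul_assoc] }
  continuous_apply' f := by
    have h : Continuous fun p : G × G => α.aut p.1 (f (p.1⁻¹ * p.2)) :=
      α.continuous_aut_comp continuous_fst
        (f.continuous.comp (continuous_fst.inv.mul continuous_snd))
    exact (ContinuousMap.curry ⟨_, h⟩).continuous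

theorem shiftTensor_aut_apply (g : G) (f : C(G, A)) (t : G) :
    α.shiftTensor.aut g f t = α.aut g (f (g⁻¹ * t)) := rfl

variable (G A) in
/-- The second-factor embedding `A → C(G) ⊗ A = C(G, A)`, by constant functions. -/
def secondFactor : A →⋆ₙₐ[ℂ] C(G, A) where
  toFun a := ContinuousMap.const G a
  map_smul' _ _ := rfl
  map_zero' := rfl
  map_add' _ _ := rfl
  map_mul' _ _ := rfl
  map_star' _ := rfl

theorem secondFactor_equivariant (g : G) (a : A) :
    secondFactor G A (α.aut g a) = α.shiftTensor.aut g (secondFactor G A a) := rfl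

end ShiftTensor

end CStarAction

/-! ### The tensor product `A ⊗ K(H)` -/

section Compacts

theorem isCompactOperator_star {H : Type*} [NormedAddCommGroup H] [InnerProductSpace ℂ H]
    [CompleteSpace H] {T : H →L[ℂ] H} (hT : IsCompactOperator T) :
    IsCompactOperator (star T : H →L[ℂ] H) := by
  have hTT : IsCompactOperator (T * star T : H →L[ℂ] H) := hT.comp_clm (star T)
  refine (isCompactOperator_iff_isCompact_closure_image_closedBall (𝕜₁ := ℂ)
    ((star T : H →L[ℂ] H) : H →ₗ[ℂ] H) one_pos).2 ?_
  have h1 := (isCompactOperator_iff_isCompact_closure_image_closedBall (𝕜₁ := ℂ)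
    ((T * star T : H →L[ℂ] H) : H →ₗ[ℂ] H) one_pos).1 hTT
  have tb : TotallyBounded ((T * star T : H →L[ℂ] H) '' Metric.closedBall 0 1) :=
    h1.totallyBounded.subset subset_closure
  refine TotallyBounded.isCompact_of_isClosed (TotallyBounded.closure ?_) isClosed_closure
  rw [Metric.totallyBounded_iff]
  intro ε hε
  obtain ⟨t, hts, htf, htc⟩ := Metric.finite_approx_of_totallyBounded tb (ε ^ 2 / 2) (by positivity)
  have hts' : ∀ y ∈ t, ∃ v, v ∈ Metric.closedBall (0 : H) 1 ∧ (T * star T) v = y :=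
    fun y hy => hts hy
  choose! u hu using hts'
  refine ⟨(fun y => star T (u y)) '' t, htf.image _, ?_⟩
  rintro _ ⟨x, hx, rfl⟩
  obtain ⟨y, hy, hxy⟩ := Set.mem_iUnion₂.1 (htc ⟨x, hx, rfl⟩)
  refine Set.mem_iUnion₂.2 ⟨_, ⟨y, hy, rfl⟩, ?_⟩
  obtain ⟨hub, huy⟩ := hu y hy
  rw [Metric.mem_ball, dist_eq_norm] at hxy ⊢
  rw [← huy, ← map_sub] at hxy
  change ‖star T x - star T (u y)‖ < ε
  rw [← map_sub]
  set z := x - u y with hz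
  have hz2 : ‖z‖ ≤ 2 := by
    rw [mem_closedBall_zero_iff] at hx hub
    exact (norm_sub_le _ _).trans (by linarith)
  have key : ‖star T z‖ ^ 2 ≤ ‖(T * star T) z‖ * ‖z‖ := by
    have e : RCLike.re (inner ℂ ((T * star T) z) z) = ‖star T z‖ ^ 2 := by
      have : inner ℂ ((T * star T) z) z = inner ℂ (star T z) (star T z) := by
        rw [ContinuousLinearMap.star_eq_adjoint, ContinuousLinearMap.adjoint_inner_right]
        rfl
      rw [this, inner_self_eq_norm_sq]
    rw [← e]
    exact (RCLike.re_le_norm _).trans (norm_inner_le_norm _ _)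
  have : ‖star T z‖ ^ 2 < ε ^ 2 := by
    refine key.trans_lt ?_
    calc ‖(T * star T) z‖ * ‖z‖ ≤ ‖(T * star T) z‖ * 2 := by gcongr
      _ < ε ^ 2 := by linarith
  exact lt_of_pow_lt_pow_left₀ 2 hε.le this

theorem isCompactOperator_rankOne {H : Type*} [NormedAddCommGroup H] [InnerProductSpace ℂ H]
    (ξ η : H) : IsCompactOperator (InnerProductSpace.rankOne ℂ ξ η) := by
  have h : IsCompactOperator (innerSL ℂ η) :=
    isCompactOperator_of_locallyCompactSpace_dom (innerSL ℂ η)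
  exact h.clm_comp (ContinuousLinearMap.toSpanSingleton ℂ ξ)

variable (H : Type*) [NormedAddCommGroup H] [InnerProductSpace ℂ H] [CompleteSpace H]

/-- The `C*`-algebra `K(H)` of compact operators on a Hilbert space. -/
def compacts : NonUnitalStarSubalgebra ℂ (H →L[ℂ] H) where
  carrier := {T | IsCompactOperator T}
  zero_mem' := isCompactOperator_zero
  add_mem' hS hT := hS.add hT
  smul_mem' c _ hT := hT.smul c
  mul_mem' {_ T} hS _ := hS.comp_clm T
  star_mem' hT := isCompactOperator_star hT

instance : IsClosed (compacts H : Set (H →L[ℂ] H)) :=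
  isClosed_setOfPred_isCompactOperator

variable {H} in
/-- The rank-one operator `ζ ↦ ⟨η, ζ⟩ ξ`, as an element of `K(H)`. -/
def rankOneCompact (ξ η : H) : compacts H :=
  ⟨InnerProductSpace.rankOne ℂ ξ η, isCompactOperator_rankOne ξ η⟩

variable (A K : Type*) [NonUnitalCStarAlgebra A] [NonUnitalCStarAlgebra K]

/-- The `C*`-seminorms `p` on the algebraic tensor product `A ⊙ K` with
`p(a ⊗ k) ≤ ‖a‖ ‖k‖` (an inequality that every `C*`-seminorm on `A ⊙ K` satisfies). -/
def tensorSeminorms : SeminormFamily (A ⊗[ℂ] K) where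
  seminorms := {p | ∀ (a : A) (k : K), p.toSeminorm (a ⊗ₜ k) ≤ ‖a‖ * ‖k‖}
  bounded x := by
    induction x using TensorProduct.induction_on with
    | zero => exact ⟨0, fun p _ => (map_zero p.toSeminorm).le⟩
    | tmul a k => exact ⟨_, fun p hp => hp a k⟩
    | add x y hx hy =>
      obtain ⟨C, hC⟩ := hx
      obtain ⟨D, hD⟩ := hy
      exact ⟨C + D, fun p hp => (map_add_le_add p.toSeminorm x y).trans
        (add_le_add (hC p hp) (hD p hp))⟩

/-- The `C*`-tensor product `A ⊗ K`: the completion of the algebraic tensor product in its largest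
`C*`-norm. It is only used where `K` is an algebra of compact operators, which is nuclear, so that
the algebraic tensor product has exactly one `C*`-norm. -/
abbrev CStarTensor : Type _ := (tensorSeminorms A K).Env

variable {A K} in
/-- The elementary tensor `a ⊗ k`. -/
def elemTensor (a : A) (k : K) : CStarTensor A K :=
  SeminormFamily.Env.of (S := tensorSeminorms A K) (a ⊗ₜ[ℂ] k : A ⊗[ℂ] K)

end Compacts

/-! ### The canonical embedding of the crossed product -/

namespace CStarAction

variable {G A : Type*} [Group G] [TopologicalSpace G] [IsTopologicalGroup G] [CompactSpace G]
  [SecondCountableTopology G] [MeasurableSpace G] [BorelSpace G] [NonUnitalCStarAlgebra A]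
  (α : CStarAction G A) (μ : Measure G) [μ.IsHaarMeasure]

/-- For `a ∈ A` and `ξ, η ∈ C(G)`, the element `s ↦ (t ↦ ξ(t) conj(η(s⁻¹ t)) α_t(a))` of
`C(G, C(G, A))`. -/
def kernelElement (a : A) (ξ η : C(G, ℂ)) : ConvAlg α.shiftTensor μ :=
  ConvAlg.mk α.shiftTensor μ (ContinuousMap.curry
    { toFun := fun p : G × G => (ξ p.2 * star (η (p.1⁻¹ * p.2))) • α.aut p.2 a
      continuous_toFun := by
        have h := (α.continuous_aut a).comp (continuous_snd (X := G) (Y := G))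
        have h2 : Continuous fun p : G × G => ξ p.2 * star (η (p.1⁻¹ * p.2)) := by fun_prop
        exact h2.smul h })

/-- The canonical isomorphism `(C(G) ⊗ A) ⋊_{σ ⊗ α} G ≅ A ⊗ K(L²(G))`. It is the composition of the
isomorphism with `(C(G) ⊗ A) ⋊_{σ ⊗ id} G` that is induced by the conjugacy
`f ↦ (t ↦ α_t(f(t)))` from `σ ⊗ id` to `σ ⊗ α`, and of the isomorphism
`(C(G) ⊗ A) ⋊_{σ ⊗ id} G ≅ A ⊗ K(L²(G))` given by multiplication operators and left translations.
So it sends `f ∈ C(G, C(G, A))` to the operator with the `A`-valued kernel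
`k(t, r) = α_t⁻¹(f(t r⁻¹)(t))`. The predicate says this for the `f` whose kernel is of the form
`k(t, r) = ξ(t) conj(η(r)) a`; these `f` span a dense subspace. -/
def IsCanonicalIso
    (Φ : α.shiftTensor.CrossedProduct μ ≃⋆ₐ[ℂ] CStarTensor A (compacts (Lp ℂ 2 μ))) : Prop :=
  ∀ (a : A) (ξ η : C(G, ℂ)),
    Φ (α.shiftTensor.toCrossedProduct μ (α.kernelElement μ a ξ η)) =
      elemTensor a (rankOneCompact (ContinuousMap.toLp 2 μ ℂ ξ) (ContinuousMap.toLp 2 μ ℂ η))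

/-- The `*`-homomorphism `A ⋊_α G → A ⊗ K(L²(G))` given by an isomorphism
`(C(G) ⊗ A) ⋊_{σ ⊗ α} G ≅ A ⊗ K(L²(G))` and induced by the equivariant second-factor embedding
`A → C(G) ⊗ A`. -/
def crossedProductEmbedding
    (Φ : α.shiftTensor.CrossedProduct μ ≃⋆ₐ[ℂ] CStarTensor A (compacts (Lp ℂ 2 μ))) :
    α.CrossedProduct μ →⋆ₙₐ[ℂ] CStarTensor A (compacts (Lp ℂ 2 μ)) :=
  (Φ : α.shiftTensor.CrossedProduct μ →⋆ₙₐ[ℂ] CStarTensor A (compacts (Lp ℂ 2 μ))).comp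
    (crossedProductMap μ (secondFactor G A) α.secondFactor_equivariant)

end CStarAction

end RokhlinSplit

end

/-!
The Rokhlin property and multiplication `F_∞(A) × A → A_∞` give an equivariant `*`-homomorphism
`ψ : C(G, A) → A_∞` that extends the embedding of `A` as constant functions.

For the fixed point algebra, compose `ψ` with `a ↦ (t ↦ α_t(a))`. The image consists of fixed points
of `A_∞`, and averaging representing sequences over `G` shows that these come from `(A^α)_∞`.

For the crossed product, integrating lifts of `ψ ∘ F` turns `ψ` into a `*`-homomorphism
`C(G, A) ⋊ G → (A ⋊ G)_∞`, which splits the map induced by the second-factor embedding.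

For the canonical isomorphism, the kernel functions in `C(G, C(G, A))` and the elements
`a ⊗ |ξ⟩⟨η|` multiply like matrix units. Hence, for `ξ` orthonormal in `L²(G)`, matrices over `A`
embed in both algebras, and the norms of the entries control the elements up to a constant. The
`C*`-identity removes the constant: if `‖T x‖ ≤ C q(x)` for a `*`-homomorphism `T` and a
submultiplicative `q`, apply this to powers of `x* x` and take roots. So the identification of
matrix units is contractive in both directions and extends to the completions.
-/

noncomputable section

namespace RokhlinSplit

open scoped ENNReal TensorProduct
open MeasureTheory Topology

/-! ### Automatic contractivity -/

section AutomaticContractivity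

theorem le_of_forall_two_pow_le {a b K : ℝ} (hb : 0 ≤ b)
    (h : ∀ k : ℕ, a ^ 2 ^ k ≤ K * b ^ 2 ^ k) : a ≤ b := by
  by_contra! hab
  rcases hb.eq_or_lt with rfl | hb
  · exact hab.not_ge (by simpa using h 0)
  · have hr : 1 < a / b := (one_lt_div hb).2 hab
    obtain ⟨n, hn⟩ := pow_unbounded_of_one_lt K hr
    have hK : (a / b) ^ 2 ^ n ≤ K := by
      rw [div_pow, div_le_iff₀ (by positivity)]
      exact h n
    exact absurd (hn.trans_le (pow_le_pow_right₀ hr.le Nat.lt_two_pow_self.le)) hK.not_gt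

variable {R B : Type*} [Mul R] [Star R] [NonUnitalNormedRing B] [StarRing B] [CStarRing B]
  {T : R → B} {q q' : R → ℝ}

theorem norm_mul_sq_le_norm_star_mul_self_mul (b c : B) : ‖b * c‖ ^ 2 ≤ ‖c‖ * ‖star b * b * c‖ :=
  calc ‖b * c‖ ^ 2 = ‖star c * (star b * b * c)‖ := by
        rw [sq, ← CStarRing.norm_star_mul_self, star_mul]
        simp only [mul_assoc]
    _ ≤ ‖c‖ * ‖star b * b * c‖ := (norm_mul_le _ _).trans_eq (by rw [norm_star])

theorem norm_mul_two_pow_le (hmul : ∀ x y, T (x * y) = T x * T y)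
    (hstar : ∀ x, T (star x) = star (T x)) (hq : ∀ x, q (star x * x) ≤ q x ^ 2)
    (hq0 : ∀ x, 0 ≤ q x) (hq' : ∀ x y, q' (x * y) ≤ q x * q' y) (hT : ∀ x, ‖T x‖ ≤ q' x)
    (k : ℕ) (x z : R) :
    ‖T x * T z‖ ^ 2 ^ k * ‖T z‖ ≤ q' z * (‖T z‖ * q x) ^ 2 ^ k := by
  induction k generalizing x with
  | zero =>
    have hxz : ‖T x * T z‖ ≤ q x * q' z := by
      rw [← hmul]
      exact (hT _).trans (hq' x z)
    calc ‖T x * T z‖ ^ 2 ^ 0 * ‖T z‖ ≤ q x * q' z * ‖T z‖ := by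
          rw [pow_zero, pow_one]
          gcongr
      _ = q' z * (‖T z‖ * q x) ^ 2 ^ 0 := by ring
  | succ k ih =>
    have hz : 0 ≤ q' z := (norm_nonneg _).trans (hT z)
    calc ‖T x * T z‖ ^ 2 ^ (k + 1) * ‖T z‖ = (‖T x * T z‖ ^ 2) ^ 2 ^ k * ‖T z‖ := by
          rw [← pow_mul, pow_succ']
      _ ≤ (‖T z‖ * ‖T (star x * x) * T z‖) ^ 2 ^ k * ‖T z‖ := by
          gcongr
          rw [hmul, hstar]
          exact norm_mul_sq_le_norm_star_mul_self_mul _ _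
      _ = ‖T z‖ ^ 2 ^ k * (‖T (star x * x) * T z‖ ^ 2 ^ k * ‖T z‖) := by ring
      _ ≤ ‖T z‖ ^ 2 ^ k * (q' z * (‖T z‖ * q (star x * x)) ^ 2 ^ k) :=
          mul_le_mul_of_nonneg_left (ih _) (by positivity)
      _ ≤ ‖T z‖ ^ 2 ^ k * (q' z * (‖T z‖ * q x ^ 2) ^ 2 ^ k) := by
          have := hq0 (star x * x)
          gcongr
          exact hq x
      _ = q' z * (‖T z‖ * q x) ^ 2 ^ (k + 1) := by rw [pow_succ' 2 k, pow_mul]; ring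

/-- Typically `q' = C * q`: the constant disappears on taking `2 ^ k`-th roots. -/
theorem norm_le_of_norm_le_module_norm (hmul : ∀ x y, T (x * y) = T x * T y)
    (hstar : ∀ x, T (star x) = star (T x)) (hq : ∀ x, q (star x * x) ≤ q x ^ 2)
    (hq0 : ∀ x, 0 ≤ q x) (hq' : ∀ x y, q' (x * y) ≤ q x * q' y) (hT : ∀ x, ‖T x‖ ≤ q' x)
    (x : R) : ‖T x‖ ≤ q x := by
  rcases (norm_nonneg (T x)).eq_or_lt with hx | hx
  · exact hx ▸ hq0 x
  have hnorm : ‖T (star x)‖ = ‖T x‖ := by rw [hstar, norm_star]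
  have hmain : ‖T x * T (star x)‖ ≤ ‖T (star x)‖ * q x := by
    refine le_of_forall_two_pow_le (K := q' (star x) / ‖T (star x)‖)
      (mul_nonneg (norm_nonneg _) (hq0 x)) fun k => ?_
    rw [div_mul_eq_mul_div, le_div_iff₀ (hnorm ▸ hx)]
    exact norm_mul_two_pow_le hmul hstar hq hq0 hq' hT k x (star x)
  rw [hstar, CStarRing.norm_self_mul_star, norm_star] at hmain
  exact le_of_mul_le_mul_left hmain hx

end AutomaticContractivity

/-! ### The sequence algebra is a `C*`-algebra -/

section SeqAlgebraCStar

variable {A : Type*} [NonUnitalCStarAlgebra A]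

open StarIdeal.Quotient (mk)

namespace SeqAlgebra

theorem mk_eq_mk_iff {x y : lp (fun _ : ℕ => A) ∞} :
    (mk x : SeqAlgebra A) = mk y ↔
      Filter.Tendsto (fun n => ‖x n - y n‖) Filter.atTop (𝓝 0) :=
  StarIdeal.Quotient.mk_eq_mk

theorem eventually_norm_le {x : lp (fun _ : ℕ => A) ∞} {c : ℝ} (h : ‖(mk x : SeqAlgebra A)‖ ≤ c)
    {ε : ℝ} (hε : 0 < ε) : ∀ᶠ n in Filter.atTop, ‖x n‖ ≤ c + ε := by
  obtain ⟨y, hyx, hy⟩ := StarIdeal.Quotient.exists_norm_lt (mk x : SeqAlgebra A) (half_pos hε)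
  filter_upwards [(mk_eq_mk_iff.1 hyx).eventually (gt_mem_nhds (half_pos hε))] with n hn
  have hyn : ‖y n‖ ≤ ‖y‖ := lp.norm_apply_le_norm ENNReal.top_ne_zero y n
  have hxn : ‖x n‖ ≤ ‖y n‖ + ‖y n - x n‖ := norm_le_norm_add_norm_sub _ _
  linarith

theorem norm_mk_le_of_eventually {x : lp (fun _ : ℕ => A) ∞} {c : ℝ} (hc : 0 ≤ c)
    (h : ∀ ε > 0, ∀ᶠ n in Filter.atTop, ‖x n‖ ≤ c + ε) : ‖(mk x : SeqAlgebra A)‖ ≤ c := by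
  refine le_of_forall_pos_le_add fun ε hε => ?_
  obtain ⟨N, hN⟩ := Filter.eventually_atTop.1 (h ε hε)
  have hbound : ∀ n, ‖(if n < N then 0 else x n : A)‖ ≤ c + ε := fun n => by
    split_ifs with hn
    · rw [norm_zero]
      positivity
    · exact hN n (not_lt.1 hn)
  let tail : lp (fun _ : ℕ => A) ∞ := ⟨fun n => if n < N then 0 else x n,
    memℓp_infty ⟨c + ε, by rintro _ ⟨n, rfl⟩; exact hbound n⟩⟩
  have htail : (mk x : SeqAlgebra A) = mk tail := by
    rw [mk_eq_mk_iff]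
    refine tendsto_const_nhds.congr' ?_
    filter_upwards [Filter.eventually_ge_atTop N] with n hn
    change (0 : ℝ) = ‖x n - (if n < N then 0 else x n : A)‖
    rw [if_neg (not_lt.2 hn), sub_self, norm_zero]
  rw [htail]
  exact (StarIdeal.Quotient.norm_mk_le tail).trans (lp.norm_le_of_forall_le (by positivity) hbound)

theorem mk_eq_zero_of_norm_eq_zero {x : lp (fun _ : ℕ => A) ∞} (h : ‖(mk x : SeqAlgebra A)‖ = 0) :
    (mk x : SeqAlgebra A) = 0 := by
  refine mk_eq_mk_iff.2 (Metric.tendsto_nhds.2 fun ε hε => ?_)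
  filter_upwards [eventually_norm_le h.le (half_pos hε)] with n hn
  rw [Real.dist_eq, sub_zero, abs_norm, lp.coeFn_zero, Pi.zero_apply, sub_zero]
  linarith

instance : NormedAddCommGroup (SeqAlgebra A) :=
  { (inferInstance : SeminormedAddCommGroup (SeqAlgebra A)) with
    eq_of_dist_eq_zero := by
      intro x y hxy
      obtain ⟨z, hz⟩ := StarIdeal.Quotient.mk_surjective (x - y)
      refine sub_eq_zero.1 (hz ▸ mk_eq_zero_of_norm_eq_zero ?_)
      rw [hz, ← hxy]
      exact (dist_eq_norm x y).symm }

instance : NonUnitalNormedRing (SeqAlgebra A) :=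
  { (inferInstance : NormedAddCommGroup (SeqAlgebra A)),
    (inferInstance : NonUnitalSeminormedRing (SeqAlgebra A)) with }

instance : CompleteSpace (SeqAlgebra A) :=
  inferInstanceAs (CompleteSpace (lp (fun _ : ℕ => A) ∞ ⧸ (nullSequences A).toSubmodule))

instance : CStarRing (SeqAlgebra A) where
  norm_mul_self_le x := by
    obtain ⟨x, rfl⟩ := StarIdeal.Quotient.mk_surjective x
    rw [← StarIdeal.Quotient.mk_star, ← StarIdeal.Quotient.mk_mul]
    set r := ‖(mk (star x * x) : SeqAlgebra A)‖ with hr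
    have hr0 : 0 ≤ r := norm_nonneg _
    rw [← sq, ← Real.le_sqrt (norm_nonneg _) hr0]
    refine norm_mk_le_of_eventually (Real.sqrt_nonneg _) fun ε hε => ?_
    filter_upwards [eventually_norm_le hr.ge (sq_pos_of_pos hε)] with n hn
    have hsq : ‖x n‖ ^ 2 ≤ r + ε ^ 2 := by
      rw [sq, ← CStarRing.norm_star_mul_self]
      exact hn
    refine le_of_sq_le_sq (hsq.trans ?_) (by positivity)
    nlinarith [Real.sq_sqrt hr0, Real.sqrt_nonneg r]

instance : NonUnitalCStarAlgebra (SeqAlgebra A) where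

end SeqAlgebra

end SeqAlgebraCStar

/-! ### Partitions of unity and vector-valued functions -/

section Density

open scoped ComplexOrder

variable {X : Type*} [TopologicalSpace X]

/-- A finite partition of unity on `X`, with complex-valued functions indexed by points of `X`. -/
structure IsPartition (s : Finset X) (h : X → C(X, ℂ)) : Prop where
  nonneg : ∀ j, 0 ≤ h j
  sum_eq_one : ∑ j ∈ s, h j = 1

theorem IsPartition.sum_norm_apply {s : Finset X} {h : X → C(X, ℂ)} (hh : IsPartition s h) (x : X) :
    ∑ j ∈ s, ‖h j x‖ = 1 := by
  have hx := congrArg (fun f : C(X, ℂ) => f x) hh.sum_eq_one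
  rw [ContinuousMap.sum_apply, ContinuousMap.one_apply] at hx
  rw [← Complex.ofReal_inj, Complex.ofReal_sum, Complex.ofReal_one, ← hx]
  exact Finset.sum_congr rfl fun j _ => RCLike.norm_of_nonneg' (hh.nonneg j x)

theorem exists_isPartition [CompactSpace X] [T2Space X] {E : Type*} [SeminormedAddCommGroup E]
    (F : C(X, E)) {ε : ℝ} (hε : 0 < ε) :
    ∃ (s : Finset X) (h : X → C(X, ℂ)), IsPartition s h ∧
      ∀ j x, h j x ≠ 0 → ‖F x - F j‖ < ε := by
  let U : X → Set X := fun j => {x | ‖F x - F j‖ < ε}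
  have hU : ∀ j, IsOpen (U j) := fun j =>
    isOpen_lt ((F.continuous.sub continuous_const).norm) continuous_const
  have hcover : (Set.univ : Set X) ⊆ ⋃ j, U j := fun x _ =>
    Set.mem_iUnion.2 ⟨x, by simpa [U] using hε⟩
  obtain ⟨p, hp⟩ := PartitionOfUnity.exists_isSubordinate isClosed_univ U hU hcover
  have hfin : {j | (Function.support (p j)).Nonempty}.Finite := by
    simpa using p.locallyFinite.finite_nonempty_inter_compact isCompact_univ
  refine ⟨hfin.toFinset, fun j => ⟨fun x => (p j x : ℂ), by fun_prop⟩,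
    ⟨fun j x => Complex.zero_le_real.2 (p.nonneg j x), ?_⟩, fun j x hx => ?_⟩
  · ext x
    have hsum : ∑ j ∈ hfin.toFinset, p j x = 1 := by
      rw [← p.sum_eq_one (Set.mem_univ x)]
      refine (finsum_eq_sum_of_support_subset _ fun j hj => ?_).symm
      rw [Set.Finite.coe_toFinset]
      exact ⟨x, hj⟩
    rw [ContinuousMap.sum_apply, ContinuousMap.one_apply, ← Complex.ofReal_one, ← hsum,
      Complex.ofReal_sum]
    rfl
  · exact hp j (subset_tsupport _ fun h0 => hx (Complex.ofReal_eq_zero.2 h0))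

variable {E : Type*} [NormedAddCommGroup E] [NormedSpace ℂ E]

variable (X E) in
/-- The bilinear map `(f, e) ↦ (x ↦ f(x) e)`. -/
def smulConst : C(X, ℂ) →ₗ[ℂ] E →ₗ[ℂ] C(X, E) :=
  LinearMap.mk₂ ℂ (fun f e => ⟨fun x => f x • e, f.continuous.smul continuous_const⟩)
    (fun f g e => ContinuousMap.ext fun x => add_smul (f x) (g x) e)
    (fun c f e => ContinuousMap.ext fun x => smul_assoc c (f x) e)
    (fun f e e' => ContinuousMap.ext fun x => smul_add (f x) e e')
    (fun c f e => ContinuousMap.ext fun x => smul_comm (f x) c e)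

theorem smulConst_apply (f : C(X, ℂ)) (e : E) (x : X) : smulConst X E f e x = f x • e := rfl

variable (X E) in
/-- The canonical map `C(X) ⊙ E → C(X, E)`. -/
def tensorToFun : C(X, ℂ) ⊗[ℂ] E →ₗ[ℂ] C(X, E) := TensorProduct.lift (smulConst X E)

theorem norm_sub_partition_sum_le (F : C(X, E)) {ε : ℝ} {s : Finset X} {h : X → C(X, ℂ)}
    (hh : IsPartition s h) (hF : ∀ j x, h j x ≠ 0 → ‖F x - F j‖ < ε) (x : X) :
    ‖F x - ∑ j ∈ s, h j x • F j‖ ≤ ε := by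
  have hone : ∑ j ∈ s, h j x = 1 := by
    rw [← ContinuousMap.sum_apply, hh.sum_eq_one, ContinuousMap.one_apply]
  have hsum : F x - ∑ j ∈ s, h j x • F j = ∑ j ∈ s, h j x • (F x - F j) := by
    simp only [smul_sub, Finset.sum_sub_distrib]
    rw [← Finset.sum_smul, hone, one_smul]
  rw [hsum]
  calc ‖∑ j ∈ s, h j x • (F x - F j)‖ ≤ ∑ j ∈ s, ‖h j x‖ * ε := by
        refine norm_sum_le_of_le _ fun j _ => ?_
        rw [norm_smul]
        by_cases hx : h j x = 0
        · simp [hx]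
        · exact mul_le_mul_of_nonneg_left (hF j x hx).le (norm_nonneg _)
    _ = ε := by rw [← Finset.sum_mul, hh.sum_norm_apply, one_mul]

variable [CompactSpace X]

theorem norm_smulConst_le (f : C(X, ℂ)) (e : E) : ‖smulConst X E f e‖ ≤ ‖f‖ * ‖e‖ := by
  rw [ContinuousMap.norm_le _ (by positivity)]
  intro x
  rw [smulConst_apply, norm_smul]
  exact mul_le_mul_of_nonneg_right (f.norm_coe_le_norm x) (norm_nonneg _)

variable [T2Space X]

theorem denseRange_tensorToFun : DenseRange (tensorToFun X E) := by
  rw [Metric.denseRange_iff]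
  intro F ε hε
  obtain ⟨s, h, hh, hF⟩ := exists_isPartition F (half_pos hε)
  refine ⟨∑ j ∈ s, h j ⊗ₜ F j, ?_⟩
  rw [dist_eq_norm, map_sum]
  refine lt_of_le_of_lt ?_ (half_lt_self hε)
  rw [ContinuousMap.norm_le _ (by positivity)]
  intro x
  rw [ContinuousMap.sub_apply, ContinuousMap.sum_apply]
  exact norm_sub_partition_sum_le F hh hF x

theorem continuousMap_induction {P : C(X, E) → Prop} (hcl : IsClosed {F | P F})
    (hadd : ∀ F F', P F → P F' → P (F + F')) (hsmul : ∀ f e, P (smulConst X E f e))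
    (F : C(X, E)) : P F := by
  refine denseRange_tensorToFun.induction_on (p := P) F hcl fun x => ?_
  induction x using TensorProduct.induction_on with
  | zero => simpa using hsmul 0 0
  | tmul f e => exact hsmul f e
  | add x y hx hy =>
    rw [map_add]
    exact hadd _ _ hx hy

theorem continuousLinearMap_ext {Y : Type*} [NormedAddCommGroup Y] [NormedSpace ℂ Y]
    {S T : C(X, E) →L[ℂ] Y} (h : ∀ f e, S (smulConst X E f e) = T (smulConst X E f e)) :
    S = T := by
  ext1 F
  induction F using continuousMap_induction with
  | hcl => exact isClosed_eq S.continuous T.continuous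
  | hadd F F' hF hF' => rw [map_add, map_add, hF, hF']
  | hsmul f e => exact h f e

end Density

/-! ### Integration over a compact group -/

section Haar

variable {G : Type*} [Group G] [TopologicalSpace G] [IsTopologicalGroup G] [CompactSpace G]
  [MeasurableSpace G] [BorelSpace G]
  (μ : Measure G) [μ.IsHaarMeasure] [IsProbabilityMeasure μ]

theorem isMulRightInvariant_of_compactSpace : μ.IsMulRightInvariant where
  map_mul_right_eq_self g := by
    have := Measure.isProbabilityMeasure_map (μ := μ) (f := (· * g)) (by fun_prop)
    exact Measure.isHaarMeasure_eq_of_isProbabilityMeasure _ μ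

theorem isInvInvariant_of_compactSpace : μ.IsInvInvariant where
  inv_eq_self := by
    have := isMulRightInvariant_of_compactSpace μ
    have : IsProbabilityMeasure μ.inv := Measure.isProbabilityMeasure_map (by fun_prop)
    have : μ.inv.IsOpenPosMeasure :=
      continuous_inv.isOpenPosMeasure_map inv_surjective
    have : μ.inv.IsHaarMeasure := {}
    exact Measure.isHaarMeasure_eq_of_isProbabilityMeasure _ μ

theorem integral_inv_mul_eq_self {E : Type*} [NormedAddCommGroup E] [NormedSpace ℝ E] (f : G → E)
    (t : G) : ∫ s, f (s⁻¹ * t) ∂μ = ∫ s, f s ∂μ := by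
  have := isMulRightInvariant_of_compactSpace μ
  have := isInvInvariant_of_compactSpace μ
  rw [integral_inv_eq_self (fun s => f (s * t)) μ, integral_mul_right_eq_self]

theorem eventually_integral_le [SecondCountableTopology G] {h : ℕ → G → ℝ}
    (hc : ∀ n, Continuous (h n)) {C : ℝ} (hC : ∀ n s, |h n s| ≤ C) {M : ℝ}
    (hM : ∀ s, ∀ ε > 0, ∀ᶠ n in Filter.atTop, h n s ≤ M + ε) {ε : ℝ} (hε : 0 < ε) :
    ∀ᶠ n in Filter.atTop, ∫ s, h n s ∂μ ≤ M + ε := by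
  have hexc : ∀ n, Continuous fun s => max (h n s - M) 0 := fun n =>
    ((hc n).sub continuous_const).max continuous_const
  have hlim : Filter.Tendsto (fun n => ∫ s, max (h n s - M) 0 ∂μ) Filter.atTop
      (𝓝 (∫ _, (0 : ℝ) ∂μ)) := by
    refine tendsto_integral_of_dominated_convergence (fun _ => C + |M|)
      (fun n => (hexc n).aestronglyMeasurable) (integrable_const _)
      (fun n => Filter.Eventually.of_forall fun s => ?_) (Filter.Eventually.of_forall fun s => ?_)
    · obtain ⟨-, hle⟩ := abs_le.1 (hC n s)
      rw [Real.norm_of_nonneg (le_max_right _ _)]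
      exact max_le (by linarith [neg_abs_le M])
        (add_nonneg ((abs_nonneg _).trans (hC n s)) (abs_nonneg M))
    · rw [Metric.tendsto_nhds]
      intro δ hδ
      filter_upwards [hM s (δ / 2) (half_pos hδ)] with n hn
      rw [Real.dist_eq, sub_zero, abs_of_nonneg (le_max_right _ _)]
      exact max_lt (by linarith) hδ
  rw [integral_zero] at hlim
  filter_upwards [hlim.eventually (gt_mem_nhds hε)] with n hn
  have hint : Integrable (fun s => max (h n s - M) 0) μ :=
    ConvAlg.integrable_of_continuous (hexc n)
  calc ∫ s, h n s ∂μ ≤ ∫ s, (M + max (h n s - M) 0) ∂μ :=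
        integral_mono (ConvAlg.integrable_of_continuous (hc n)) ((integrable_const _).add hint)
          fun s => by linarith [le_max_left (h n s - M) 0]
    _ = M + ∫ s, max (h n s - M) 0 ∂μ := by
        rw [integral_add (integrable_const _) hint, integral_const, probReal_univ, one_smul]
    _ ≤ M + ε := by linarith

end Haar

/-! ### The universal property of `C(X, A)` -/

theorem tendsto_star_mul_mul_approximateUnit {A : Type*} [NonUnitalCStarAlgebra A] [PartialOrder A]
    [StarOrderedRing A] (a : A) :
    Filter.Tendsto (fun b => star b * a * b) (CStarAlgebra.approximateUnit A) (𝓝 a) := by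
  have hl := CStarAlgebra.increasingApproximateUnit A
  have hlim : Filter.Tendsto (fun b => ‖a * b - a‖ + ‖b * a - a‖) (CStarAlgebra.approximateUnit A)
      (𝓝 0) := by
    simpa using ((hl.tendsto_mul_left a).sub_const a).norm.add
      ((hl.tendsto_mul_right a).sub_const a).norm
  refine tendsto_iff_norm_sub_tendsto_zero.2 (squeeze_zero' (Filter.Eventually.of_forall fun _ =>
    norm_nonneg _) ?_ hlim)
  filter_upwards [hl.eventually_norm, hl.eventually_star_eq] with b hb hstar
  calc ‖star b * a * b - a‖ = ‖b * (a * b - a) + (b * a - a)‖ := by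
        rw [hstar, mul_sub, mul_assoc, sub_add_sub_cancel]
    _ ≤ 1 * ‖a * b - a‖ + ‖b * a - a‖ :=
        (norm_add_le _ _).trans (by gcongr; exact (norm_mul_le _ _).trans (by gcongr))
    _ = ‖a * b - a‖ + ‖b * a - a‖ := by rw [one_mul]

section FunctionAlgebra

open scoped ComplexOrder

variable {X : Type*} [TopologicalSpace X]
  {A D : Type*} [NonUnitalCStarAlgebra A] [NonUnitalCStarAlgebra D]

/-- A bilinear map `C(X) × A → D` that is multiplicative and star-preserving, like the one given by
a pair of commuting `*`-homomorphisms. -/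
structure CommutingPair (θ : C(X, ℂ) →ₗ[ℂ] A →ₗ[ℂ] D) : Prop where
  mul_apply : ∀ f g a b, θ f a * θ g b = θ (f * g) (a * b)
  star_apply : ∀ f a, star (θ f a) = θ (star f) (star a)

theorem commutingPair_smulConst [CompactSpace X] : CommutingPair (smulConst X A) where
  mul_apply f g a b := ContinuousMap.ext fun x => smul_mul_smul_comm (f x) a (g x) b
  star_apply f a := ContinuousMap.ext fun x => star_smul (f x) a

namespace CommutingPair

variable {θ : C(X, ℂ) →ₗ[ℂ] A →ₗ[ℂ] D}

theorem norm_one_apply_le (hθ : CommutingPair θ) (a : A) : ‖θ 1 a‖ ≤ ‖a‖ := by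
  let T : A →⋆ₙₐ[ℂ] D :=
    { toFun := θ 1
      map_smul' := fun c a => map_smul (θ 1) c a
      map_zero' := map_zero (θ 1)
      map_add' := map_add (θ 1)
      map_mul' := fun a b => by rw [hθ.mul_apply, one_mul]
      map_star' := fun a => by rw [hθ.star_apply, star_one] }
  exact NonUnitalStarAlgHom.norm_apply_le T a

variable [CompactSpace X]

theorem lift_mul (hθ : CommutingPair θ) (x y : C(X, ℂ) ⊗[ℂ] A) :
    TensorProduct.lift θ (x * y) = TensorProduct.lift θ x * TensorProduct.lift θ y := by
  induction x using TensorProduct.induction_on with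
  | zero => simp
  | add x x' hx hx' => rw [add_mul, map_add, hx, hx', map_add, add_mul]
  | tmul f a =>
    induction y using TensorProduct.induction_on with
    | zero => simp
    | add y y' hy hy' => rw [mul_add, map_add, hy, hy', map_add, mul_add]
    | tmul g b =>
      rw [Algebra.TensorProduct.tmul_mul_tmul]
      exact (hθ.mul_apply f g a b).symm

theorem lift_star (hθ : CommutingPair θ) (x : C(X, ℂ) ⊗[ℂ] A) :
    TensorProduct.lift θ (star x) = star (TensorProduct.lift θ x) := by
  induction x using TensorProduct.induction_on with
  | zero => simp
  | add x x' hx hx' => rw [star_add, map_add, hx, hx', map_add, star_add]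
  | tmul f a => exact (hθ.star_apply f a).symm

theorem apply_nonneg [PartialOrder A] [StarOrderedRing A] [PartialOrder D] [StarOrderedRing D]
    (hθ : CommutingPair θ) {f : C(X, ℂ)} (hf : 0 ≤ f) {a : A} (ha : 0 ≤ a) : 0 ≤ θ f a := by
  obtain ⟨g, rfl⟩ := CStarAlgebra.nonneg_iff_eq_star_mul_self.1 hf
  obtain ⟨d, rfl⟩ := CStarAlgebra.nonneg_iff_eq_star_mul_self.1 ha
  rw [← hθ.mul_apply, ← hθ.star_apply]
  exact star_mul_self_nonneg _

theorem norm_apply_le (hθ : CommutingPair θ) (f : C(X, ℂ)) (a : A) : ‖θ f a‖ ≤ ‖f‖ * ‖a‖ := by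
  let _ := CStarAlgebra.spectralOrder A
  have := CStarAlgebra.spectralOrderedRing A
  let _ := CStarAlgebra.spectralOrder D
  have := CStarAlgebra.spectralOrderedRing D
  have hf : 0 ≤ ((‖f‖ ^ 2 : ℝ) : ℂ) • (1 : C(X, ℂ)) - star f * f := fun x => by
    have hx : star (f x) * f x = ((‖f x‖ ^ 2 : ℝ) : ℂ) := by
      rw [Complex.star_def, ← Complex.normSq_eq_conj_mul_self, Complex.normSq_eq_norm_sq]
    change (0 : ℂ) ≤ ((‖f‖ ^ 2 : ℝ) : ℂ) • (1 : ℂ) - star (f x) * f x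
    rw [hx, smul_eq_mul, mul_one, ← Complex.ofReal_sub, Complex.zero_le_real, sub_nonneg]
    gcongr
    exact f.norm_coe_le_norm x
  have hle : star (θ f a) * θ f a ≤ ((‖f‖ ^ 2 : ℝ) : ℂ) • θ 1 (star a * a) := by
    rw [← sub_nonneg, hθ.star_apply, hθ.mul_apply, ← LinearMap.smul_apply, ← map_smul,
      ← LinearMap.sub_apply, ← map_sub]
    exact hθ.apply_nonneg hf (star_mul_self_nonneg a)
  refine le_of_sq_le_sq ?_ (by positivity)
  calc ‖θ f a‖ ^ 2 = ‖star (θ f a) * θ f a‖ := by rw [CStarRing.norm_star_mul_self, sq]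
    _ ≤ ‖((‖f‖ ^ 2 : ℝ) : ℂ) • θ 1 (star a * a)‖ :=
        CStarAlgebra.norm_le_norm_of_nonneg_of_le (star_mul_self_nonneg _) hle
    _ ≤ ‖f‖ ^ 2 * ‖star a * a‖ := by
        rw [norm_smul, Complex.norm_real, Real.norm_of_nonneg (by positivity)]
        gcongr
        exact hθ.norm_one_apply_le _
    _ = (‖f‖ * ‖a‖) ^ 2 := by rw [CStarRing.norm_star_mul_self]; ring

theorem continuous_apply (hθ : CommutingPair θ) (f : C(X, ℂ)) : Continuous (θ f) :=
  AddMonoidHomClass.continuous_of_bound (θ f) ‖f‖ (hθ.norm_apply_le f)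

section Positive

variable [PartialOrder A] [StarOrderedRing A] {s : Finset X} {h : X → C(X, ℂ)} {a : X → A} {M : ℝ}

theorem norm_partition_conj_le (hθ : CommutingPair θ) (hh : IsPartition s h) (hM : 0 ≤ M)
    (ha0 : ∀ j, 0 ≤ a j) (ha : ∀ j, ‖a j‖ ≤ M) {b : A} (hb : ‖b‖ ≤ 1) :
    ‖∑ j ∈ s, θ (h j) (star b * a j * b)‖ ≤ M := by
  let _ := CStarAlgebra.spectralOrder D
  have := CStarAlgebra.spectralOrderedRing D
  have hconj : ∀ j, star b * a j * b ≤ (M : ℂ) • (star b * b) := fun j =>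
    (CStarAlgebra.star_left_conjugate_le_norm_smul (ha0 j).isSelfAdjoint).trans <| by
      have := smul_le_smul_of_nonneg_right (ha j) (star_mul_self_nonneg b)
      simpa only [Complex.coe_smul] using this
  have hnonneg : 0 ≤ ∑ j ∈ s, θ (h j) (star b * a j * b) := Finset.sum_nonneg fun j _ =>
    hθ.apply_nonneg (hh.nonneg j) (star_left_conjugate_nonneg (ha0 j) b)
  have hle : ∑ j ∈ s, θ (h j) (star b * a j * b) ≤ (M : ℂ) • θ 1 (star b * b) :=
    calc _ ≤ ∑ j ∈ s, θ (h j) ((M : ℂ) • (star b * b)) := Finset.sum_le_sum fun j _ => by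
          rw [← sub_nonneg, ← map_sub]
          exact hθ.apply_nonneg (hh.nonneg j) (sub_nonneg.2 (hconj j))
      _ = (M : ℂ) • θ 1 (star b * b) := by
          rw [← LinearMap.sum_apply, ← map_sum, hh.sum_eq_one, map_smul]
  calc _ ≤ ‖(M : ℂ) • θ 1 (star b * b)‖ := CStarAlgebra.norm_le_norm_of_nonneg_of_le hnonneg hle
    _ ≤ M * ‖star b * b‖ := by
        rw [norm_smul, Complex.norm_real, Real.norm_of_nonneg hM]
        gcongr
        exact hθ.norm_one_apply_le _
    _ ≤ M * 1 := by
        rw [CStarRing.norm_star_mul_self]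
        gcongr
        exact mul_le_one₀ hb (norm_nonneg b) hb
    _ = M := mul_one M

theorem norm_partition_sum_le (hθ : CommutingPair θ) (hh : IsPartition s h) (hM : 0 ≤ M)
    (ha0 : ∀ j, 0 ≤ a j) (ha : ∀ j, ‖a j‖ ≤ M) : ‖∑ j ∈ s, θ (h j) (a j)‖ ≤ M := by
  have hlim : Filter.Tendsto (fun b => ‖∑ j ∈ s, θ (h j) (star b * a j * b)‖)
      (CStarAlgebra.approximateUnit A) (𝓝 ‖∑ j ∈ s, θ (h j) (a j)‖) :=
    (tendsto_finsetSum _ fun j _ => ((hθ.continuous_apply (h j)).tendsto (a j)).comp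
      (tendsto_star_mul_mul_approximateUnit (a j))).norm
  refine le_of_tendsto hlim ?_
  filter_upwards [(CStarAlgebra.increasingApproximateUnit A).eventually_norm] with b hb
  exact hθ.norm_partition_conj_le hh hM ha0 ha hb

end Positive

variable [T2Space X]

theorem exists_norm_lift_sub_partition_sum_le (hθ : CommutingPair θ) (x : C(X, ℂ) ⊗[ℂ] A) {ε : ℝ}
    (hε : 0 < ε) : ∃ (s : Finset X) (h : X → C(X, ℂ)), IsPartition s h ∧
      ‖TensorProduct.lift θ x - ∑ j ∈ s, θ (h j) (tensorToFun X A x j)‖ ≤ ε := by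
  obtain ⟨S, hS⟩ := TensorProduct.exists_finset x
  set K : ℝ := ∑ i ∈ S, ‖i.2‖ with hK
  have hδ : 0 < ε / (K + 1) := by positivity
  let F : C(X, S → ℂ) := ContinuousMap.pi fun i => i.1.1
  obtain ⟨s, h, hh, hF⟩ := exists_isPartition F hδ
  have happrox : ∀ i ∈ S, ‖i.1 - ∑ j ∈ s, i.1 j • h j‖ ≤ ε / (K + 1) := fun i hi => by
    refine (ContinuousMap.norm_le _ hδ.le).2 fun t => ?_
    have hcoord : (i.1 - ∑ j ∈ s, i.1 j • h j) t = (F t - ∑ j ∈ s, h j t • F j) ⟨i, hi⟩ := by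
      rw [ContinuousMap.sub_apply, ContinuousMap.sum_apply, Pi.sub_apply, Finset.sum_apply]
      exact congrArg (i.1 t - ·) (Finset.sum_congr rfl fun j _ => mul_comm _ _)
    rw [hcoord]
    exact (norm_le_pi_norm _ _).trans (norm_sub_partition_sum_le F hh hF t)
  have hlift : TensorProduct.lift θ x = ∑ i ∈ S, θ i.1 i.2 := by
    rw [hS, map_sum]
    rfl
  have hval : ∀ j, tensorToFun X A x j = ∑ i ∈ S, i.1 j • i.2 := fun j => by
    rw [hS, map_sum, ContinuousMap.sum_apply]
    rfl
  refine ⟨s, h, hh, ?_⟩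
  calc _ = ‖∑ i ∈ S, θ (i.1 - ∑ j ∈ s, i.1 j • h j) i.2‖ := by
        simp only [hlift, hval, map_sum, map_smul, map_sub, LinearMap.sub_apply,
          LinearMap.sum_apply, LinearMap.smul_apply, Finset.sum_sub_distrib]
        rw [Finset.sum_comm]
    _ ≤ ∑ i ∈ S, ε / (K + 1) * ‖i.2‖ := norm_sum_le_of_le _ fun i hi =>
        (hθ.norm_apply_le _ _).trans (mul_le_mul_of_nonneg_right (happrox i hi) (norm_nonneg _))
    _ = ε * (K / (K + 1)) := by rw [← Finset.mul_sum, ← hK]; ring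
    _ ≤ ε * 1 := by
        gcongr
        exact div_le_one_of_le₀ (by linarith) (by positivity)
    _ = ε := mul_one ε

theorem norm_lift_le_of_nonneg [PartialOrder A] [StarOrderedRing A] (hθ : CommutingPair θ)
    {x : C(X, ℂ) ⊗[ℂ] A} (hx : ∀ t, 0 ≤ tensorToFun X A x t) :
    ‖TensorProduct.lift θ x‖ ≤ ‖tensorToFun X A x‖ := by
  refine le_of_forall_pos_le_add fun ε hε => ?_
  obtain ⟨s, h, hh, hsub⟩ := hθ.exists_norm_lift_sub_partition_sum_le x hε
  exact (norm_le_insert' _ _).trans <| add_le_add (hθ.norm_partition_sum_le hh (norm_nonneg _) hx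
    fun j => ContinuousMap.norm_coe_le_norm _ j) hsub

theorem norm_lift_le (hθ : CommutingPair θ) (x : C(X, ℂ) ⊗[ℂ] A) :
    ‖TensorProduct.lift θ x‖ ≤ ‖tensorToFun X A x‖ := by
  let _ := CStarAlgebra.spectralOrder A
  have := CStarAlgebra.spectralOrderedRing A
  have hfun : tensorToFun X A (star x * x) = star (tensorToFun X A x) * tensorToFun X A x := by
    rw [tensorToFun, commutingPair_smulConst.lift_mul, commutingPair_smulConst.lift_star]
  have hle := hθ.norm_lift_le_of_nonneg (x := star x * x) fun t => by
    rw [hfun]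
    exact star_mul_self_nonneg (tensorToFun X A x t)
  rw [hfun, hθ.lift_mul, hθ.lift_star, CStarRing.norm_star_mul_self,
    CStarRing.norm_star_mul_self] at hle
  exact le_of_sq_le_sq (by simpa only [sq] using hle) (norm_nonneg _)

theorem exists_hom (hθ : CommutingPair θ) :
    ∃ ψ : C(X, A) →⋆ₙₐ[ℂ] D, ∀ f a, ψ (smulConst X A f a) = θ f a := by
  let T : C(X, A) →L[ℂ] D := (TensorProduct.lift θ).extendOfNorm (tensorToFun X A)
  have hT : ∀ f a, T (smulConst X A f a) = θ f a := fun f a =>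
    LinearMap.extendOfNorm_eq (denseRange_tensorToFun (X := X) (E := A))
      ⟨1, fun x => by rw [one_mul]; exact hθ.norm_lift_le x⟩ (f ⊗ₜ a)
  refine ⟨{ toFun := T
            map_smul' := fun c x => map_smul T c x
            map_zero' := map_zero T
            map_add' := map_add T
            map_mul' := fun F F' => ?_
            map_star' := fun F => ?_ }, hT⟩
  · induction F using continuousMap_induction with
    | hcl => exact isClosed_eq (by fun_prop) (by fun_prop)
    | hadd F₁ F₂ h₁ h₂ => rw [add_mul, map_add, h₁, h₂, map_add, add_mul]
    | hsmul f a =>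
      induction F' using continuousMap_induction with
      | hcl => exact isClosed_eq (by fun_prop) (by fun_prop)
      | hadd F₁ F₂ h₁ h₂ => rw [mul_add, map_add, h₁, h₂, map_add, mul_add]
      | hsmul g b => rw [commutingPair_smulConst.mul_apply, hT, hT, hT, hθ.mul_apply]
  · induction F using continuousMap_induction with
    | hcl => exact isClosed_eq (by fun_prop) (by fun_prop)
    | hadd F₁ F₂ h₁ h₂ => rw [star_add, map_add, h₁, h₂, map_add, star_add]
    | hsmul f a => rw [commutingPair_smulConst.star_apply, hT, hT, hθ.star_apply]

end CommutingPair

end FunctionAlgebra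

/-! ### The action of the central sequence algebra on `A` -/

section CentralAction

open StarIdeal.Quotient (mk)

theorem tendsto_apply_of_denseRange {E ι κ : Type*} [PseudoMetricSpace E] {l : Filter ι}
    {T : ι → E → E} (hT : ∀ i, LipschitzWith 1 (T i)) {d : κ → E} (hd : DenseRange d)
    (h : ∀ k, Filter.Tendsto (fun i => T i (d k)) l (𝓝 (d k))) (x : E) :
    Filter.Tendsto (fun i => T i x) l (𝓝 x) :=
  have hclosed : IsClosed {x | Filter.Tendsto (fun i => T i x) l (𝓝 x)} :=
    (LipschitzWith.uniformEquicontinuous T 1 hT).equicontinuous.isClosed_setOfPred_tendsto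
      continuous_id
  hd.induction_on x hclosed h

variable {A : Type*} [NonUnitalCStarAlgebra A]

variable (A) in
theorem exists_sequential_approximateUnit [TopologicalSpace.SeparableSpace A] :
    ∃ e : ℕ → A, (∀ n, ‖e n‖ ≤ 1) ∧
      ∀ a, Filter.Tendsto (fun n => e n * a) Filter.atTop (𝓝 a) ∧
        Filter.Tendsto (fun n => a * e n) Filter.atTop (𝓝 a) := by
  let _ := CStarAlgebra.spectralOrder A
  have := CStarAlgebra.spectralOrderedRing A
  have hu := CStarAlgebra.increasingApproximateUnit A
  have : Nonempty A := ⟨0⟩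
  let d := TopologicalSpace.denseSeq A
  have hd : DenseRange d := TopologicalSpace.denseRange_denseSeq A
  let Φ : A → ℕ → A × A := fun b k => (b * d k, d k * b)
  -- Separability enters here: the neighbourhood filter in `ℕ → A × A` is countably generated.
  let l : Filter A := Filter.comap Φ (𝓝 fun k => (d k, d k)) ⊓ Filter.principal {b | ‖b‖ ≤ 1}
  have hul : CStarAlgebra.approximateUnit A ≤ l := by
    refine le_inf (Filter.map_le_iff_le_comap.1 (tendsto_pi_nhds.2 fun k => ?_))
      (Filter.le_principal_iff.2 hu.eventually_norm)
    exact (hu.tendsto_mul_right (d k)).prodMk_nhds (hu.tendsto_mul_left (d k))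
  have : l.NeBot := Filter.neBot_of_le hul
  obtain ⟨e, he⟩ := l.exists_seq_tendsto
  obtain ⟨heΦ, hnorm⟩ := Filter.tendsto_inf.1 he
  obtain ⟨N, hN⟩ := Filter.eventually_atTop.1 (Filter.tendsto_principal.1 hnorm)
  have hlim := fun k => (tendsto_pi_nhds.1 (Filter.tendsto_comap_iff.1 heΦ) k).comp
    (Filter.tendsto_add_atTop_nat N)
  have hnorm' : ∀ n, ‖e (n + N)‖ ≤ 1 := fun n => hN _ (Nat.le_add_left N n)
  refine ⟨fun n => e (n + N), hnorm', fun a => ⟨?_, ?_⟩⟩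
  · refine tendsto_apply_of_denseRange (T := fun n a => e (n + N) * a)
      (fun n => LipschitzWith.of_dist_le_mul fun a b => ?_) hd
      (fun k => (continuous_fst.tendsto _).comp (hlim k)) a
    rw [dist_eq_norm, dist_eq_norm, ← mul_sub]
    exact (norm_mul_le _ _).trans (by gcongr; exact hnorm' n)
  · refine tendsto_apply_of_denseRange (T := fun n a => a * e (n + N))
      (fun n => LipschitzWith.of_dist_le_mul fun a b => ?_) hd
      (fun k => (continuous_snd.tendsto _).comp (hlim k)) a
    rw [dist_eq_norm, dist_eq_norm, ← sub_mul, mul_comm]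
    exact (norm_mul_le _ _).trans (by gcongr; exact hnorm' n)

theorem relCommutant_comm (x : relCommutant A) (a : A) :
    toSeqAlgebra A a * (x : SeqAlgebra A) = (x : SeqAlgebra A) * toSeqAlgebra A a :=
  ((NonUnitalStarSubalgebra.mem_centralizer_iff ℂ).1 x.2 _ ⟨a, rfl⟩).1

variable (A) in
theorem exists_relCommutant_unit [TopologicalSpace.SeparableSpace A] :
    ∃ e : relCommutant A, ∀ a, (e : SeqAlgebra A) * toSeqAlgebra A a = toSeqAlgebra A a := by
  obtain ⟨e, he1, he⟩ := exists_sequential_approximateUnit A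
  let x : lp (fun _ : ℕ => A) ∞ := ⟨e, memℓp_infty ⟨1, by rintro _ ⟨n, rfl⟩; exact he1 n⟩⟩
  have hleft : ∀ a, (mk x : SeqAlgebra A) * toSeqAlgebra A a = toSeqAlgebra A a := fun a =>
    SeqAlgebra.mk_eq_mk_iff.2 (tendsto_iff_norm_sub_tendsto_zero.1 (he a).1)
  have hright : ∀ a, toSeqAlgebra A a * (mk x : SeqAlgebra A) = toSeqAlgebra A a := fun a =>
    SeqAlgebra.mk_eq_mk_iff.2 (tendsto_iff_norm_sub_tendsto_zero.1 (he a).2)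
  refine ⟨⟨mk x, (NonUnitalStarSubalgebra.mem_centralizer_iff ℂ).2 ?_⟩, hleft⟩
  rintro _ ⟨a, rfl⟩
  rw [← map_star]
  exact ⟨by rw [hleft, hright], by rw [hleft, hright]⟩

variable (A) in
/-- The product `A_∞ ∩ A' × A → A_∞`, `(x, a) ↦ x a`. -/
def commutantMul : relCommutant A →ₗ[ℂ] A →ₗ[ℂ] SeqAlgebra A :=
  LinearMap.mk₂ ℂ (fun x a => (x : SeqAlgebra A) * toSeqAlgebra A a)
    (fun x y a => by simp [add_mul]) (fun c x a => by simp [smul_mul_assoc])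
    (fun x a b => by simp [mul_add]) (fun c x a => by simp [mul_smul_comm])

variable (A) in
/-- The product `F_∞(A) × A → A_∞` induced by `commutantMul`. -/
def centralMul : CentralSeqAlgebra A →ₗ[ℂ] A →ₗ[ℂ] SeqAlgebra A :=
  (annihilator A).toSubmodule.liftQ (commutantMul A) fun _ hx =>
    LinearMap.ext fun a => (hx a).1

theorem centralMul_mk (x : relCommutant A) (a : A) :
    centralMul A (mk x) a = (x : SeqAlgebra A) * toSeqAlgebra A a := rfl

theorem centralMul_mul_centralMul (x y : CentralSeqAlgebra A) (a b : A) :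
    centralMul A x a * centralMul A y b = centralMul A (x * y) (a * b) := by
  obtain ⟨x, rfl⟩ := StarIdeal.Quotient.mk_surjective x
  obtain ⟨y, rfl⟩ := StarIdeal.Quotient.mk_surjective y
  rw [← StarIdeal.Quotient.mk_mul, centralMul_mk, centralMul_mk, centralMul_mk, map_mul,
    NonUnitalStarSubalgebra.coe_mul]
  simp only [mul_assoc]
  rw [← mul_assoc (toSeqAlgebra A a), relCommutant_comm, mul_assoc]

theorem star_centralMul (x : CentralSeqAlgebra A) (a : A) :
    star (centralMul A x a) = centralMul A (star x) (star a) := by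
  obtain ⟨x, rfl⟩ := StarIdeal.Quotient.mk_surjective x
  rw [← StarIdeal.Quotient.mk_star, centralMul_mk, centralMul_mk, star_mul, ← map_star,
    ← relCommutant_comm]
  rfl

end CentralAction

/-! ### The Rokhlin property -/

namespace CStarAction

theorem secondFactor_eq_smulConst_one {X A : Type*} [TopologicalSpace X] [NonUnitalCStarAlgebra A]
    (a : A) : secondFactor X A a = smulConst X A 1 a :=
  ContinuousMap.ext fun _ => (one_smul ℂ a).symm

section CentralAutomorphisms

variable {G A : Type*} [Group G] [TopologicalSpace G] [NonUnitalCStarAlgebra A]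
  (α : CStarAction G A)

theorem seqAut_centralMul (g : G) (x : CentralSeqAlgebra A) (a : A) :
    α.seqAut g (centralMul A x a) = centralMul A (α.centralAut g x) (α.aut g a) := by
  obtain ⟨x, rfl⟩ := StarIdeal.Quotient.mk_surjective x
  rw [centralMul_mk, map_mul]
  rfl

theorem continuous_seqAut (g : G) : Continuous (α.seqAut g) := (homL (α.seqAut g)).continuous

theorem centralAut_mk_eq_self {e : relCommutant A}
    (he : ∀ a, (e : SeqAlgebra A) * toSeqAlgebra A a = toSeqAlgebra A a) (g : G) :
    α.centralAut g (StarIdeal.Quotient.mk e) = StarIdeal.Quotient.mk e := by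
  have hmul : ∀ a, ((α.commutantAut g e - e : relCommutant A) : SeqAlgebra A) *
      toSeqAlgebra A a = 0 := fun a => by
    change (α.seqAut g (e : SeqAlgebra A) - (e : SeqAlgebra A)) * toSeqAlgebra A a = 0
    rw [sub_mul, he]
    nth_rw 1 [α.toSeqAlgebra_eq_seqAut g a]
    rw [← map_mul, he, ← α.toSeqAlgebra_eq_seqAut, sub_self]
  exact StarIdeal.Quotient.mk_eq_mk.2 fun a => ⟨hmul a, by rw [relCommutant_comm, hmul]⟩

theorem centralMul_eq_toSeqAlgebra [TopologicalSpace.SeparableSpace A] {p : α.continuousCentral}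
    (hp : ∀ x, p * x = x) (a : A) : centralMul A p a = toSeqAlgebra A a := by
  obtain ⟨e, he⟩ := exists_relCommutant_unit A
  have hmem : (StarIdeal.Quotient.mk e : CentralSeqAlgebra A) ∈ α.continuousCentral := by
    change Continuous fun g => α.centralAut g (StarIdeal.Quotient.mk e)
    simp_rw [α.centralAut_mk_eq_self he]
    exact continuous_const
  have hpe : (p : CentralSeqAlgebra A) * StarIdeal.Quotient.mk e = StarIdeal.Quotient.mk e :=
    congrArg Subtype.val (hp ⟨StarIdeal.Quotient.mk e, hmem⟩)
  obtain ⟨x, hx⟩ := StarIdeal.Quotient.mk_surjective (p : CentralSeqAlgebra A)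
  calc centralMul A p a = centralMul A ((p : CentralSeqAlgebra A) * StarIdeal.Quotient.mk e) a := by
        rw [← hx, ← StarIdeal.Quotient.mk_mul, centralMul_mk, centralMul_mk,
          NonUnitalStarSubalgebra.coe_mul, mul_assoc, he]
    _ = toSeqAlgebra A a := by rw [hpe, centralMul_mk, he]

end CentralAutomorphisms

section CentralPair

variable {G A : Type*} [Group G] [TopologicalSpace G] [NonUnitalCStarAlgebra A]
  {α : CStarAction G A}

/-- The map `f ⊗ a ↦ φ(f) a` on `C(G) ⊙ A`. -/
def centralPair (φ : C(G, ℂ) →⋆ₙₐ[ℂ] α.continuousCentral) :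
    C(G, ℂ) →ₗ[ℂ] A →ₗ[ℂ] SeqAlgebra A :=
  centralMul A ∘ₗ
    { toFun := fun f => (φ f : CentralSeqAlgebra A)
      map_add' := fun f g => by rw [map_add]; rfl
      map_smul' := fun c f => by rw [map_smul]; rfl }

theorem centralPair_apply (φ : C(G, ℂ) →⋆ₙₐ[ℂ] α.continuousCentral) (f : C(G, ℂ)) (a : A) :
    centralPair φ f a = centralMul A (φ f) a := rfl

theorem commutingPair_centralPair (φ : C(G, ℂ) →⋆ₙₐ[ℂ] α.continuousCentral) :
    CommutingPair (centralPair φ) where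
  mul_apply f g a b := by
    have hmul : (φ (f * g) : CentralSeqAlgebra A) = φ f * φ g :=
      congrArg Subtype.val (φ.map_mul' f g)
    exact (centralMul_mul_centralMul _ _ a b).trans (congrArg (centralMul A · (a * b)) hmul.symm)
  star_apply f a := by
    have hstar : (φ (star f) : CentralSeqAlgebra A) = star (φ f : CentralSeqAlgebra A) :=
      congrArg Subtype.val (φ.map_star' f)
    exact (star_centralMul _ a).trans (congrArg (centralMul A · (star a)) hstar.symm)

end CentralPair

variable {G A : Type*} [Group G] [TopologicalSpace G] [IsTopologicalGroup G] [CompactSpace G]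
  [NonUnitalCStarAlgebra A] {α : CStarAction G A}

theorem shiftTensor_aut_smulConst (g : G) (f : C(G, ℂ)) (a : A) :
    α.shiftTensor.aut g (smulConst G A f a) = smulConst G A (shift g f) (α.aut g a) :=
  ContinuousMap.ext fun _ => map_smul (α.aut g) _ a

theorem RokhlinProperty.exists_hom [T2Space G] [TopologicalSpace.SeparableSpace A]
    (hα : α.RokhlinProperty) :
    ∃ ψ : C(G, A) →⋆ₙₐ[ℂ] SeqAlgebra A, (∀ a, ψ (secondFactor G A a) = toSeqAlgebra A a) ∧
      ∀ g F, ψ (α.shiftTensor.aut g F) = α.seqAut g (ψ F) := by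
  obtain ⟨φ, hφ1, hφ⟩ := hα
  obtain ⟨ψ, hψ⟩ := (commutingPair_centralPair φ).exists_hom
  refine ⟨ψ, fun a => ?_, fun g F => ?_⟩
  · rw [secondFactor_eq_smulConst_one, hψ, centralPair_apply]
    exact α.centralMul_eq_toSeqAlgebra (fun x => (hφ1 x).1) a
  · have hψc : Continuous ψ := (homL ψ).continuous
    induction F using continuousMap_induction with
    | hcl =>
      exact isClosed_eq (hψc.comp (homL (α.shiftTensor.aut g)).continuous)
        ((α.continuous_seqAut g).comp hψc)
    | hadd F₁ F₂ h₁ h₂ => rw [map_add, map_add, h₁, h₂, map_add, map_add]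
    | hsmul f a =>
      rw [shiftTensor_aut_smulConst, hψ, hψ, centralPair_apply, centralPair_apply, hφ,
        seqAut_centralMul]

end CStarAction

/-! ### The fixed point algebra -/

theorem exists_factorization {A B D : Type*} [NonUnitalNonAssocSemiring A] [Module ℂ A] [Star A]
    [NonUnitalNonAssocSemiring B] [Module ℂ B] [Star B] [NonUnitalNonAssocSemiring D] [Module ℂ D]
    [Star D] (ι : B →⋆ₙₐ[ℂ] D) (hι : Function.Injective ι) (T : A →⋆ₙₐ[ℂ] D)
    (hT : ∀ a, ∃ b, ι b = T a) : ∃ S : A →⋆ₙₐ[ℂ] B, ∀ a, ι (S a) = T a := by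
  choose S hS using hT
  exact ⟨{ toFun := S
           map_smul' := fun c a => hι (by simp only [MonoidHom.id_apply, map_smul, hS])
           map_zero' := hι (by simp only [map_zero, hS])
           map_add' := fun a b => hι (by simp only [map_add, hS])
           map_mul' := fun a b => hι (by simp only [map_mul, hS])
           map_star' := fun a => hι (by simp only [map_star, hS]) }, hS⟩

theorem SeqAlgebra.map_injective {B C : Type*} [NonUnitalCStarAlgebra B] [NonUnitalCStarAlgebra C]
    {φ : B →⋆ₙₐ[ℂ] C} (hφ : ∀ b, ‖φ b‖ = ‖b‖) : Function.Injective (SeqAlgebra.map φ) := by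
  intro x y h
  obtain ⟨x, rfl⟩ := StarIdeal.Quotient.mk_surjective x
  obtain ⟨y, rfl⟩ := StarIdeal.Quotient.mk_surjective y
  refine SeqAlgebra.mk_eq_mk_iff.2 ((SeqAlgebra.mk_eq_mk_iff.1 h).congr fun n => ?_)
  exact (congrArg norm (map_sub φ (x n) (y n)).symm).trans (hφ _)

namespace CStarAction

section Orbit

variable {G A : Type*} [Group G] [TopologicalSpace G] [NonUnitalCStarAlgebra A]
  (α : CStarAction G A)

theorem injective_map_fixedPointsInclusion :
    Function.Injective (SeqAlgebra.map α.fixedPointsInclusion) :=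
  SeqAlgebra.map_injective fun _ => rfl

/-- The embedding `A → C(G, A)`, `a ↦ (t ↦ α_t(a))`, onto the fixed point algebra of `σ ⊗ α`. -/
def orbitHom : A →⋆ₙₐ[ℂ] C(G, A) where
  toFun a := ⟨fun t => α.aut t a, α.continuous_aut a⟩
  map_smul' c a := ContinuousMap.ext fun t => map_smul (α.aut t) c a
  map_zero' := ContinuousMap.ext fun t => map_zero (α.aut t)
  map_add' a b := ContinuousMap.ext fun t => map_add (α.aut t) a b
  map_mul' a b := ContinuousMap.ext fun t => map_mul (α.aut t) a b
  map_star' a := ContinuousMap.ext fun t => map_star (α.aut t) a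

theorem shiftTensor_aut_orbitHom [IsTopologicalGroup G] [CompactSpace G] (g : G) (a : A) :
    α.shiftTensor.aut g (α.orbitHom a) = α.orbitHom a :=
  ContinuousMap.ext fun t => by
    rw [shiftTensor_aut_apply]
    change α.aut g (α.aut (g⁻¹ * t) a) = α.aut t a
    rw [← aut_mul, mul_inv_cancel_left]

theorem orbitHom_fixedPoints (a : α.fixedPoints) :
    α.orbitHom (a : A) = secondFactor G A (a : A) :=
  ContinuousMap.ext fun t => a.2 t

end Orbit

variable {G A : Type*} [Group G] [TopologicalSpace G] [IsTopologicalGroup G] [CompactSpace G]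
  [SecondCountableTopology G] [MeasurableSpace G] [BorelSpace G] [NonUnitalCStarAlgebra A]
  (α : CStarAction G A)

section Average

variable (μ : Measure G) [μ.IsHaarMeasure]

/-- The average `∫ α_g(a) dμ(g)` of the orbit of an element. -/
def average (a : A) : α.fixedPoints :=
  ⟨∫ g, α.aut g a ∂μ, fun h => by
    refine ((homL (α.aut h)).integral_comp_comm (μ := μ)
      (ConvAlg.integrable_of_continuous (α.continuous_aut a))).symm.trans ?_
    change ∫ g, α.aut h (α.aut g a) ∂μ = _
    simp_rw [← α.aut_mul]
    exact integral_mul_left_eq_self (fun g => α.aut g a) h⟩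

variable [IsProbabilityMeasure μ]

theorem norm_average_le (a : A) : ‖α.average μ a‖ ≤ ‖a‖ := by
  change ‖∫ g, α.aut g a ∂μ‖ ≤ ‖a‖
  simpa using norm_integral_le_of_norm_le_const (μ := μ)
    (Filter.Eventually.of_forall fun g => (α.norm_aut g a).le)

theorem norm_average_sub_le (a : A) :
    ‖(α.average μ a : A) - a‖ ≤ ∫ g, ‖α.aut g a - a‖ ∂μ := by
  have hsub : (α.average μ a : A) - a = ∫ g, (α.aut g a - a) ∂μ := by
    rw [integral_sub (ConvAlg.integrable_of_continuous (α.continuous_aut a)) (integrable_const _)]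
    simp [average]
  rw [hsub]
  exact norm_integral_le_integral_norm _

theorem tendsto_norm_average_sub {x : ℕ → A} {C : ℝ} (hC : ∀ n, ‖x n‖ ≤ C)
    (hx : ∀ g, Filter.Tendsto (fun n => ‖α.aut g (x n) - x n‖) Filter.atTop (𝓝 0)) :
    Filter.Tendsto (fun n => ‖(α.average μ (x n) : A) - x n‖) Filter.atTop (𝓝 0) := by
  refine squeeze_zero (fun n => norm_nonneg _) (fun n => α.norm_average_sub_le μ (x n)) ?_
  rw [← integral_zero G ℝ (μ := μ)]
  refine tendsto_integral_of_dominated_convergence (fun _ => C + C)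
    (fun n => (((α.continuous_aut (x n)).sub continuous_const).norm).aestronglyMeasurable)
    (integrable_const _) (fun n => Filter.Eventually.of_forall fun g => ?_)
    (Filter.Eventually.of_forall hx)
  rw [norm_norm]
  exact (norm_sub_le _ _).trans (add_le_add ((α.norm_aut g (x n)).trans_le (hC n)) (hC n))

end Average

theorem exists_map_fixedPointsInclusion_eq (μ : Measure G) [μ.IsHaarMeasure]
    [IsProbabilityMeasure μ] (x : SeqAlgebra A) (hx : ∀ g, α.seqAut g x = x) :
    ∃ y, SeqAlgebra.map α.fixedPointsInclusion y = x := by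
  obtain ⟨x, rfl⟩ := StarIdeal.Quotient.mk_surjective x
  have hbound : ∀ n, ‖x n‖ ≤ ‖x‖ := lp.norm_apply_le_norm ENNReal.top_ne_zero x
  let y : lp (fun _ : ℕ => α.fixedPoints) ∞ := ⟨fun n => α.average μ (x n),
    memℓp_infty ⟨‖x‖, by rintro _ ⟨n, rfl⟩; exact (α.norm_average_le μ _).trans (hbound n)⟩⟩
  exact ⟨StarIdeal.Quotient.mk y, SeqAlgebra.mk_eq_mk_iff.2 <|
    α.tendsto_norm_average_sub μ hbound fun g => SeqAlgebra.mk_eq_mk_iff.1 (hx g)⟩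

theorem sequentiallySplit_fixedPointsInclusion (μ : Measure G) [μ.IsHaarMeasure]
    [IsProbabilityMeasure μ] {ψ : C(G, A) →⋆ₙₐ[ℂ] SeqAlgebra A}
    (hψ : ∀ a, ψ (secondFactor G A a) = toSeqAlgebra A a)
    (hψ' : ∀ g F, ψ (α.shiftTensor.aut g F) = α.seqAut g (ψ F)) :
    SequentiallySplit α.fixedPointsInclusion := by
  obtain ⟨S, hS⟩ := exists_factorization (SeqAlgebra.map α.fixedPointsInclusion)
    α.injective_map_fixedPointsInclusion (ψ.comp α.orbitHom)
    (fun a => α.exists_map_fixedPointsInclusion_eq μ _ fun g => by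
      rw [NonUnitalStarAlgHom.comp_apply, ← hψ', shiftTensor_aut_orbitHom])
  refine ⟨S, NonUnitalStarAlgHom.ext fun a => α.injective_map_fixedPointsInclusion ?_⟩
  rw [NonUnitalStarAlgHom.comp_apply, hS, SeqAlgebra.map_toSeqAlgebra]
  change ψ (α.orbitHom (a : A)) = toSeqAlgebra A (a : A)
  rw [orbitHom_fixedPoints, hψ]

end CStarAction

/-! ### `*`-homomorphisms on enveloping algebras -/

section EnvelopingLift

variable {X : Type*} [NonUnitalRing X] [StarRing X] [Module ℂ X]
  {D : Type*} [NonUnitalCStarAlgebra D]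

/-- The `C*`-seminorm `x ↦ ‖T x‖` of a `*`-homomorphism `T` to a `C*`-algebra. -/
def homSeminorm (T : X →⋆ₙₐ[ℂ] D) : CStarSeminorm X :=
  CStarSeminorm.comp
    { toSeminorm := normSeminorm ℂ D
      mul_le' := norm_mul_le
      star_mul_self' := fun _ => CStarRing.norm_star_mul_self } T

/-- The canonical map to the enveloping algebra, as a linear map on the original algebra (rather
than on its seminormed synonym). -/
def envOfₗ (S : SeminormFamily X) : X →ₗ[ℂ] S.Env where
  toFun x := SeminormFamily.Env.of (S := S) x
  map_add' := SeminormFamily.Env.of_add S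
  map_smul' := SeminormFamily.Env.of_smul S

theorem norm_envOfₗ (S : SeminormFamily X) (x : X) : ‖envOfₗ S x‖ = S.sup x :=
  SeminormFamily.Env.norm_of S x

theorem denseRange_envOfₗ (S : SeminormFamily X) : DenseRange (envOfₗ S) :=
  SeminormFamily.Env.denseRange_of S

variable {S : SeminormFamily X}

theorem exists_env_hom (T : X →⋆ₙₐ[ℂ] D) (hT : homSeminorm T ∈ S.seminorms) :
    ∃ T' : S.Env →⋆ₙₐ[ℂ] D, ∀ x, T' (envOfₗ S x) = T x := by
  let T₁ : X →ₗ[ℂ] D :=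
    { toFun := T, map_add' := map_add T, map_smul' := fun c x => map_smul T c x }
  let T₂ : S.Env →L[ℂ] D := T₁.extendOfNorm (envOfₗ S)
  have hT₂ : ∀ x, T₂ (envOfₗ S x) = T x := fun x =>
    LinearMap.extendOfNorm_eq (denseRange_envOfₗ S) ⟨1, fun x => by
      rw [one_mul, norm_envOfₗ]
      exact S.le_sup hT x⟩ x
  refine ⟨{ toFun := T₂
            map_smul' := fun c x => map_smul T₂ c x
            map_zero' := map_zero T₂
            map_add' := map_add T₂
            map_mul' := fun x y => ?_
            map_star' := fun x => ?_ }, hT₂⟩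
  · induction x, y using SeminormFamily.Env.induction_on₂ with
    | hP => exact isClosed_eq (by fun_prop) (by fun_prop)
    | h x y =>
      rw [← SeminormFamily.Env.of_mul]
      exact (hT₂ (x * y)).trans ((map_mul T x y).trans (congrArg₂ _ (hT₂ x).symm (hT₂ y).symm))
  · induction x using SeminormFamily.Env.induction_on with
    | hP => exact isClosed_eq (by fun_prop) (by fun_prop)
    | h x =>
      rw [← SeminormFamily.Env.of_star]
      exact (hT₂ (star x)).trans ((map_star T x).trans (congrArg star (hT₂ x).symm))

variable [IsScalarTower ℂ X X] [SMulCommClass ℂ X X] [StarModule ℂ X]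

theorem env_hom_ext {T T' : S.Env →⋆ₙₐ[ℂ] D} (h : ∀ x, T (envOfₗ S x) = T' (envOfₗ S x)) :
    T = T' :=
  NonUnitalStarAlgHom.ext fun x => congrFun ((denseRange_envOfₗ S).equalizer
    (homL T).continuous (homL T').continuous (funext h)) x

end EnvelopingLift

/-! ### `*`-homomorphisms on crossed products -/

section CrossedProductLift

variable {G A : Type*} [Group G] [TopologicalSpace G] [MeasurableSpace G] [NonUnitalCStarAlgebra A]

namespace ConvAlg

variable (α : CStarAction G A) (μ : Measure G)

/-- The identification of `C(G, A)` with the convolution algebra. It transports the supremum norm,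
which the convolution algebra does not carry as an instance. -/
def ofFun : C(G, A) ≃ₗ[ℂ] ConvAlg α μ := LinearEquiv.refl ℂ C(G, A)

variable {α μ}

theorem ofFun_symm_apply (f : ConvAlg α μ) (t : G) : (ofFun α μ).symm f t = f t := rfl

theorem continuous_norm (f : ConvAlg α μ) : Continuous fun t => ‖f t‖ :=
  ((ofFun α μ).symm f).continuous.norm

theorem norm_integrand_le (f g : ConvAlg α μ) (s t : G) :
    ‖f s * α.aut s (g (s⁻¹ * t))‖ ≤ ‖f s‖ * ‖g (s⁻¹ * t)‖ := by
  refine (norm_mul_le _ _).trans ?_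
  rw [α.norm_aut]

variable [CompactSpace G]

theorem norm_apply_le (f : ConvAlg α μ) (t : G) : ‖f t‖ ≤ ‖(ofFun α μ).symm f‖ :=
  ContinuousMap.norm_coe_le_norm ((ofFun α μ).symm f) t

variable [IsTopologicalGroup G] [SecondCountableTopology G] [BorelSpace G]
  [μ.IsHaarMeasure]

theorem norm_symm_mul_le (f g : ConvAlg α μ) :
    ‖(ofFun α μ).symm (f * g)‖ ≤ (∫ t, ‖f t‖ ∂μ) * ‖(ofFun α μ).symm g‖ := by
  rw [ContinuousMap.norm_le _ (mul_nonneg (integral_nonneg fun _ => norm_nonneg _) (norm_nonneg _))]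
  intro t
  rw [ofFun_symm_apply, mul_apply, ← integral_mul_const]
  refine norm_integral_le_of_norm_le
    ((integrable_of_continuous f.continuous_norm).mul_const _)
    (Filter.Eventually.of_forall fun s => (norm_integrand_le f g s t).trans ?_)
  exact mul_le_mul_of_nonneg_left (g.norm_apply_le _) (norm_nonneg _)

theorem integral_norm_mul_le (f g : ConvAlg α μ) :
    ∫ t, ‖(f * g) t‖ ∂μ ≤ (∫ t, ‖f t‖ ∂μ) * ∫ t, ‖g t‖ ∂μ := by
  have hc : Continuous fun p : G × G => ‖f p.2‖ * ‖g (p.2⁻¹ * p.1)‖ :=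
    (f.continuous_norm.comp continuous_snd).mul
      (g.continuous_norm.comp (continuous_snd.inv.mul continuous_fst))
  have hc_left : ∀ t, Continuous fun s => ‖f s‖ * ‖g (s⁻¹ * t)‖ := fun t =>
    hc.comp (Continuous.prodMk_right t)
  have hc_integral : Continuous fun t => ∫ s, ‖f s‖ * ‖g (s⁻¹ * t)‖ ∂μ := by
    simpa only [Measure.restrict_univ] using
      continuous_parametric_integral_of_continuous (μ := μ) (s := Set.univ)
        (f := fun t s => ‖f s‖ * ‖g (s⁻¹ * t)‖) hc isCompact_univ
  calc ∫ t, ‖(f * g) t‖ ∂μ ≤ ∫ t, ∫ s, ‖f s‖ * ‖g (s⁻¹ * t)‖ ∂μ ∂μ := by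
        refine integral_mono (integrable_of_continuous (f * g).continuous_norm)
          (integrable_of_continuous hc_integral) fun t => ?_
        exact norm_integral_le_of_norm_le (integrable_of_continuous (hc_left t))
          (Filter.Eventually.of_forall fun s => norm_integrand_le f g s t)
    _ = ∫ s, ∫ t, ‖f s‖ * ‖g (s⁻¹ * t)‖ ∂μ ∂μ :=
        integral_integral_swap_of_hasCompactSupport hc (HasCompactSupport.of_compactSpace _)
    _ = ∫ s, ‖f s‖ * ∫ t, ‖g t‖ ∂μ ∂μ := by
        refine integral_congr_ae (Filter.Eventually.of_forall fun s => ?_)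
        change ∫ t, ‖f s‖ * ‖g (s⁻¹ * t)‖ ∂μ = _
        rw [integral_const_mul, integral_mul_left_eq_self (fun t => ‖g t‖)]
    _ = _ := integral_mul_const _ _

theorem norm_symm_star_le (f : ConvAlg α μ) :
    ‖(ofFun α μ).symm (star f)‖ ≤ ‖(ofFun α μ).symm f‖ := by
  rw [ContinuousMap.norm_le _ (norm_nonneg _)]
  intro t
  rw [ofFun_symm_apply, star_apply, α.norm_aut, norm_star]
  exact f.norm_apply_le _

variable (α μ) in
theorem continuous_convStar :
    Continuous fun f : C(G, A) => (ofFun α μ).symm (star (ofFun α μ f)) := by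
  let S : C(G, A) →+ C(G, A) :=
    { toFun := fun f => (ofFun α μ).symm (star (ofFun α μ f))
      map_zero' := by simp
      map_add' := fun f g => by simp }
  exact AddMonoidHomClass.continuous_of_bound S 1 fun f => by
    rw [one_mul]; exact norm_symm_star_le _

variable [IsProbabilityMeasure μ]

theorem integral_norm_star (f : ConvAlg α μ) : ∫ t, ‖star f t‖ ∂μ = ∫ t, ‖f t‖ ∂μ := by
  have := isInvInvariant_of_compactSpace μ
  simp_rw [star_apply, α.norm_aut, norm_star]
  exact integral_inv_eq_self (fun t => ‖f t‖) μ

theorem norm_hom_le_integral_norm {D : Type*} [NonUnitalCStarAlgebra D]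
    (T : ConvAlg α μ →⋆ₙₐ[ℂ] D) {C : ℝ} (hC : ∀ f, ‖T f‖ ≤ C * ‖(ofFun α μ).symm f‖)
    (f : ConvAlg α μ) : ‖T f‖ ≤ ∫ t, ‖f t‖ ∂μ := by
  refine norm_le_of_norm_le_module_norm (q := fun f => ∫ t, ‖f t‖ ∂μ)
    (q' := fun f => |C| * ‖(ofFun α μ).symm f‖) (map_mul T) (map_star T) (fun f => ?_)
    (fun f => integral_nonneg fun _ => norm_nonneg _) (fun f g => ?_) (fun f => ?_) f
  · rw [sq]
    exact (integral_norm_mul_le _ _).trans_eq (by rw [integral_norm_star])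
  · rw [mul_left_comm]
    exact mul_le_mul_of_nonneg_left (norm_symm_mul_le f g) (abs_nonneg C)
  · exact (hC f).trans (mul_le_mul_of_nonneg_right (le_abs_self C) (norm_nonneg _))

theorem integral_norm_le (f : ConvAlg α μ) : ∫ t, ‖f t‖ ∂μ ≤ ‖(ofFun α μ).symm f‖ := by
  refine (integral_mono (integrable_of_continuous f.continuous_norm)
    (integrable_const ‖(ofFun α μ).symm f‖) fun t => f.norm_apply_le t).trans ?_
  simp

theorem norm_symm_mul_le' (f g : ConvAlg α μ) :
    ‖(ofFun α μ).symm (f * g)‖ ≤ ‖(ofFun α μ).symm f‖ * ‖(ofFun α μ).symm g‖ :=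
  (norm_symm_mul_le f g).trans (mul_le_mul_of_nonneg_right f.integral_norm_le (norm_nonneg _))

variable (α μ)

/-- The convolution product, as a bounded bilinear map for the supremum norm. -/
def convL : C(G, A) →L[ℂ] C(G, A) →L[ℂ] C(G, A) :=
  LinearMap.mkContinuous₂
    (LinearMap.mk₂ ℂ (fun f g => (ofFun α μ).symm (ofFun α μ f * ofFun α μ g))
      (fun f f' g => by rw [map_add, add_mul, map_add])
      (fun c f g => by rw [map_smul, smul_mul_assoc, map_smul])
      (fun f g g' => by rw [map_add, mul_add, map_add])
      (fun c f g => by rw [map_smul, mul_smul_comm, map_smul])) 1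
    fun f g => by rw [one_mul]; exact norm_symm_mul_le' _ _

theorem convL_apply (f g : C(G, A)) :
    convL α μ f g = (ofFun α μ).symm (ofFun α μ f * ofFun α μ g) := rfl

end ConvAlg

namespace CStarAction

variable [IsTopologicalGroup G] [CompactSpace G] [SecondCountableTopology G] [BorelSpace G]
  (α : CStarAction G A) (μ : Measure G) [μ.IsHaarMeasure]

theorem norm_toCrossedProduct_le (f : ConvAlg α μ) :
    ‖α.toCrossedProduct μ f‖ ≤ ∫ t, ‖f t‖ ∂μ := by
  change ‖envOfₗ (ConvAlg.seminormFamily α μ) f‖ ≤ _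
  rw [norm_envOfₗ]
  exact SeminormFamily.sup_le _ (integral_nonneg fun _ => norm_nonneg _) fun p hp => hp f

variable [IsProbabilityMeasure μ]

/-- The canonical map `C(G, A) → A ⋊_α G`, which is contractive for the supremum norm. -/
def funToCrossedProduct : C(G, A) →L[ℂ] α.CrossedProduct μ :=
  LinearMap.mkContinuous (envOfₗ (ConvAlg.seminormFamily α μ) ∘ₗ
    (ConvAlg.ofFun α μ : C(G, A) →ₗ[ℂ] ConvAlg α μ)) 1 fun f => by
      rw [one_mul]
      exact (α.norm_toCrossedProduct_le μ _).trans (ConvAlg.integral_norm_le _)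

variable {α μ} {D : Type*} [NonUnitalCStarAlgebra D]

theorem exists_crossedProduct_hom_of_continuousLinearMap (T : C(G, A) →L[ℂ] D)
    (hmul : ∀ f g, T (ConvAlg.convL α μ f g) = T f * T g)
    (hstar : ∀ f, T ((ConvAlg.ofFun α μ).symm (star (ConvAlg.ofFun α μ f))) = star (T f)) :
    ∃ T' : α.CrossedProduct μ →⋆ₙₐ[ℂ] D, ∀ f, T' (α.funToCrossedProduct μ f) = T f := by
  let T₁ : ConvAlg α μ →⋆ₙₐ[ℂ] D :=
    { toFun := fun f => T ((ConvAlg.ofFun α μ).symm f)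
      map_smul' := fun c f => by rw [map_smul, map_smul]; rfl
      map_zero' := by rw [map_zero, map_zero]
      map_add' := fun f g => by rw [map_add, map_add]
      map_mul' := fun f g => hmul ((ConvAlg.ofFun α μ).symm f) ((ConvAlg.ofFun α μ).symm g)
      map_star' := fun f => hstar ((ConvAlg.ofFun α μ).symm f) }
  have hT₁ : ∀ f, ‖T₁ f‖ ≤ ‖T‖ * ‖(ConvAlg.ofFun α μ).symm f‖ := fun f => T.le_opNorm _
  obtain ⟨T', hT'⟩ := exists_env_hom (S := ConvAlg.seminormFamily α μ) T₁
    (fun f => ConvAlg.norm_hom_le_integral_norm T₁ hT₁ f)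
  exact ⟨T', fun f => hT' (ConvAlg.ofFun α μ f)⟩

/-- By `hmul` and `hstar`, the range of `κ` is a `*`-subalgebra of the convolution algebra; they are
stated on `E` because `κ` need not be injective. -/
theorem exists_crossedProduct_hom {E : Type*} [AddCommGroup E] [Module ℂ E]
    (κ : E →ₗ[ℂ] C(G, A)) (hκ : DenseRange κ) (τ : E →ₗ[ℂ] D) {C : ℝ}
    (hC : ∀ e, ‖τ e‖ ≤ C * ‖κ e‖)
    (hmul : ∀ e e', ∃ e'', ConvAlg.ofFun α μ (κ e'') =
      ConvAlg.ofFun α μ (κ e) * ConvAlg.ofFun α μ (κ e') ∧ τ e'' = τ e * τ e')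
    (hstar : ∀ e, ∃ e', ConvAlg.ofFun α μ (κ e') = star (ConvAlg.ofFun α μ (κ e)) ∧
      τ e' = star (τ e)) :
    ∃ T : α.CrossedProduct μ →⋆ₙₐ[ℂ] D, ∀ e, T (α.funToCrossedProduct μ (κ e)) = τ e := by
  let T₀ : C(G, A) →L[ℂ] D := τ.extendOfNorm κ
  have hT₀ : ∀ e, T₀ (κ e) = τ e := LinearMap.extendOfNorm_eq hκ ⟨C, hC⟩
  have hT₀_mul : ∀ f g, T₀ (ConvAlg.convL α μ f g) = T₀ f * T₀ g := fun f g => by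
    refine hκ.induction_on₂ (p := fun f g => T₀ (ConvAlg.convL α μ f g) = T₀ f * T₀ g)
      (isClosed_eq (by fun_prop) (by fun_prop)) (fun e e' => ?_) f g
    obtain ⟨e'', hκ'', hτ''⟩ := hmul e e'
    rw [ConvAlg.convL_apply, ← hκ'', LinearEquiv.symm_apply_apply, hT₀, hT₀, hT₀, hτ'']
  have hT₀_star : ∀ f,
      T₀ ((ConvAlg.ofFun α μ).symm (star (ConvAlg.ofFun α μ f))) = star (T₀ f) := fun f => by
    refine hκ.induction_on (p := fun f => T₀ ((ConvAlg.ofFun α μ).symm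
      (star (ConvAlg.ofFun α μ f))) = star (T₀ f)) f
      (isClosed_eq (T₀.continuous.comp (ConvAlg.continuous_convStar α μ)) (by fun_prop)) fun e => ?_
    obtain ⟨e', hκ', hτ'⟩ := hstar e
    rw [← hκ', LinearEquiv.symm_apply_apply, hT₀, hT₀, hτ']
  obtain ⟨T, hT⟩ := exists_crossedProduct_hom_of_continuousLinearMap T₀ hT₀_mul hT₀_star
  exact ⟨T, fun e => (hT (κ e)).trans (hT₀ e)⟩

theorem crossedProduct_hom_ext {E : Type*} (κ : E → C(G, A)) (hκ : DenseRange κ)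
    {T T' : α.CrossedProduct μ →⋆ₙₐ[ℂ] D}
    (h : ∀ e, T (α.funToCrossedProduct μ (κ e)) = T' (α.funToCrossedProduct μ (κ e))) :
    T = T' :=
  env_hom_ext fun f => congrFun (hκ.equalizer
    ((homL T).continuous.comp (α.funToCrossedProduct μ).continuous)
    ((homL T').continuous.comp (α.funToCrossedProduct μ).continuous) (funext h))
    ((ConvAlg.ofFun α μ).symm f)

end CStarAction

end CrossedProductLift

/-! ### Crossed products of equivariant `*`-homomorphisms to sequence algebras -/

theorem SeminormFamily.Env.map_of {X Y : Type*} [NonUnitalRing X] [StarRing X] [Module ℂ X]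
    [IsScalarTower ℂ X X] [SMulCommClass ℂ X X] [StarModule ℂ X] [NonUnitalRing Y] [StarRing Y]
    [Module ℂ Y] [IsScalarTower ℂ Y Y] [SMulCommClass ℂ Y Y] [StarModule ℂ Y]
    {S : SeminormFamily X} {T : SeminormFamily Y} (θ : S.Pre →⋆ₙₐ[ℂ] T.Pre)
    (h : ∀ x, ‖θ x‖ ≤ ‖x‖) (x : S.Pre) :
    SeminormFamily.Env.map θ h (SeminormFamily.Env.of x) = SeminormFamily.Env.of (θ x) :=
  UniformSpace.Completion.map_coe
    (LipschitzWith.uniformContinuous (K := 1) (LipschitzWith.of_dist_le_mul fun x y => by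
      rw [dist_eq_norm, dist_eq_norm, NNReal.coe_one, one_mul, ← map_sub]
      exact h _)) x

section Integral

variable {G : Type*} [TopologicalSpace G] [CompactSpace G] [MeasurableSpace G] [BorelSpace G]
  (μ : Measure G) [IsProbabilityMeasure μ]

/-- Integration on `C(G, A)`, as a bounded linear map. -/
def integralL (A : Type*) [NonUnitalCStarAlgebra A] : C(G, A) →L[ℂ] A :=
  have hint (f : C(G, A)) : Integrable f μ :=
    f.continuous.integrable_of_hasCompactSupport (HasCompactSupport.of_compactSpace f)
  LinearMap.mkContinuous
    { toFun := fun f => ∫ t, f t ∂μ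
      map_add' := fun f g => integral_add (hint f) (hint g)
      map_smul' := fun c f => integral_smul c f } 1 fun f => by
    rw [one_mul]
    refine (norm_integral_le_of_norm_le_const (C := ‖f‖)
      (Filter.Eventually.of_forall f.norm_coe_le_norm)).trans ?_
    simp

theorem integralL_smulConst {A : Type*} [NonUnitalCStarAlgebra A] (h : C(G, ℂ)) (a : A) :
    integralL μ A (smulConst G A h a) = (∫ t, h t ∂μ) • a :=
  integral_smul_const (fun t => h t) a

end Integral

section SequenceLift

open StarIdeal.Quotient (mk)

/-- Evaluation at a point, as a `*`-homomorphism. -/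
def evalHom {G : Type*} [TopologicalSpace G] [CompactSpace G] (A : Type*) [NonUnitalCStarAlgebra A]
    (s : G) : C(G, A) →⋆ₙₐ[ℂ] A where
  toFun f := f s
  map_smul' _ _ := rfl
  map_zero' := rfl
  map_add' _ _ := rfl
  map_mul' _ _ := rfl
  map_star' _ := rfl

/-- Componentwise application of a bounded linear map to bounded sequences. -/
def seqMapL {A Y : Type*} [NormedAddCommGroup A] [NormedSpace ℂ A] [NormedAddCommGroup Y]
    [NormedSpace ℂ Y] (L : A →L[ℂ] Y) :
    lp (fun _ : ℕ => A) ∞ →L[ℂ] lp (fun _ : ℕ => Y) ∞ :=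
  lp.mapCLM ∞ (fun _ => L) (norm_nonneg L) fun _ => le_rfl

variable {G : Type*} [TopologicalSpace G] [CompactSpace G]
  {A B : Type*} [NonUnitalCStarAlgebra A] [NonUnitalCStarAlgebra B]

/-- Pairs `(F, f)` of a continuous function `F` to `B` and a bounded sequence `f` of continuous
functions to `A` that lifts `ψ ∘ F` pointwise. Pointwise lifting says nothing about uniform
convergence, so `f` need not determine an element of `C(G, A_∞)`. -/
def liftPairs (G : Type*) [TopologicalSpace G] [CompactSpace G] (ψ : B →⋆ₙₐ[ℂ] SeqAlgebra A) :
    Submodule ℂ (C(G, B) × lp (fun _ : ℕ => C(G, A)) ∞) where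
  carrier := {p | ∀ s, (mk (seqMap (evalHom A s) p.2) : SeqAlgebra A) = ψ (p.1 s)}
  zero_mem' s := by
    rw [Prod.snd_zero, Prod.fst_zero, map_zero, ContinuousMap.zero_apply, map_zero,
      StarIdeal.Quotient.mk_zero]
  add_mem' {p q} hp hq s := by
    rw [Prod.snd_add, Prod.fst_add, map_add, ContinuousMap.add_apply, map_add,
      StarIdeal.Quotient.mk_add, hp, hq]
  smul_mem' c p hp s := by
    rw [Prod.smul_snd, Prod.smul_fst, map_smul, ContinuousMap.smul_apply, map_smul,
      StarIdeal.Quotient.mk_smul, hp]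

variable (ψ : B →⋆ₙₐ[ℂ] SeqAlgebra A)

theorem mem_liftPairs {p : C(G, B) × lp (fun _ : ℕ => C(G, A)) ∞} :
    p ∈ liftPairs G ψ ↔ ∀ s, (mk (seqMap (evalHom A s) p.2) : SeqAlgebra A) = ψ (p.1 s) := Iff.rfl

variable (G) in
/-- The first component `(F, f) ↦ F`. -/
def liftPairsFst : liftPairs G ψ →ₗ[ℂ] C(G, B) :=
  LinearMap.fst ℂ _ _ ∘ₗ (liftPairs G ψ).subtype

/-- The sequence `n ↦ h · x n` of functions, for a bounded sequence `x` in `A`. -/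
def smulSeq (h : C(G, ℂ)) (x : lp (fun _ : ℕ => A) ∞) : lp (fun _ : ℕ => C(G, A)) ∞ :=
  ⟨fun n => smulConst G A h (x n), memℓp_infty ⟨‖h‖ * ‖x‖, by
    rintro _ ⟨n, rfl⟩
    exact (norm_smulConst_le h (x n)).trans (mul_le_mul_of_nonneg_left
      (lp.norm_apply_le_norm ENNReal.top_ne_zero x n) (norm_nonneg _))⟩⟩

theorem smulSeq_mem (h : C(G, ℂ)) {b : B} {x : lp (fun _ : ℕ => A) ∞}
    (hx : (mk x : SeqAlgebra A) = ψ b) : (smulConst G B h b, smulSeq h x) ∈ liftPairs G ψ := by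
  intro s
  change (mk (h s • x) : SeqAlgebra A) = ψ (h s • b)
  rw [StarIdeal.Quotient.mk_smul, hx, map_smul]

theorem denseRange_liftPairsFst [T2Space G] : DenseRange (liftPairsFst G ψ) := by
  refine Dense.mono ?_ (denseRange_tensorToFun (X := G) (E := B))
  rintro _ ⟨x, rfl⟩
  suffices tensorToFun G B x ∈ LinearMap.range (liftPairsFst G ψ) from this
  induction x using TensorProduct.induction_on with
  | zero => rw [map_zero]; exact zero_mem _
  | tmul h b =>
    obtain ⟨x, hx⟩ := StarIdeal.Quotient.mk_surjective (ψ b)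
    exact ⟨⟨_, smulSeq_mem ψ h hx⟩, rfl⟩
  | add x y hx hy => rw [map_add]; exact add_mem hx hy

/-- The map `(F, f) ↦ [L ∘ f]` to the sequence algebra. -/
def liftPairsMap {Y : Type*} [NonUnitalCStarAlgebra Y] (L : C(G, A) →L[ℂ] Y) :
    liftPairs G ψ →ₗ[ℂ] SeqAlgebra Y where
  toFun p := mk (seqMapL L p.1.2)
  map_add' p q := by
    rw [← StarIdeal.Quotient.mk_add, ← map_add]
    rfl
  map_smul' c p := by
    rw [RingHom.id_apply, ← StarIdeal.Quotient.mk_smul, ← map_smul]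
    rfl

variable [Group G] [IsTopologicalGroup G] [SecondCountableTopology G] [MeasurableSpace G]
  [BorelSpace G] (μ : Measure G) [μ.IsHaarMeasure] [IsProbabilityMeasure μ]

theorem norm_liftPairsMap_le {Y : Type*} [NonUnitalCStarAlgebra Y]
    {L : C(G, A) →L[ℂ] Y} (hL : ∀ f, ‖L f‖ ≤ ∫ t, ‖f t‖ ∂μ) (p : liftPairs G ψ) :
    ‖liftPairsMap ψ L p‖ ≤ ‖liftPairsFst G ψ p‖ := by
  obtain ⟨⟨F, f⟩, hp⟩ := p
  change ‖(mk (seqMapL L f) : SeqAlgebra Y)‖ ≤ ‖F‖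
  refine SeqAlgebra.norm_mk_le_of_eventually (norm_nonneg _) fun ε hε => ?_
  have hev := eventually_integral_le μ (h := fun n s => ‖f n s‖) (M := ‖F‖) (C := ‖f‖)
    (fun n => (f n).continuous.norm)
    (fun n s => by
      rw [abs_norm]
      exact ((f n).norm_coe_le_norm s).trans (lp.norm_apply_le_norm ENNReal.top_ne_zero f n))
    (fun s δ hδ => by
      have hle : ‖(mk (seqMap (evalHom A s) f) : SeqAlgebra A)‖ ≤ ‖F‖ := by
        rw [(mem_liftPairs ψ).1 hp s]
        exact (NonUnitalStarAlgHom.norm_apply_le ψ _).trans (F.norm_coe_le_norm s)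
      exact SeqAlgebra.eventually_norm_le hle hδ) hε
  filter_upwards [hev] with n hn
  exact (hL (f n)).trans hn

theorem mk_integral_of_mem_liftPairs [T2Space G] {F : C(G, B)} {f : lp (fun _ : ℕ => C(G, A)) ∞}
    (hp : (F, f) ∈ liftPairs G ψ) :
    (mk (seqMapL (integralL μ A) f) : SeqAlgebra A) = ψ (∫ t, F t ∂μ) := by
  have hbound : ∃ C, ∀ p, ‖liftPairsMap ψ (integralL μ A) p‖ ≤ C * ‖liftPairsFst G ψ p‖ :=
    ⟨1, fun p => by
      rw [one_mul]
      exact norm_liftPairsMap_le ψ μ (fun f => norm_integral_le_integral_norm _) p⟩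
  let J : C(G, B) →L[ℂ] SeqAlgebra A :=
    (liftPairsMap ψ (integralL μ A)).extendOfNorm (liftPairsFst G ψ)
  have hJ : ∀ p, J (liftPairsFst G ψ p) = liftPairsMap ψ (integralL μ A) p :=
    LinearMap.extendOfNorm_eq (denseRange_liftPairsFst ψ) hbound
  have hJ_eq : J = (homL ψ).comp (integralL μ B) := by
    refine continuousLinearMap_ext fun h b => ?_
    obtain ⟨x, hx⟩ := StarIdeal.Quotient.mk_surjective (ψ b)
    refine (hJ ⟨_, smulSeq_mem ψ h hx⟩).trans ?_
    have hint : seqMapL (integralL μ A) (smulSeq h x) = (∫ t, h t ∂μ) • x :=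
      lp.ext (funext fun n => integralL_smulConst μ h (x n))
    change (mk (seqMapL (integralL μ A) (smulSeq h x)) : SeqAlgebra A) =
      ψ (integralL μ B (smulConst G B h b))
    rw [hint, integralL_smulConst, StarIdeal.Quotient.mk_smul, hx, map_smul]
  have hJF : J F = mk (seqMapL (integralL μ A) f) := hJ ⟨_, hp⟩
  rw [← hJF, hJ_eq]
  rfl

end SequenceLift

namespace CStarAction

variable {G A B : Type*} [Group G] [TopologicalSpace G] [IsTopologicalGroup G] [CompactSpace G]
  [NonUnitalCStarAlgebra A] [NonUnitalCStarAlgebra B] (α : CStarAction G A) {β : CStarAction G B}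

/-- The integrand of the convolution product, as a continuous function. -/
def convIntegrand (f g : C(G, A)) (t : G) : C(G, A) :=
  ⟨fun s => f s * α.aut s (g (s⁻¹ * t)), f.continuous.mul (α.continuous_aut_comp continuous_id
    (g.continuous.comp (continuous_inv.mul continuous_const)))⟩

/-- The componentwise integrand of the convolution product of sequences. -/
def convIntegrandSeq (f g : lp (fun _ : ℕ => C(G, A)) ∞) (t : G) : lp (fun _ : ℕ => C(G, A)) ∞ :=
  ⟨fun n => α.convIntegrand (f n) (g n) t, memℓp_infty ⟨‖f‖ * ‖g‖, by
    rintro _ ⟨n, rfl⟩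
    rw [ContinuousMap.norm_le _ (by positivity)]
    intro s
    refine (norm_mul_le _ _).trans ?_
    rw [α.norm_aut]
    exact mul_le_mul
      (((f n).norm_coe_le_norm s).trans (lp.norm_apply_le_norm ENNReal.top_ne_zero f n))
      (((g n).norm_coe_le_norm _).trans (lp.norm_apply_le_norm ENNReal.top_ne_zero g n))
      (norm_nonneg _) (norm_nonneg _)⟩⟩

variable {α} {ψ : B →⋆ₙₐ[ℂ] SeqAlgebra A}

theorem convIntegrandSeq_mem (hψ : ∀ g b, ψ (β.aut g b) = α.seqAut g (ψ b))
    {F F' : C(G, B)} {f f' : lp (fun _ : ℕ => C(G, A)) ∞} (h : (F, f) ∈ liftPairs G ψ)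
    (h' : (F', f') ∈ liftPairs G ψ) (t : G) :
    (β.convIntegrand F F' t, α.convIntegrandSeq f f' t) ∈ liftPairs G ψ := by
  intro s
  change StarIdeal.Quotient.mk (seqMap (evalHom A s) f) *
    α.seqAut s (StarIdeal.Quotient.mk (seqMap (evalHom A (s⁻¹ * t)) f')) =
      ψ (F s * β.aut s (F' (s⁻¹ * t)))
  rw [h s, h' (s⁻¹ * t), map_mul ψ, hψ]

variable [SecondCountableTopology G] [MeasurableSpace G] [BorelSpace G] (μ : Measure G)
  [μ.IsHaarMeasure]

variable (α) in
/-- The componentwise involution of the convolution algebra on sequences. -/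
def convStarSeq (f : lp (fun _ : ℕ => C(G, A)) ∞) : lp (fun _ : ℕ => C(G, A)) ∞ :=
  ⟨fun n => (ConvAlg.ofFun α μ).symm (star (ConvAlg.ofFun α μ (f n))),
    memℓp_infty ⟨‖f‖, by
      rintro _ ⟨n, rfl⟩
      exact (ConvAlg.norm_symm_star_le _).trans (lp.norm_apply_le_norm ENNReal.top_ne_zero f n)⟩⟩

theorem convStarSeq_mem (hψ : ∀ g b, ψ (β.aut g b) = α.seqAut g (ψ b))
    {F : C(G, B)} {f : lp (fun _ : ℕ => C(G, A)) ∞} (h : (F, f) ∈ liftPairs G ψ) :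
    ((ConvAlg.ofFun β μ).symm (star (ConvAlg.ofFun β μ F)), α.convStarSeq μ f) ∈ liftPairs G ψ := by
  intro t
  change α.seqAut t (star (StarIdeal.Quotient.mk (seqMap (evalHom A t⁻¹) f))) =
    ψ (β.aut t (star (F t⁻¹)))
  rw [h t⁻¹, hψ, map_star ψ]

variable [IsProbabilityMeasure μ]

variable (α) in
/-- The componentwise convolution product of sequences. -/
def convSeq (f g : lp (fun _ : ℕ => C(G, A)) ∞) : lp (fun _ : ℕ => C(G, A)) ∞ :=
  ⟨fun n => (ConvAlg.ofFun α μ).symm (ConvAlg.ofFun α μ (f n) * ConvAlg.ofFun α μ (g n)),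
    memℓp_infty ⟨‖f‖ * ‖g‖, by
      rintro _ ⟨n, rfl⟩
      exact (ConvAlg.norm_symm_mul_le' _ _).trans
        (mul_le_mul (lp.norm_apply_le_norm ENNReal.top_ne_zero f n)
          (lp.norm_apply_le_norm ENNReal.top_ne_zero g n) (norm_nonneg _) (norm_nonneg _))⟩⟩

variable [T2Space G]

theorem convSeq_mem (hψ : ∀ g b, ψ (β.aut g b) = α.seqAut g (ψ b))
    {F F' : C(G, B)} {f f' : lp (fun _ : ℕ => C(G, A)) ∞} (h : (F, f) ∈ liftPairs G ψ)
    (h' : (F', f') ∈ liftPairs G ψ) :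
    ((ConvAlg.ofFun β μ).symm (ConvAlg.ofFun β μ F * ConvAlg.ofFun β μ F'),
      α.convSeq μ f f') ∈ liftPairs G ψ :=
  fun t => mk_integral_of_mem_liftPairs ψ μ (convIntegrandSeq_mem hψ h h' t)

/-- The map on `B ⋊_β G` induced by an equivariant `ψ : B → A_∞` has to be built from lifts, because
`ψ ∘ F` is a function to `A_∞` and not a sequence of functions to `A`. -/
theorem exists_crossedProduct_seqHom (hψ : ∀ g b, ψ (β.aut g b) = α.seqAut g (ψ b)) :
    ∃ T : β.CrossedProduct μ →⋆ₙₐ[ℂ] SeqAlgebra (α.CrossedProduct μ),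
      ∀ F f, (F, f) ∈ liftPairs G ψ → T (β.funToCrossedProduct μ F) =
        StarIdeal.Quotient.mk (seqMapL (α.funToCrossedProduct μ) f) := by
  obtain ⟨T, hT⟩ := exists_crossedProduct_hom (α := β) (μ := μ) (liftPairsFst G ψ)
    (denseRange_liftPairsFst ψ) (liftPairsMap ψ (α.funToCrossedProduct μ)) (C := 1)
    (fun p => by
      rw [one_mul]
      exact norm_liftPairsMap_le ψ μ (fun f => α.norm_toCrossedProduct_le μ _) p)
    (by
      rintro ⟨⟨F, f⟩, h⟩ ⟨⟨F', f'⟩, h'⟩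
      refine ⟨⟨_, convSeq_mem μ hψ h h'⟩, rfl, ?_⟩
      change StarIdeal.Quotient.mk (seqMapL (α.funToCrossedProduct μ) (α.convSeq μ f f')) =
        StarIdeal.Quotient.mk (seqMapL (α.funToCrossedProduct μ) f *
          seqMapL (α.funToCrossedProduct μ) f')
      refine congrArg _ (lp.ext (funext fun n => ?_))
      exact map_mul (α.toCrossedProduct μ) (ConvAlg.ofFun α μ (f n)) (ConvAlg.ofFun α μ (f' n)))
    (by
      rintro ⟨⟨F, f⟩, h⟩
      refine ⟨⟨_, convStarSeq_mem μ hψ h⟩, rfl, ?_⟩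
      change StarIdeal.Quotient.mk (seqMapL (α.funToCrossedProduct μ) (α.convStarSeq μ f)) =
        StarIdeal.Quotient.mk (star (seqMapL (α.funToCrossedProduct μ) f))
      refine congrArg _ (lp.ext (funext fun n => ?_))
      exact map_star (α.toCrossedProduct μ) (ConvAlg.ofFun α μ (f n)))
  exact ⟨T, fun F f h => hT ⟨_, h⟩⟩

theorem sequentiallySplit_crossedProductMap {φ : A →⋆ₙₐ[ℂ] B}
    (hφ : ∀ g a, φ (α.aut g a) = β.aut g (φ a))
    (hψ : ∀ g b, ψ (β.aut g b) = α.seqAut g (ψ b)) (hψφ : ∀ a, ψ (φ a) = toSeqAlgebra A a) :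
    SequentiallySplit (crossedProductMap (α := α) (β := β) μ φ hφ) := by
  obtain ⟨T, hT⟩ := exists_crossedProduct_seqHom μ hψ
  refine ⟨T, crossedProduct_hom_ext id Function.surjective_id.denseRange fun f => ?_⟩
  have hmem : ((ConvAlg.ofFun β μ).symm (convMap μ φ hφ (ConvAlg.ofFun α μ f)),
      constSeq C(G, A) f) ∈ liftPairs G ψ := fun s => (hψφ (f s)).symm
  have hmap : crossedProductMap (α := α) (β := β) μ φ hφ (α.funToCrossedProduct μ f) =
      β.funToCrossedProduct μ
        ((ConvAlg.ofFun β μ).symm (convMap μ φ hφ (ConvAlg.ofFun α μ f))) :=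
    SeminormFamily.Env.map_of _ _ _
  rw [NonUnitalStarAlgHom.comp_apply, id, hmap, hT _ _ hmem]
  rfl

end CStarAction

/-! ### Compact operators as limits of operators of finite rank -/

section CompactApproximation

variable {H : Type*} [NormedAddCommGroup H] [InnerProductSpace ℂ H] [CompleteSpace H]

/-- The finite rank operator is `P ∘ T` for the orthogonal projection `P` onto the span of a finite
`ε`-net of the image of the unit ball. -/
theorem exists_norm_sub_sum_rankOne_le {T : H →L[ℂ] H} (hT : IsCompactOperator T) {ε : ℝ}
    (hε : 0 < ε) :
    ∃ (n : ℕ) (u v : Fin n → H), ‖T - ∑ i, InnerProductSpace.rankOne ℂ (u i) (v i)‖ ≤ ε := by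
  have hcompact := (isCompactOperator_iff_isCompact_closure_image_closedBall (𝕜₁ := ℂ)
    (T : H →ₗ[ℂ] H) one_pos).1 hT
  obtain ⟨s, hs, hcover⟩ := Metric.totallyBounded_iff.1
    (hcompact.totallyBounded.subset subset_closure) ε hε
  let W : Submodule ℂ H := Submodule.span ℂ s
  have : FiniteDimensional ℂ W := FiniteDimensional.span_of_finite ℂ hs
  let b := stdOrthonormalBasis ℂ W
  refine ⟨_, fun i => (b i : H), fun i => T.adjoint (b i), ?_⟩
  have hsum : ∑ i, InnerProductSpace.rankOne ℂ (b i : H) (T.adjoint (b i)) =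
      W.starProjection ∘L T := by
    rw [b.starProjection_eq_sum_rankOne, ContinuousLinearMap.finsetSum_comp]
    exact Finset.sum_congr rfl fun i _ => (InnerProductSpace.rankOne_comp _ _ _).symm
  rw [hsum]
  refine ContinuousLinearMap.opNorm_le_of_unit_norm hε.le fun x hx => ?_
  obtain ⟨y, hy, hxy⟩ := Set.mem_iUnion₂.1
    (hcover ⟨x, by rw [mem_closedBall_zero_iff]; exact hx.le, rfl⟩)
  have hmin : ‖T x - W.starProjection (T x)‖ ≤ ‖T x - y‖ := by
    rw [Submodule.starProjection_minimal]
    exact ciInf_le ⟨0, by rintro _ ⟨z, rfl⟩; exact norm_nonneg _⟩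
      (⟨y, Submodule.subset_span hy⟩ : W)
  refine hmin.trans ?_
  rw [Metric.mem_ball, dist_eq_norm] at hxy
  exact hxy.le

theorem rankOneCompact_mul (u v w z : H) :
    rankOneCompact u v * rankOneCompact w z = (inner ℂ v w : ℂ) • rankOneCompact u z :=
  Subtype.ext (InnerProductSpace.rankOne_comp_rankOne u v w z)

theorem rankOneCompact_star (u v : H) : star (rankOneCompact u v) = rankOneCompact v u :=
  Subtype.ext (InnerProductSpace.adjoint_rankOne u v)

theorem continuous_rankOneCompact : Continuous fun p : H × H => rankOneCompact p.1 p.2 :=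
  continuous_induced_rng.2 (((ContinuousLinearMap.toSpanSingletonCLE (𝕜 := ℂ)).continuous.comp
    continuous_fst).clm_comp ((innerSL ℂ (E := H)).continuous.comp continuous_snd))

end CompactApproximation

/-! ### Elementary tensors in spans -/

section TripleTensor

theorem triple_tensor_induction {R X Y M : Type*} [CommSemiring R] [AddCommMonoid X] [Module R X]
    [AddCommMonoid Y] [Module R Y] [AddCommMonoid M] [Module R M]
    {P : (X ⊗[R] Y) ⊗[R] M → Prop} (hadd : ∀ x y, P x → P y → P (x + y))
    (htmul : ∀ f g a, P ((f ⊗ₜ g) ⊗ₜ a)) (x : (X ⊗[R] Y) ⊗[R] M) : P x := by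
  have hzero : P 0 := by simpa only [TensorProduct.tmul_zero] using htmul 0 0 0
  induction x using TensorProduct.induction_on with
  | zero => exact hzero
  | tmul p a =>
    induction p using TensorProduct.induction_on with
    | zero => rw [TensorProduct.zero_tmul]; exact hzero
    | tmul f g => exact htmul f g a
    | add p q hp hq => rw [TensorProduct.add_tmul]; exact hadd _ _ hp hq
  | add x y hx hy => exact hadd _ _ hx hy

variable {X M : Type*} [AddCommGroup X] [Module ℂ X] [StarAddMonoid X] [AddCommGroup M] [Module ℂ M]

theorem exists_finset_mem_span_tmul_star (x : (X ⊗[ℂ] X) ⊗[ℂ] M) :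
    ∃ S : Finset X, x ∈ Submodule.span ℂ
      {y | ∃ f ∈ S, ∃ g ∈ S, ∃ a : M, y = (f ⊗ₜ[ℂ] star g) ⊗ₜ[ℂ] a} := by
  classical
  induction x using triple_tensor_induction with
  | hadd x y hx hy =>
    obtain ⟨S, hS⟩ := hx
    obtain ⟨S', hS'⟩ := hy
    refine ⟨S ∪ S', add_mem (Submodule.span_mono ?_ hS) (Submodule.span_mono ?_ hS')⟩
    · rintro _ ⟨f, hf, g, hg, a, rfl⟩
      exact ⟨f, Finset.mem_union_left _ hf, g, Finset.mem_union_left _ hg, a, rfl⟩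
    · rintro _ ⟨f, hf, g, hg, a, rfl⟩
      exact ⟨f, Finset.mem_union_right _ hf, g, Finset.mem_union_right _ hg, a, rfl⟩
  | htmul f g a =>
    exact ⟨{f, star g}, Submodule.subset_span ⟨f, by simp, star g, by simp, a, by simp⟩⟩

theorem exists_tmul_star_tmul_eq_sum [StarModule ℂ X] {ι : Type*} [Fintype ι] {ξ : ι → X} {f g : X}
    (hf : f ∈ Submodule.span ℂ (Set.range ξ)) (hg : g ∈ Submodule.span ℂ (Set.range ξ)) (a : M) :
    ∃ b : ι → ι → M, (f ⊗ₜ[ℂ] star g) ⊗ₜ[ℂ] a =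
      ∑ i, ∑ j, (ξ i ⊗ₜ[ℂ] star (ξ j)) ⊗ₜ[ℂ] b i j := by
  obtain ⟨c, rfl⟩ := (Submodule.mem_span_range_iff_exists_fun ℂ).1 hf
  obtain ⟨d, rfl⟩ := (Submodule.mem_span_range_iff_exists_fun ℂ).1 hg
  refine ⟨fun i j => (c i * star (d j)) • a, ?_⟩
  rw [star_sum, TensorProduct.sum_tmul, TensorProduct.sum_tmul]
  refine Finset.sum_congr rfl fun i _ => ?_
  rw [TensorProduct.tmul_sum, TensorProduct.sum_tmul]
  refine Finset.sum_congr rfl fun j _ => ?_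
  rw [star_smul, TensorProduct.smul_tmul_smul, TensorProduct.smul_tmul]

end TripleTensor

/-! ### Systems of matrix units indexed by continuous functions -/

section KernelSystem

variable {G : Type*} [TopologicalSpace G] [CompactSpace G] [MeasurableSpace G] [BorelSpace G]
  (μ : Measure G) [IsFiniteMeasure μ]

/-- The inner product of `L²(G)`, on continuous functions. -/
def funInner (ξ η : C(G, ℂ)) : ℂ :=
  inner ℂ (ContinuousMap.toLp 2 μ ℂ ξ) (ContinuousMap.toLp 2 μ ℂ η)

/-- A map `(ξ, η, a) ↦ m(ξ, η, a)` that multiplies and is starred like `a ⊗ |ξ⟩⟨η|`. Both sides of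
the canonical isomorphism carry such a system. -/
structure KernelSystem {A D : Type*} [NonUnitalRing A] [StarRing A] [Module ℂ A]
    [NonUnitalRing D] [StarRing D] [Module ℂ D] (m : C(G, ℂ) → C(G, ℂ) → A →ₗ[ℂ] D) : Prop where
  mul_apply : ∀ ξ η ξ' η' a b, m ξ η a * m ξ' η' b = funInner μ η ξ' • m ξ η' (a * b)
  star_apply : ∀ ξ η a, star (m ξ η a) = m η ξ (star a)

/-- A finite family of continuous functions that is orthonormal in `L²(G)`. -/
def FunOrthonormal {n : ℕ} (ξ : Fin n → C(G, ℂ)) : Prop :=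
  ∀ i j, funInner μ (ξ i) (ξ j) = if i = j then 1 else 0

variable {μ} {A D : Type*} [NonUnitalRing A] [StarRing A] [Module ℂ A]
    [NonUnitalRing D] [StarRing D] [Module ℂ D] {m : C(G, ℂ) → C(G, ℂ) → A →ₗ[ℂ] D}

/-- The element `∑ m(ξ_i, ξ_j, a_ij)` that is given by a matrix. -/
def matrixElement (m : C(G, ℂ) → C(G, ℂ) → A →ₗ[ℂ] D) {n : ℕ} (ξ : Fin n → C(G, ℂ))
    (a : Matrix (Fin n) (Fin n) A) : D :=
  ∑ i, ∑ j, m (ξ i) (ξ j) (a i j)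

theorem KernelSystem.matrixElement_mul (hm : KernelSystem μ m) {n : ℕ} {ξ : Fin n → C(G, ℂ)}
    (hξ : FunOrthonormal μ ξ) (a b : Matrix (Fin n) (Fin n) A) :
    matrixElement m ξ (a * b) = matrixElement m ξ a * matrixElement m ξ b := by
  have hunit : ∀ i j k l, m (ξ i) (ξ j) (a i j) * m (ξ k) (ξ l) (b k l) =
      if j = k then m (ξ i) (ξ l) (a i j * b k l) else 0 := fun i j k l => by
    rw [hm.mul_apply, hξ]
    split_ifs <;> simp
  simp only [matrixElement, Finset.sum_mul]
  simp only [Finset.mul_sum, Matrix.mul_apply, map_sum, hunit]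
  refine Finset.sum_congr rfl fun i _ => ?_
  rw [Finset.sum_comm]
  refine Finset.sum_congr rfl fun j _ => ?_
  rw [Finset.sum_comm]
  exact Finset.sum_congr rfl fun l _ => by simp

theorem KernelSystem.matrixElement_star (hm : KernelSystem μ m) {n : ℕ} {ξ : Fin n → C(G, ℂ)}
    (a : Matrix (Fin n) (Fin n) A) :
    matrixElement m ξ (star a) = star (matrixElement m ξ a) := by
  simp only [matrixElement, star_sum, hm.star_apply]
  rw [Finset.sum_comm]
  rfl

theorem exists_funOrthonormal_subset_span [SecondCountableTopology G] [μ.IsOpenPosMeasure]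
    (S : Finset C(G, ℂ)) : ∃ (n : ℕ) (ξ : Fin n → C(G, ℂ)), FunOrthonormal μ ξ ∧
      ∀ f ∈ S, f ∈ Submodule.span ℂ (Set.range ξ) := by
  let Λ : C(G, ℂ) →ₗ[ℂ] Lp ℂ 2 μ := (ContinuousMap.toLp 2 μ ℂ : C(G, ℂ) →L[ℂ] Lp ℂ 2 μ)
  have hΛ : Function.Injective Λ := ContinuousMap.toLp_injective μ
  let V : Submodule ℂ C(G, ℂ) := Submodule.span ℂ S
  have : FiniteDimensional ℂ V := FiniteDimensional.span_finset ℂ S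
  let b := stdOrthonormalBasis ℂ (V.map Λ)
  have hb : ∀ i, ∃ ξ, Λ ξ = b i := fun i => by
    obtain ⟨ξ, _, h⟩ := (b i).2
    exact ⟨ξ, h⟩
  choose ξ hξ using hb
  refine ⟨_, ξ, fun i j => ?_, fun f hf => ?_⟩
  · change inner ℂ (Λ (ξ i)) (Λ (ξ j)) = _
    rw [hξ, hξ]
    exact orthonormal_iff_ite.1 b.orthonormal i j
  · have hmem : Λ f ∈ V.map Λ := Submodule.mem_map_of_mem (Submodule.subset_span hf)
    have hsum : f = ∑ i, b.repr ⟨Λ f, hmem⟩ i • ξ i :=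
      hΛ ((congrArg Subtype.val (b.sum_repr ⟨Λ f, hmem⟩)).symm.trans (by simp [hξ]))
    rw [hsum]
    exact Submodule.sum_mem _ fun i _ => Submodule.smul_mem _ _ (Submodule.subset_span ⟨i, rfl⟩)

theorem exists_matrix_repr [SecondCountableTopology G] [μ.IsOpenPosMeasure]
    {M : Type*} [AddCommGroup M] [Module ℂ M] (x : (C(G, ℂ) ⊗[ℂ] C(G, ℂ)) ⊗[ℂ] M) :
    ∃ (n : ℕ) (ξ : Fin n → C(G, ℂ)) (a : Fin n → Fin n → M), FunOrthonormal μ ξ ∧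
      x = ∑ i, ∑ j, (ξ i ⊗ₜ[ℂ] star (ξ j)) ⊗ₜ[ℂ] a i j := by
  obtain ⟨S, hS⟩ := exists_finset_mem_span_tmul_star x
  obtain ⟨n, ξ, hξ, hspan⟩ := exists_funOrthonormal_subset_span (μ := μ) S
  let R : (Fin n → Fin n → M) →ₗ[ℂ] (C(G, ℂ) ⊗[ℂ] C(G, ℂ)) ⊗[ℂ] M :=
    { toFun := fun a => ∑ i, ∑ j, (ξ i ⊗ₜ[ℂ] star (ξ j)) ⊗ₜ[ℂ] a i j
      map_add' := fun a b => by
        simp only [Pi.add_apply, TensorProduct.tmul_add, Finset.sum_add_distrib]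
      map_smul' := fun c a => by
        simp only [Pi.smul_apply, TensorProduct.tmul_smul, Finset.smul_sum, RingHom.id_apply] }
  have hR : x ∈ LinearMap.range R := by
    refine Submodule.span_le.2 ?_ hS
    rintro _ ⟨f, hf, g, hg, a, rfl⟩
    obtain ⟨b, hb⟩ := exists_tmul_star_tmul_eq_sum (hspan f hf) (hspan g hg) a
    exact ⟨b, hb.symm⟩
  obtain ⟨a, ha⟩ := hR
  exact ⟨n, ξ, a, hξ, ha.symm⟩

end KernelSystem

/-! ### The kernel functions in `C(G, C(G, A))` -/

theorem funInner_eq_integral {G : Type*} [TopologicalSpace G] [CompactSpace G] [MeasurableSpace G]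
    [BorelSpace G] (μ : Measure G) [IsFiniteMeasure μ]
    (ξ η : C(G, ℂ)) : funInner μ ξ η = ∫ t, star (ξ t) * η t ∂μ := by
  refine (ContinuousMap.inner_toLp μ ξ η).trans ?_
  exact integral_congr_ae (Filter.Eventually.of_forall fun t => mul_comm _ _)

section TensorToKernel

variable {G : Type*} [TopologicalSpace G] [CompactSpace G] {A : Type*} [NonUnitalCStarAlgebra A]

variable (G A) in
/-- The map `C(G) ⊙ C(G) ⊙ A → C(G, C(G, A))`. -/
def tensorToKernel : (C(G, ℂ) ⊗[ℂ] C(G, ℂ)) ⊗[ℂ] A →ₗ[ℂ] C(G, C(G, A)) :=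
  tensorToFun G C(G, A) ∘ₗ LinearMap.lTensor C(G, ℂ) (tensorToFun G A) ∘ₗ
    (TensorProduct.assoc ℂ C(G, ℂ) C(G, ℂ) A).toLinearMap

theorem denseRange_tensorToKernel [T2Space G] : DenseRange (tensorToKernel G A) := by
  intro k
  let P : Submodule ℂ C(G, C(G, A)) := (LinearMap.range (tensorToKernel G A)).topologicalClosure
  suffices h : k ∈ P from h
  induction k using continuousMap_induction with
  | hcl => exact Submodule.isClosed_topologicalClosure _
  | hadd F F' hF hF' => exact add_mem hF hF'
  | hsmul f h =>
    have hc : Continuous fun h : C(G, A) => smulConst G C(G, A) f h :=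
      AddMonoidHomClass.continuous_of_bound (smulConst G C(G, A) f) ‖f‖ fun h =>
        norm_smulConst_le f h
    induction h using continuousMap_induction with
    | hcl => exact (Submodule.isClosed_topologicalClosure _).preimage hc
    | hadd F F' hF hF' => rw [map_add]; exact add_mem hF hF'
    | hsmul g a =>
      exact Submodule.le_topologicalClosure _ ⟨(f ⊗ₜ g) ⊗ₜ a, rfl⟩

end TensorToKernel

namespace CStarAction

variable {G : Type*} [Group G] [TopologicalSpace G] [IsTopologicalGroup G] [CompactSpace G]
  {A : Type*} [NonUnitalCStarAlgebra A] (α : CStarAction G A)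

/-- The function `s ↦ (t ↦ α_t(k(t)(s⁻¹ t)))` that is given by a kernel `k`. -/
def kernelTransformFun (k : C(G, C(G, A))) : C(G, C(G, A)) :=
  ContinuousMap.curry
    { toFun := fun p : G × G => α.aut p.2 (k p.2 (p.1⁻¹ * p.2))
      continuous_toFun := α.continuous_aut_comp continuous_snd
        ((k.continuous.comp continuous_snd).eval (continuous_fst.inv.mul continuous_snd)) }

/-- The map `k ↦ (s ↦ (t ↦ α_t(k(t)(s⁻¹ t))))`. -/
def kernelTransform : C(G, C(G, A)) →L[ℂ] C(G, C(G, A)) :=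
  LinearMap.mkContinuous
    { toFun := α.kernelTransformFun
      map_add' := fun k l => ContinuousMap.ext fun s => ContinuousMap.ext fun t =>
        map_add (α.aut t) _ _
      map_smul' := fun c k => ContinuousMap.ext fun s => ContinuousMap.ext fun t =>
        map_smul (α.aut t) c _ } 1 fun k => by
    rw [one_mul, ContinuousMap.norm_le _ (norm_nonneg _)]
    intro s
    rw [ContinuousMap.norm_le _ (norm_nonneg _)]
    intro t
    change ‖α.aut t (k t (s⁻¹ * t))‖ ≤ _
    rw [α.norm_aut]
    exact ((k t).norm_coe_le_norm _).trans (k.norm_coe_le_norm t)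

theorem kernelTransform_surjective : Function.Surjective α.kernelTransform := by
  intro F
  refine ⟨ContinuousMap.curry
    { toFun := fun p : G × G => α.aut p.1⁻¹ (F (p.1 * p.2⁻¹) p.1)
      continuous_toFun := α.continuous_aut_comp continuous_fst.inv
        ((F.continuous.comp (continuous_fst.mul continuous_snd.inv)).eval continuous_fst) }, ?_⟩
  refine ContinuousMap.ext fun s => ContinuousMap.ext fun t => ?_
  change α.aut t (α.aut t⁻¹ (F (t * (s⁻¹ * t)⁻¹) t)) = F s t
  rw [← α.aut_mul, mul_inv_cancel, α.aut_one]
  congr 2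
  group

variable (G) in
/-- The map `C(G) ⊙ C(G) ⊙ A → C(G, C(G, A))` to the kernel functions. -/
def tensorToConv : (C(G, ℂ) ⊗[ℂ] C(G, ℂ)) ⊗[ℂ] A →ₗ[ℂ] C(G, C(G, A)) :=
  (α.kernelTransform : C(G, C(G, A)) →ₗ[ℂ] C(G, C(G, A))) ∘ₗ tensorToKernel G A

theorem denseRange_tensorToConv [T2Space G] : DenseRange (α.tensorToConv G) :=
  α.kernelTransform_surjective.denseRange.comp denseRange_tensorToKernel
    α.kernelTransform.continuous

variable [SecondCountableTopology G] [MeasurableSpace G] [BorelSpace G] (μ : Measure G)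
  [μ.IsHaarMeasure]

/-- The kernel functions `s ↦ (t ↦ ξ(t) conj(η(s⁻¹ t)) α_t(a))`, as linear maps in `a`. -/
def kernelElementₗ (ξ η : C(G, ℂ)) : A →ₗ[ℂ] ConvAlg α.shiftTensor μ where
  toFun a := α.kernelElement μ a ξ η
  map_add' a b := ConvAlg.ext fun s => ContinuousMap.ext fun t => by
    change (ξ t * star (η (s⁻¹ * t))) • α.aut t (a + b) = (ξ t * star (η (s⁻¹ * t))) • α.aut t a +
      (ξ t * star (η (s⁻¹ * t))) • α.aut t b
    rw [map_add, smul_add]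
  map_smul' c a := ConvAlg.ext fun s => ContinuousMap.ext fun t => by
    change (ξ t * star (η (s⁻¹ * t))) • α.aut t (c • a) =
      c • (ξ t * star (η (s⁻¹ * t))) • α.aut t a
    rw [map_smul, smul_comm]

theorem evalHom_kernelElementₗ_mul_aut (ξ η ξ' η' : C(G, ℂ)) (a b : A) (r s t : G) :
    evalHom A t (α.kernelElementₗ μ ξ η a r *
        α.shiftTensor.aut r (α.kernelElementₗ μ ξ' η' b (r⁻¹ * s))) =
      (star (η (r⁻¹ * t)) * ξ' (r⁻¹ * t)) • ((ξ t * star (η' (s⁻¹ * t))) • α.aut t (a * b)) := by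
  change (ξ t * star (η (r⁻¹ * t))) • α.aut t a *
    α.aut r ((ξ' (r⁻¹ * t) * star (η' ((r⁻¹ * s)⁻¹ * (r⁻¹ * t)))) • α.aut (r⁻¹ * t) b) = _
  have hcancel : (r⁻¹ * s)⁻¹ * (r⁻¹ * t) = s⁻¹ * t := by group
  rw [map_smul, ← α.aut_mul, mul_inv_cancel_left, smul_mul_smul_comm, ← map_mul, smul_smul, hcancel]
  congr 1
  ring

theorem kernelSystem_kernelElementₗ [IsProbabilityMeasure μ] :
    KernelSystem μ (α.kernelElementₗ μ) where
  mul_apply ξ η ξ' η' a b := by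
    refine ConvAlg.ext fun s => ContinuousMap.ext fun t => ?_
    refine ((homL (evalHom A t)).integral_comp_comm
      (ConvAlg.integrable_integrand (α.kernelElementₗ μ ξ η a)
        (α.kernelElementₗ μ ξ' η' b) s)).symm.trans ?_
    refine (integral_congr_ae (Filter.Eventually.of_forall fun r =>
      α.evalHom_kernelElementₗ_mul_aut μ ξ η ξ' η' a b r s t)).trans ?_
    rw [integral_smul_const, integral_inv_mul_eq_self μ (fun r => star (η r) * ξ' r) t,
      ← funInner_eq_integral]
    rfl
  star_apply ξ η a := by
    refine ConvAlg.ext fun s => ContinuousMap.ext fun t => ?_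
    change α.aut s (star ((ξ (s⁻¹ * t) * star (η (s⁻¹⁻¹ * (s⁻¹ * t)))) • α.aut (s⁻¹ * t) a)) =
      (η t * star (ξ (s⁻¹ * t))) • α.aut t (star a)
    rw [star_smul, map_smul, ← map_star (α.aut (s⁻¹ * t)), ← α.aut_mul, mul_inv_cancel_left,
      inv_inv, mul_inv_cancel_left, star_mul, star_star]

theorem ofFun_tensorToConv_tmul (f g : C(G, ℂ)) (a : A) :
    ConvAlg.ofFun α.shiftTensor μ (α.tensorToConv G ((f ⊗ₜ g) ⊗ₜ a)) =
      α.kernelElementₗ μ f (star g) a :=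
  ConvAlg.ext fun s => ContinuousMap.ext fun t => by
    change α.aut t (f t • g (s⁻¹ * t) • a) = (f t * star (star (g (s⁻¹ * t)))) • α.aut t a
    rw [star_star, smul_smul, map_smul]

theorem ofFun_tensorToConv_matrix {n : ℕ} (ξ : Fin n → C(G, ℂ)) (a : Matrix (Fin n) (Fin n) A) :
    ConvAlg.ofFun α.shiftTensor μ
      (α.tensorToConv G (∑ i, ∑ j, (ξ i ⊗ₜ[ℂ] star (ξ j)) ⊗ₜ[ℂ] a i j)) =
      matrixElement (α.kernelElementₗ μ) ξ a := by
  simp only [map_sum, ofFun_tensorToConv_tmul, star_star, matrixElement]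

end CStarAction

/-! ### Models of the algebra of compact operators on `L²(G)` -/

section ElementaryTensors

variable {A K : Type*} [NonUnitalCStarAlgebra A] [NonUnitalCStarAlgebra K]

theorem elemTensor_mul (a b : A) (k l : K) :
    elemTensor a k * elemTensor b l = elemTensor (a * b) (k * l) := by
  refine (SeminormFamily.Env.of_mul (tensorSeminorms A K) _ _).symm.trans ?_
  exact congrArg _ (Algebra.TensorProduct.tmul_mul_tmul a b k l)

theorem elemTensor_star (a : A) (k : K) :
    star (elemTensor a k) = elemTensor (star a) (star k) := by
  refine (SeminormFamily.Env.of_star (tensorSeminorms A K) _).symm.trans ?_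
  exact congrArg _ (TensorProduct.star_tmul a k)

theorem norm_elemTensor_le (a : A) (k : K) : ‖elemTensor a k‖ ≤ ‖a‖ * ‖k‖ := by
  refine (norm_envOfₗ (tensorSeminorms A K) (a ⊗ₜ[ℂ] k)).trans_le ?_
  exact SeminormFamily.sup_le _ (by positivity) fun p hp => hp a k

end ElementaryTensors

section CompactModel

variable {G : Type*} [TopologicalSpace G] {K : Type*} [NonUnitalCStarAlgebra K]

variable {ρ : C(G, ℂ) ⊗[ℂ] C(G, ℂ) →ₗ[ℂ] K} (A : Type*) [NonUnitalCStarAlgebra A]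

/-- The scalar multiples of `ρ(ξ ⊗ conj(η))`. -/
def compactKernel (ρ : C(G, ℂ) ⊗[ℂ] C(G, ℂ) →ₗ[ℂ] K) (ξ η : C(G, ℂ)) : ℂ →ₗ[ℂ] K :=
  LinearMap.toSpanSingleton ℂ K (ρ (ξ ⊗ₜ star η))

/-- The elements `a ⊗ ρ(ξ ⊗ conj(η))`, as linear maps in `a`. -/
def elemKernel (ρ : C(G, ℂ) ⊗[ℂ] C(G, ℂ) →ₗ[ℂ] K) (ξ η : C(G, ℂ)) : A →ₗ[ℂ] CStarTensor A K :=
  envOfₗ (tensorSeminorms A K) ∘ₗ (TensorProduct.mk ℂ A K).flip (ρ (ξ ⊗ₜ star η))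

/-- The map `C(G) ⊙ C(G) ⊙ A → A ⊗ K` induced by `ρ`. -/
def tensorToElem (ρ : C(G, ℂ) ⊗[ℂ] C(G, ℂ) →ₗ[ℂ] K) :
    (C(G, ℂ) ⊗[ℂ] C(G, ℂ)) ⊗[ℂ] A →ₗ[ℂ] CStarTensor A K :=
  envOfₗ (tensorSeminorms A K) ∘ₗ (TensorProduct.comm ℂ K A).toLinearMap ∘ₗ LinearMap.rTensor A ρ

variable {A}

theorem elemKernel_apply (ξ η : C(G, ℂ)) (a : A) :
    elemKernel A ρ ξ η a = elemTensor a (ρ (ξ ⊗ₜ star η)) := rfl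

theorem tensorToElem_tmul (p : C(G, ℂ) ⊗[ℂ] C(G, ℂ)) (a : A) :
    tensorToElem A ρ (p ⊗ₜ a) = elemTensor a (ρ p) := rfl

theorem tensorToElem_tmul_tmul (f g : C(G, ℂ)) (a : A) :
    tensorToElem A ρ ((f ⊗ₜ g) ⊗ₜ a) = elemKernel A ρ f (star g) a := by
  rw [elemKernel_apply, star_star, tensorToElem_tmul]

theorem tensorToElem_matrix {n : ℕ} (ξ : Fin n → C(G, ℂ)) (a : Matrix (Fin n) (Fin n) A) :
    tensorToElem A ρ (∑ i, ∑ j, (ξ i ⊗ₜ[ℂ] star (ξ j)) ⊗ₜ[ℂ] a i j) =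
      matrixElement (elemKernel A ρ) ξ a := by
  simp only [map_sum, tensorToElem_tmul_tmul, star_star, matrixElement]

/-- A linear map `ρ : C(G) ⊙ C(G) → K` that behaves like the map `f ⊗ conj(g) ↦ |f⟩⟨g|` to the
compact operators on `L²(G)`. -/
structure CompactModel [CompactSpace G] [MeasurableSpace G] [BorelSpace G] (μ : Measure G)
    [IsFiniteMeasure μ] (ρ : C(G, ℂ) ⊗[ℂ] C(G, ℂ) →ₗ[ℂ] K) : Prop where
  mul_apply : ∀ f g f' g', ρ (f ⊗ₜ star g) * ρ (f' ⊗ₜ star g') =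
    funInner μ g f' • ρ (f ⊗ₜ star g')
  star_apply : ∀ f g, star (ρ (f ⊗ₜ star g)) = ρ (g ⊗ₜ star f)
  norm_coeff_le : ∀ {n : ℕ} (ξ : Fin n → C(G, ℂ)) (c : Fin n → Fin n → ℂ), FunOrthonormal μ ξ →
    ∀ i j, ‖c i j‖ ≤ ‖∑ i, ∑ j, c i j • ρ (ξ i ⊗ₜ star (ξ j))‖
  denseRange : DenseRange ρ

variable [CompactSpace G] [MeasurableSpace G] [BorelSpace G] {μ : Measure G} [IsFiniteMeasure μ]

theorem CompactModel.kernelSystem_compactKernel (hρ : CompactModel μ ρ) :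
    KernelSystem μ (compactKernel ρ) where
  mul_apply ξ η ξ' η' a b := by
    simp only [compactKernel, LinearMap.toSpanSingleton_apply]
    rw [smul_mul_smul_comm, hρ.mul_apply, smul_comm]
  star_apply ξ η a := by
    simp only [compactKernel, LinearMap.toSpanSingleton_apply]
    rw [star_smul, hρ.star_apply]

theorem CompactModel.kernelSystem_elemKernel (hρ : CompactModel μ ρ) :
    KernelSystem μ (elemKernel A ρ) where
  mul_apply ξ η ξ' η' a b := by
    rw [elemKernel_apply, elemKernel_apply, elemTensor_mul, hρ.mul_apply]
    exact (congrArg (envOfₗ (tensorSeminorms A K)) (TensorProduct.tmul_smul _ _ _)).trans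
      (map_smul _ _ _)
  star_apply ξ η a := by
    rw [elemKernel_apply, elemTensor_star, hρ.star_apply, elemKernel_apply]

end CompactModel

section CompactOperators

variable {G : Type*} [TopologicalSpace G]
  {H : Type*} [NormedAddCommGroup H] [InnerProductSpace ℂ H] [CompleteSpace H]
  (Λ : C(G, ℂ) →ₗ[ℂ] H)

/-- The map `C(G) ⊙ C(G) → K(H)` with `f ⊗ conj(g) ↦ |Λ f⟩⟨Λ g|`. -/
def tensorToCompact : C(G, ℂ) ⊗[ℂ] C(G, ℂ) →ₗ[ℂ] compacts H :=
  TensorProduct.lift (LinearMap.mk₂ ℂ (fun f g => rankOneCompact (Λ f) (Λ (star g)))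
    (fun f f' g => Subtype.ext (by simp [rankOneCompact]))
    (fun c f g => Subtype.ext (by simp [rankOneCompact]))
    (fun f g g' => Subtype.ext (by simp [rankOneCompact]))
    (fun c f g => Subtype.ext (by simp [rankOneCompact])))

variable {Λ}

theorem tensorToCompact_tmul (f g : C(G, ℂ)) :
    tensorToCompact Λ (f ⊗ₜ star g) = rankOneCompact (Λ f) (Λ g) :=
  congrArg (fun h => rankOneCompact (Λ f) (Λ h)) (star_star g)

theorem denseRange_tensorToCompact (hd : DenseRange Λ) : DenseRange (tensorToCompact Λ) := by
  let P : Submodule ℂ (compacts H) := (LinearMap.range (tensorToCompact Λ)).topologicalClosure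
  have hP : IsClosed (P : Set (compacts H)) := Submodule.isClosed_topologicalClosure _
  have hrankOne : ∀ p : H × H, rankOneCompact p.1 p.2 ∈ P := fun p => by
    refine (hd.prodMap hd).induction_on (p := fun p => rankOneCompact p.1 p.2 ∈ P) p
      (hP.preimage continuous_rankOneCompact) ?_
    rintro ⟨f, g⟩
    exact Submodule.le_topologicalClosure _ ⟨f ⊗ₜ star g, tensorToCompact_tmul f g⟩
  intro k
  suffices h : k ∈ P from h
  rw [← SetLike.mem_coe, ← hP.closure_eq, Metric.mem_closure_iff]
  intro ε hε
  obtain ⟨n, u, v, huv⟩ := exists_norm_sub_sum_rankOne_le k.2 (half_pos hε)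
  refine ⟨∑ i, rankOneCompact (u i) (v i), Submodule.sum_mem _ fun i _ => hrankOne (u i, v i), ?_⟩
  rw [dist_eq_norm]
  refine lt_of_le_of_lt (le_trans (le_of_eq ?_) huv) (half_lt_self hε)
  change ‖((k - ∑ i, rankOneCompact (u i) (v i) : compacts H) : H →L[ℂ] H)‖ = _
  rw [AddSubgroupClass.coe_sub, AddSubmonoidClass.coe_finsetSum]
  rfl

variable [CompactSpace G] [MeasurableSpace G] [BorelSpace G] {μ : Measure G} [IsFiniteMeasure μ]

theorem inner_sum_tensorToCompact (hΛ : ∀ f g, inner ℂ (Λ f) (Λ g) = funInner μ f g) {n : ℕ}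
    {ξ : Fin n → C(G, ℂ)} (hξ : FunOrthonormal μ ξ) (c : Fin n → Fin n → ℂ) (k l : Fin n) :
    inner ℂ (Λ (ξ k))
      ((∑ i, ∑ j, c i j • tensorToCompact Λ (ξ i ⊗ₜ star (ξ j)) : compacts H).1 (Λ (ξ l))) =
      c k l := by
  have hcoe : (∑ i, ∑ j, c i j • tensorToCompact Λ (ξ i ⊗ₜ star (ξ j)) : compacts H).1 =
      ∑ i, ∑ j, c i j • InnerProductSpace.rankOne ℂ (Λ (ξ i)) (Λ (ξ j)) := by
    simp only [AddSubmonoidClass.coe_finsetSum, tensorToCompact_tmul]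
    rfl
  rw [hcoe]
  simp only [sum_apply, smul_apply, InnerProductSpace.rankOne_apply, inner_sum, inner_smul_right,
    hΛ, show ∀ i j, funInner μ (ξ i) (ξ j) = if i = j then 1 else 0 from hξ]
  simp

theorem compactModel_tensorToCompact (hd : DenseRange Λ)
    (hΛ : ∀ f g, inner ℂ (Λ f) (Λ g) = funInner μ f g) : CompactModel μ (tensorToCompact Λ) where
  mul_apply f g f' g' := by
    simp only [tensorToCompact_tmul, rankOneCompact_mul, hΛ]
  star_apply f g := by simp only [tensorToCompact_tmul, rankOneCompact_star]
  norm_coeff_le {n} ξ c hξ k l := by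
    have hunit : ∀ i, ‖Λ (ξ i)‖ = 1 := fun i => by
      rw [norm_eq_sqrt_re_inner (𝕜 := ℂ), hΛ, hξ, if_pos rfl]
      simp
    rw [← inner_sum_tensorToCompact hΛ hξ c k l]
    refine (norm_inner_le_norm _ _).trans ?_
    rw [hunit, one_mul]
    refine (ContinuousLinearMap.le_opNorm _ _).trans ?_
    rw [hunit, mul_one]
    rfl
  denseRange := denseRange_tensorToCompact hd

end CompactOperators

/-! ### Comparison of the norms of kernels -/

namespace CStarAction

theorem norm_le_norm_kernelTransform {G : Type*} [Group G] [TopologicalSpace G]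
    [IsTopologicalGroup G] [CompactSpace G] {A : Type*} [NonUnitalCStarAlgebra A]
    (α : CStarAction G A) (k : C(G, C(G, A))) : ‖k‖ ≤ ‖α.kernelTransform k‖ := by
  rw [ContinuousMap.norm_le _ (norm_nonneg _)]
  intro t
  rw [ContinuousMap.norm_le _ (norm_nonneg _)]
  intro r
  have htransform : α.kernelTransform k (t * r⁻¹) t = α.aut t (k t r) := by
    change α.aut t (k t ((t * r⁻¹)⁻¹ * t)) = _
    congr 2
    group
  rw [← α.norm_aut t, ← htransform]
  exact ((α.kernelTransform k _).norm_coe_le_norm t).trans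
    ((α.kernelTransform k).norm_coe_le_norm _)

end CStarAction

section WeightedIntegral

variable {G : Type*} [TopologicalSpace G] [CompactSpace G] [MeasurableSpace G] [BorelSpace G]
  {μ : Measure G} [IsProbabilityMeasure μ]

variable (μ) in
/-- The integral against a weight. Weights from an orthonormal family extract the entries of a
matrix from the kernel it defines. -/
def weightedIntegral (h : C(G, ℂ)) (B : Type*) [NonUnitalCStarAlgebra B] : C(G, B) →L[ℂ] B :=
  LinearMap.mkContinuous
    { toFun := fun F => integralL μ B ⟨fun t => h t • F t, h.continuous.smul F.continuous⟩
      map_add' := fun F F' => by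
        rw [← map_add]
        exact congrArg _ (ContinuousMap.ext fun t => smul_add _ _ _)
      map_smul' := fun c F => by
        rw [RingHom.id_apply, ← map_smul]
        exact congrArg _ (ContinuousMap.ext fun t => smul_comm _ _ _) } (‖integralL μ B‖ * ‖h‖)
    fun F => by
      rw [mul_assoc]
      refine ((integralL μ B).le_opNorm _).trans (mul_le_mul_of_nonneg_left ?_ (norm_nonneg _))
      rw [ContinuousMap.norm_le _ (by positivity)]
      intro t
      refine (norm_smul_le _ _).trans ?_
      exact mul_le_mul (h.norm_coe_le_norm t) (F.norm_coe_le_norm t) (norm_nonneg _)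
        (norm_nonneg _)

theorem weightedIntegral_smulConst (h f : C(G, ℂ)) {B : Type*} [NonUnitalCStarAlgebra B] (b : B) :
    weightedIntegral μ h B (smulConst G B f b) = funInner μ (star h) f • b := by
  change ∫ t, h t • f t • b ∂μ = _
  simp_rw [smul_smul]
  rw [integral_smul_const, funInner_eq_integral]
  simp only [ContinuousMap.star_apply, star_star]

theorem weightedIntegral_tensorToKernel {A : Type*} [NonUnitalCStarAlgebra A] {n : ℕ}
    {ξ : Fin n → C(G, ℂ)} (hξ : FunOrthonormal μ ξ) (a : Matrix (Fin n) (Fin n) A) (i j : Fin n) :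
    weightedIntegral μ (ξ j) A (weightedIntegral μ (star (ξ i)) C(G, A)
      (tensorToKernel G A (∑ i, ∑ j, (ξ i ⊗ₜ[ℂ] star (ξ j)) ⊗ₜ[ℂ] a i j))) =
      a i j := by
  have hξ' : ∀ i j, funInner μ (ξ i) (ξ j) = if i = j then 1 else 0 := hξ
  have hξ_star : ∀ i j, funInner μ (star (ξ i)) (star (ξ j)) = if j = i then 1 else 0 :=
    fun i j => by
      rw [← hξ' j i, funInner_eq_integral, funInner_eq_integral]
      simp only [ContinuousMap.star_apply, star_star, mul_comm]
  have hkernel : tensorToKernel G A (∑ i, ∑ j, (ξ i ⊗ₜ[ℂ] star (ξ j)) ⊗ₜ[ℂ] a i j) =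
      ∑ i, ∑ j, smulConst G C(G, A) (ξ i) (smulConst G A (star (ξ j)) (a i j)) := by
    simp only [map_sum]
    rfl
  simp only [hkernel, map_sum, weightedIntegral_smulConst, map_smul, star_star, hξ', hξ_star]
  simp

end WeightedIntegral

section MatrixMapSMul

variable {A : Type*} [NonUnitalCStarAlgebra A] {n : ℕ}

theorem matrix_map_smul_mul (c d : Matrix (Fin n) (Fin n) ℂ) (a b : A) :
    (c * d).map (· • (a * b)) = c.map (· • a) * d.map (· • b) := by
  ext i j
  simp only [Matrix.map_apply, Matrix.mul_apply, Finset.sum_smul, smul_mul_smul_comm]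

theorem matrix_map_smul_star (c : Matrix (Fin n) (Fin n) ℂ) (a : A) :
    (star c).map (· • star a) = star (c.map (· • a)) := by
  ext i j
  exact (star_smul (c j i) a).symm

end MatrixMapSMul

namespace CStarAction

variable {G : Type*} [Group G] [TopologicalSpace G] [IsTopologicalGroup G] [CompactSpace G]
  [SecondCountableTopology G] [MeasurableSpace G] [BorelSpace G]
  {A : Type*} [NonUnitalCStarAlgebra A] (α : CStarAction G A)
  {μ : Measure G} [μ.IsHaarMeasure] [IsProbabilityMeasure μ]

theorem exists_norm_coeff_le {n : ℕ} {ξ : Fin n → C(G, ℂ)} (hξ : FunOrthonormal μ ξ)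
    (i j : Fin n) :
    ∃ C : ℝ, ∀ a : Matrix (Fin n) (Fin n) A,
      ‖a i j‖ ≤ C * ‖(ConvAlg.ofFun α.shiftTensor μ).symm
        (matrixElement (α.kernelElementₗ μ) ξ a)‖ := by
  refine ⟨‖weightedIntegral μ (ξ j) A‖ * ‖weightedIntegral μ (star (ξ i)) C(G, A)‖, fun a => ?_⟩
  have hsymm : (ConvAlg.ofFun α.shiftTensor μ).symm (matrixElement (α.kernelElementₗ μ) ξ a) =
      α.kernelTransform (tensorToKernel G A (∑ i, ∑ j, (ξ i ⊗ₜ[ℂ] star (ξ j)) ⊗ₜ[ℂ] a i j)) := by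
    rw [LinearEquiv.symm_apply_eq, ← ofFun_tensorToConv_matrix]
    rfl
  rw [hsymm, ← weightedIntegral_tensorToKernel hξ a i j, mul_assoc]
  refine (ContinuousLinearMap.le_opNorm _ _).trans
    (mul_le_mul_of_nonneg_left ?_ (norm_nonneg _))
  refine (ContinuousLinearMap.le_opNorm _ _).trans
    (mul_le_mul_of_nonneg_left ?_ (norm_nonneg _))
  exact α.norm_le_norm_kernelTransform _

variable {K : Type*} [NonUnitalCStarAlgebra K] {ρ : C(G, ℂ) ⊗[ℂ] C(G, ℂ) →ₗ[ℂ] K}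

theorem exists_norm_matrixElement_elemKernel_le (ρ : C(G, ℂ) ⊗[ℂ] C(G, ℂ) →ₗ[ℂ] K) {n : ℕ}
    {ξ : Fin n → C(G, ℂ)} (hξ : FunOrthonormal μ ξ) :
    ∃ C : ℝ, 0 ≤ C ∧ ∀ a : Matrix (Fin n) (Fin n) A, ‖matrixElement (elemKernel A ρ) ξ a‖ ≤
      C * ‖(ConvAlg.ofFun α.shiftTensor μ).symm (matrixElement (α.kernelElementₗ μ) ξ a)‖ := by
  choose C hC using fun i j => α.exists_norm_coeff_le hξ i j
  refine ⟨∑ i, ∑ j, |C i j| * ‖ρ (ξ i ⊗ₜ star (ξ j))‖,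
    Finset.sum_nonneg fun i _ => Finset.sum_nonneg fun j _ => by positivity, fun a => ?_⟩
  rw [Finset.sum_mul]
  refine norm_sum_le_of_le _ fun i _ => ?_
  rw [Finset.sum_mul]
  refine norm_sum_le_of_le _ fun j _ => (norm_elemTensor_le _ _).trans ?_
  rw [mul_right_comm]
  refine mul_le_mul_of_nonneg_right ((hC i j a).trans ?_) (norm_nonneg _)
  exact mul_le_mul_of_nonneg_right (le_abs_self _) (norm_nonneg _)

theorem norm_tensorToElem_le (hρ : CompactModel μ ρ) (x : (C(G, ℂ) ⊗[ℂ] C(G, ℂ)) ⊗[ℂ] A) :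
    ‖tensorToElem A ρ x‖ ≤ ‖α.tensorToConv G x‖ := by
  obtain ⟨n, ξ, a, hξ, rfl⟩ := exists_matrix_repr (μ := μ) x
  have hkernel := α.kernelSystem_kernelElementₗ μ
  have helem := hρ.kernelSystem_elemKernel (A := A)
  obtain ⟨C, hC0, hC⟩ := α.exists_norm_matrixElement_elemKernel_le ρ hξ
  let q : Matrix (Fin n) (Fin n) A → ℝ := fun a =>
    ‖(ConvAlg.ofFun α.shiftTensor μ).symm (matrixElement (α.kernelElementₗ μ) ξ a)‖
  have hq_mul : ∀ a b, q (a * b) ≤ q a * q b := fun a b => by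
    change ‖(ConvAlg.ofFun α.shiftTensor μ).symm (matrixElement _ ξ (a * b))‖ ≤ _
    rw [hkernel.matrixElement_mul hξ]
    exact ConvAlg.norm_symm_mul_le' _ _
  have hq_star : ∀ a, q (star a) ≤ q a := fun a => by
    change ‖(ConvAlg.ofFun α.shiftTensor μ).symm (matrixElement _ ξ (star a))‖ ≤ _
    rw [hkernel.matrixElement_star]
    exact ConvAlg.norm_symm_star_le _
  have hcontr : ‖matrixElement (elemKernel A ρ) ξ a‖ ≤ q a :=
    norm_le_of_norm_le_module_norm (q' := fun a => C * q a)
      (helem.matrixElement_mul hξ) helem.matrixElement_star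
      (fun a => ((hq_mul _ a).trans
        (mul_le_mul_of_nonneg_right (hq_star a) (norm_nonneg _))).trans_eq (sq _).symm)
      (fun a => norm_nonneg _)
      (fun a b => (mul_le_mul_of_nonneg_left (hq_mul a b) hC0).trans_eq (mul_left_comm _ _ _))
      hC a
  refine (congrArg norm (tensorToElem_matrix ξ a)).trans_le (hcontr.trans_eq ?_)
  exact congrArg norm
    ((LinearEquiv.symm_apply_eq _).2 (α.ofFun_tensorToConv_matrix μ ξ a).symm)

theorem norm_kernelElementₗ_le (ξ η : C(G, ℂ)) (a : A) :
    ‖α.shiftTensor.toCrossedProduct μ (α.kernelElementₗ μ ξ η a)‖ ≤ ‖ξ‖ * ‖η‖ * ‖a‖ := by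
  refine (α.shiftTensor.norm_toCrossedProduct_le μ _).trans
    ((ConvAlg.integral_norm_le _).trans ?_)
  rw [ContinuousMap.norm_le _ (by positivity)]
  intro s
  rw [ContinuousMap.norm_le _ (by positivity)]
  intro t
  change ‖(ξ t * star (η (s⁻¹ * t))) • α.aut t a‖ ≤ _
  rw [norm_smul, norm_mul, norm_star, α.norm_aut]
  gcongr
  · exact ξ.norm_coe_le_norm t
  · exact η.norm_coe_le_norm _

theorem norm_matrixElement_kernelElementₗ_le_sum (hρ : CompactModel μ ρ) {n : ℕ}
    {ξ : Fin n → C(G, ℂ)} (hξ : FunOrthonormal μ ξ) (a : A) (c : Matrix (Fin n) (Fin n) ℂ) :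
    ‖α.shiftTensor.toCrossedProduct μ
      (matrixElement (α.kernelElementₗ μ) ξ (c.map (· • a)))‖ ≤
      (∑ i, ∑ j, ‖ξ i‖ * ‖ξ j‖) * (‖a‖ * ‖matrixElement (compactKernel ρ) ξ c‖) := by
  simp only [matrixElement, map_sum]
  rw [Finset.sum_mul]
  refine norm_sum_le_of_le _ fun i _ => ?_
  rw [Finset.sum_mul]
  refine norm_sum_le_of_le _ fun j _ => (α.norm_kernelElementₗ_le _ _ _).trans ?_
  refine mul_le_mul_of_nonneg_left ?_ (by positivity)
  refine (norm_smul_le _ _).trans ?_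
  rw [mul_comm]
  exact mul_le_mul_of_nonneg_left (hρ.norm_coeff_le ξ c hξ i j) (norm_nonneg _)

theorem norm_matrixElement_kernelElementₗ_le (hρ : CompactModel μ ρ) {n : ℕ}
    {ξ : Fin n → C(G, ℂ)} (hξ : FunOrthonormal μ ξ) (a : A) (c : Matrix (Fin n) (Fin n) ℂ) :
    ‖α.shiftTensor.toCrossedProduct μ
      (matrixElement (α.kernelElementₗ μ) ξ (c.map (· • a)))‖ ≤
      ‖a‖ * ‖matrixElement (compactKernel ρ) ξ c‖ := by
  have hkernel := α.kernelSystem_kernelElementₗ μ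
  have hcompact := hρ.kernelSystem_compactKernel
  let q : A × Matrix (Fin n) (Fin n) ℂ → ℝ := fun x =>
    ‖x.1‖ * ‖matrixElement (compactKernel ρ) ξ x.2‖
  have hq_mul : ∀ x y, q (x * y) ≤ q x * q y := fun x y => by
    change ‖x.1 * y.1‖ * ‖matrixElement _ ξ (x.2 * y.2)‖ ≤ _
    rw [hcompact.matrixElement_mul hξ, mul_mul_mul_comm]
    exact mul_le_mul (norm_mul_le _ _) (norm_mul_le _ _) (norm_nonneg _) (by positivity)
  have hq_star : ∀ x, q (star x) = q x := fun x => by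
    change ‖star x.1‖ * ‖matrixElement _ ξ (star x.2)‖ = _
    rw [hcompact.matrixElement_star, norm_star, norm_star]
  exact norm_le_of_norm_le_module_norm (q := q)
    (T := fun x : A × Matrix (Fin n) (Fin n) ℂ => α.shiftTensor.toCrossedProduct μ
      (matrixElement (α.kernelElementₗ μ) ξ (x.2.map (· • x.1))))
    (q' := fun x => (∑ i, ∑ j, ‖ξ i‖ * ‖ξ j‖) * q x)
    (fun x y => by
      rw [Prod.snd_mul, Prod.fst_mul, matrix_map_smul_mul, hkernel.matrixElement_mul hξ, map_mul])
    (fun x => by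
      rw [Prod.snd_star, Prod.fst_star, matrix_map_smul_star, hkernel.matrixElement_star, map_star])
    (fun x => (hq_mul _ x).trans_eq (by rw [hq_star, sq]))
    (fun x => by positivity)
    (fun x y => (mul_le_mul_of_nonneg_left (hq_mul x y)
      (Finset.sum_nonneg fun i _ => Finset.sum_nonneg fun j _ => by positivity)).trans_eq
        (mul_left_comm _ _ _))
    (fun x => α.norm_matrixElement_kernelElementₗ_le_sum hρ hξ x.1 x.2) (a, c)

theorem norm_tensorToConv_tmul_le (hρ : CompactModel μ ρ) (p : C(G, ℂ) ⊗[ℂ] C(G, ℂ)) (a : A) :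
    ‖α.shiftTensor.funToCrossedProduct μ (α.tensorToConv G (p ⊗ₜ a))‖ ≤ ‖a‖ * ‖ρ p‖ := by
  obtain ⟨n, ξ, c, hξ, hpc⟩ := exists_matrix_repr (μ := μ) (p ⊗ₜ[ℂ] (1 : ℂ))
  have hp : p = ∑ i, ∑ j, c i j • (ξ i ⊗ₜ[ℂ] star (ξ j)) := by
    have := congrArg (TensorProduct.rid ℂ _) hpc
    simpa only [map_sum, TensorProduct.rid_tmul, one_smul] using this
  have hρp : ρ p = matrixElement (compactKernel ρ) ξ c := by
    rw [hp]
    simp only [map_sum, map_smul]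
    rfl
  have hpa : α.shiftTensor.funToCrossedProduct μ (α.tensorToConv G (p ⊗ₜ a)) =
      α.shiftTensor.toCrossedProduct μ
        (matrixElement (α.kernelElementₗ μ) ξ ((Matrix.of c).map (· • a))) := by
    rw [← ofFun_tensorToConv_matrix, hp]
    simp only [TensorProduct.sum_tmul, TensorProduct.smul_tmul]
    rfl
  rw [hpa, hρp]
  exact α.norm_matrixElement_kernelElementₗ_le hρ hξ a c

end CStarAction

/-! ### The canonical isomorphism -/

section CommonProducts

variable {G : Type*} [TopologicalSpace G] [CompactSpace G] [MeasurableSpace G] [BorelSpace G]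
  {μ : Measure G} [IsFiniteMeasure μ]
  {A D D' : Type*} [NonUnitalRing A] [StarRing A] [Module ℂ A]
  [NonUnitalRing D] [StarRing D] [Module ℂ D] [NonUnitalRing D'] [StarRing D'] [Module ℂ D']
  {m : C(G, ℂ) → C(G, ℂ) → A →ₗ[ℂ] D} {m' : C(G, ℂ) → C(G, ℂ) → A →ₗ[ℂ] D'}
  {L : (C(G, ℂ) ⊗[ℂ] C(G, ℂ)) ⊗[ℂ] A →ₗ[ℂ] D} {L' : (C(G, ℂ) ⊗[ℂ] C(G, ℂ)) ⊗[ℂ] A →ₗ[ℂ] D'}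

theorem KernelSystem.exists_common_mul (hm : KernelSystem μ m) (hm' : KernelSystem μ m')
    (hL : ∀ f g a, L ((f ⊗ₜ g) ⊗ₜ a) = m f (star g) a)
    (hL' : ∀ f g a, L' ((f ⊗ₜ g) ⊗ₜ a) = m' f (star g) a)
    (x y : (C(G, ℂ) ⊗[ℂ] C(G, ℂ)) ⊗[ℂ] A) :
    ∃ z, L z = L x * L y ∧ L' z = L' x * L' y := by
  induction x using triple_tensor_induction with
  | hadd x x' hx hx' =>
    obtain ⟨z, hz, hz'⟩ := hx
    obtain ⟨w, hw, hw'⟩ := hx'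
    exact ⟨z + w, by rw [map_add, map_add, add_mul, hz, hw],
      by rw [map_add, map_add, add_mul, hz', hw']⟩
  | htmul f g a =>
    induction y using triple_tensor_induction with
    | hadd y y' hy hy' =>
      obtain ⟨z, hz, hz'⟩ := hy
      obtain ⟨w, hw, hw'⟩ := hy'
      exact ⟨z + w, by rw [map_add, map_add, mul_add, hz, hw],
        by rw [map_add, map_add, mul_add, hz', hw']⟩
    | htmul f' g' b =>
      refine ⟨funInner μ (star g) f' • ((f ⊗ₜ g') ⊗ₜ (a * b)), ?_, ?_⟩
      · rw [map_smul, hL, hL, hL, hm.mul_apply]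
      · rw [map_smul, hL', hL', hL', hm'.mul_apply]

theorem KernelSystem.exists_common_star (hm : KernelSystem μ m) (hm' : KernelSystem μ m')
    (hL : ∀ f g a, L ((f ⊗ₜ g) ⊗ₜ a) = m f (star g) a)
    (hL' : ∀ f g a, L' ((f ⊗ₜ g) ⊗ₜ a) = m' f (star g) a)
    (x : (C(G, ℂ) ⊗[ℂ] C(G, ℂ)) ⊗[ℂ] A) : ∃ z, L z = star (L x) ∧ L' z = star (L' x) := by
  induction x using triple_tensor_induction with
  | hadd x x' hx hx' =>
    obtain ⟨z, hz, hz'⟩ := hx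
    obtain ⟨w, hw, hw'⟩ := hx'
    exact ⟨z + w, by rw [map_add, map_add, star_add, hz, hw],
      by rw [map_add, map_add, star_add, hz', hw']⟩
  | htmul f g a =>
    refine ⟨(star g ⊗ₜ star f) ⊗ₜ star a, ?_, ?_⟩
    · rw [hL, hL, hm.star_apply, star_star]
    · rw [hL', hL', hm'.star_apply, star_star]

end CommonProducts

section CStarTensor

variable {A K : Type*} [NonUnitalCStarAlgebra A] [NonUnitalCStarAlgebra K]

theorem exists_cstarTensor_hom {D : Type*} [NonUnitalCStarAlgebra D] (B : A →ₗ[ℂ] K →ₗ[ℂ] D)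
    (hmul : ∀ a b k l, B (a * b) (k * l) = B a k * B b l)
    (hstar : ∀ a k, B (star a) (star k) = star (B a k)) (hnorm : ∀ a k, ‖B a k‖ ≤ ‖a‖ * ‖k‖) :
    ∃ Ψ : CStarTensor A K →⋆ₙₐ[ℂ] D, ∀ a k, Ψ (elemTensor a k) = B a k := by
  let Ψ₀ : A ⊗[ℂ] K →⋆ₙₐ[ℂ] D :=
    { toFun := TensorProduct.lift B
      map_smul' := map_smul (TensorProduct.lift B)
      map_zero' := map_zero (TensorProduct.lift B)
      map_add' := map_add (TensorProduct.lift B)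
      map_mul' := fun x y => by
        induction x using TensorProduct.induction_on with
        | zero => simp only [map_zero, zero_mul]
        | add x x' hx hx' => simp only [map_add, add_mul, hx, hx']
        | tmul a k =>
          induction y using TensorProduct.induction_on with
          | zero => simp only [map_zero, mul_zero]
          | add y y' hy hy' => simp only [map_add, mul_add, hy, hy']
          | tmul b l =>
            rw [Algebra.TensorProduct.tmul_mul_tmul]
            exact hmul a b k l
      map_star' := fun x => by
        induction x using TensorProduct.induction_on with
        | zero => simp only [map_zero, star_zero]
        | add x x' hx hx' => simp only [map_add, star_add, hx, hx']
        | tmul a k =>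
          rw [TensorProduct.star_tmul]
          exact hstar a k }
  obtain ⟨Ψ, hΨ⟩ := exists_env_hom (S := tensorSeminorms A K) Ψ₀ hnorm
  exact ⟨Ψ, fun a k => hΨ (a ⊗ₜ k)⟩

theorem denseRange_tensorToElem {G : Type*} [TopologicalSpace G]
    {ρ : C(G, ℂ) ⊗[ℂ] C(G, ℂ) →ₗ[ℂ] K} (hρ : DenseRange ρ) : DenseRange (tensorToElem A ρ) := by
  let P : Submodule ℂ (CStarTensor A K) := (LinearMap.range (tensorToElem A ρ)).topologicalClosure
  have hP : IsClosed (P : Set (CStarTensor A K)) := Submodule.isClosed_topologicalClosure _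
  intro x
  suffices h : x ∈ P from h
  refine (denseRange_envOfₗ (tensorSeminorms A K)).induction_on (p := fun x => x ∈ P) x hP
    fun y => ?_
  induction y using TensorProduct.induction_on with
  | zero => rw [map_zero]; exact zero_mem _
  | add y y' hy hy' => rw [map_add]; exact add_mem hy hy'
  | tmul a k =>
    let L : K →ₗ[ℂ] CStarTensor A K :=
      envOfₗ (tensorSeminorms A K) ∘ₗ TensorProduct.mk ℂ A K a
    have hL : Continuous L := AddMonoidHomClass.continuous_of_bound L ‖a‖ fun k =>
      norm_elemTensor_le a k
    exact hρ.induction_on (p := fun k => L k ∈ P) k (hP.preimage hL) fun p =>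
      Submodule.le_topologicalClosure _ ⟨p ⊗ₜ a, rfl⟩

end CStarTensor

theorem SequentiallySplit.equiv_comp {B C D : Type*} [NonUnitalCStarAlgebra B]
    [NonUnitalCStarAlgebra C] [NonUnitalCStarAlgebra D] {φ : B →⋆ₙₐ[ℂ] C}
    (h : SequentiallySplit φ) (Φ : C ≃⋆ₐ[ℂ] D) :
    SequentiallySplit ((Φ : C →⋆ₙₐ[ℂ] D).comp φ) := by
  obtain ⟨ψ, hψ⟩ := h
  refine ⟨ψ.comp (Φ.symm : D →⋆ₙₐ[ℂ] C), ?_⟩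
  rw [← hψ]
  exact NonUnitalStarAlgHom.ext fun x => congrArg ψ (Φ.symm_apply_apply _)

namespace CStarAction

variable {G : Type*} [Group G] [TopologicalSpace G] [IsTopologicalGroup G] [CompactSpace G]
  [SecondCountableTopology G] [MeasurableSpace G] [BorelSpace G]
  {A : Type*} [NonUnitalCStarAlgebra A] (α : CStarAction G A)
  {μ : Measure G} [μ.IsHaarMeasure] [IsProbabilityMeasure μ]
  {K : Type*} [NonUnitalCStarAlgebra K] {ρ : C(G, ℂ) ⊗[ℂ] C(G, ℂ) →ₗ[ℂ] K}

theorem exists_hom_to_cstarTensor [T2Space G] (hρ : CompactModel μ ρ) :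
    ∃ Φ : α.shiftTensor.CrossedProduct μ →⋆ₙₐ[ℂ] CStarTensor A K,
      ∀ x, Φ (α.shiftTensor.funToCrossedProduct μ (α.tensorToConv G x)) = tensorToElem A ρ x := by
  have hkernel := α.kernelSystem_kernelElementₗ μ
  have hmul := hkernel.exists_common_mul
    (L := (ConvAlg.ofFun α.shiftTensor μ).toLinearMap ∘ₗ α.tensorToConv G)
    hρ.kernelSystem_elemKernel (α.ofFun_tensorToConv_tmul μ) tensorToElem_tmul_tmul
  have hstar := hkernel.exists_common_star
    (L := (ConvAlg.ofFun α.shiftTensor μ).toLinearMap ∘ₗ α.tensorToConv G)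
    hρ.kernelSystem_elemKernel (α.ofFun_tensorToConv_tmul μ) tensorToElem_tmul_tmul
  have hnorm : ∀ x, ‖tensorToElem A ρ x‖ ≤ 1 * ‖α.tensorToConv G x‖ := fun x =>
    (α.norm_tensorToElem_le hρ x).trans_eq (one_mul _).symm
  have hΦ := exists_crossedProduct_hom (E := (C(G, ℂ) ⊗[ℂ] C(G, ℂ)) ⊗[ℂ] A) (α := α.shiftTensor)
    (α.tensorToConv G) ?_ (tensorToElem A ρ) hnorm hmul hstar
  · exact hΦ
  · exact α.denseRange_tensorToConv

variable (μ) in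
/-- The map `p ↦ κ(p ⊗ a)` from `C(G) ⊙ C(G)` to the crossed product. -/
def kernelToCrossedProduct (a : A) :
    C(G, ℂ) ⊗[ℂ] C(G, ℂ) →ₗ[ℂ] α.shiftTensor.CrossedProduct μ :=
  α.shiftTensor.funToCrossedProduct μ ∘ₗ α.tensorToConv G ∘ₗ
    (TensorProduct.mk ℂ (C(G, ℂ) ⊗[ℂ] C(G, ℂ)) A).flip a

theorem kernelToCrossedProduct_apply (a : A) (p : C(G, ℂ) ⊗[ℂ] C(G, ℂ)) :
    α.kernelToCrossedProduct μ a p =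
      α.shiftTensor.funToCrossedProduct μ (α.tensorToConv G (p ⊗ₜ a)) := rfl

theorem funToCrossedProduct_tensorToConv_tmul (f g : C(G, ℂ)) (a : A) :
    α.shiftTensor.funToCrossedProduct μ (α.tensorToConv G ((f ⊗ₜ g) ⊗ₜ a)) =
      α.shiftTensor.toCrossedProduct μ (α.kernelElementₗ μ f (star g) a) :=
  congrArg (α.shiftTensor.toCrossedProduct μ) (α.ofFun_tensorToConv_tmul μ f g a)

theorem kernelToCrossedProduct_tmul (a : A) (f g : C(G, ℂ)) :
    α.kernelToCrossedProduct μ a (f ⊗ₜ g) =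
      α.shiftTensor.toCrossedProduct μ (α.kernelElementₗ μ f (star g) a) :=
  α.funToCrossedProduct_tensorToConv_tmul f g a

variable (μ) in
/-- The extension of `ρ(p) ↦ κ(p ⊗ a)` to `K`. -/
def compactToCrossedProduct (ρ : C(G, ℂ) ⊗[ℂ] C(G, ℂ) →ₗ[ℂ] K) (a : A) :
    K →L[ℂ] α.shiftTensor.CrossedProduct μ :=
  (α.kernelToCrossedProduct μ a).extendOfNorm ρ

theorem compactToCrossedProduct_apply (hρ : CompactModel μ ρ) (a : A)
    (p : C(G, ℂ) ⊗[ℂ] C(G, ℂ)) :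
    α.compactToCrossedProduct μ ρ a (ρ p) = α.kernelToCrossedProduct μ a p :=
  LinearMap.extendOfNorm_eq hρ.denseRange ⟨‖a‖, fun p => α.norm_tensorToConv_tmul_le hρ p a⟩ p

theorem norm_compactToCrossedProduct_le (hρ : CompactModel μ ρ) (a : A) (k : K) :
    ‖α.compactToCrossedProduct μ ρ a k‖ ≤ ‖a‖ * ‖k‖ := by
  refine hρ.denseRange.induction_on
    (p := fun k => ‖α.compactToCrossedProduct μ ρ a k‖ ≤ ‖a‖ * ‖k‖) k
    (isClosed_le (α.compactToCrossedProduct μ ρ a).continuous.norm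
      (continuous_const.mul continuous_norm)) fun p => ?_
  rw [α.compactToCrossedProduct_apply hρ]
  exact α.norm_tensorToConv_tmul_le hρ p a

theorem compactToCrossedProduct_mul (hρ : CompactModel μ ρ) (a b : A) (k l : K) :
    α.compactToCrossedProduct μ ρ (a * b) (k * l) =
      α.compactToCrossedProduct μ ρ a k * α.compactToCrossedProduct μ ρ b l := by
  refine (hρ.denseRange.prodMap hρ.denseRange).induction_on
    (p := fun x => α.compactToCrossedProduct μ ρ (a * b) (x.1 * x.2) =
      α.compactToCrossedProduct μ ρ a x.1 * α.compactToCrossedProduct μ ρ b x.2) (k, l)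
    (isClosed_eq ((α.compactToCrossedProduct μ ρ (a * b)).continuous.comp
      (continuous_fst.mul continuous_snd))
      (((α.compactToCrossedProduct μ ρ a).continuous.comp continuous_fst).mul
        ((α.compactToCrossedProduct μ ρ b).continuous.comp continuous_snd))) ?_
  rintro ⟨p, q⟩
  change α.compactToCrossedProduct μ ρ (a * b) (ρ p * ρ q) =
      α.compactToCrossedProduct μ ρ a (ρ p) * α.compactToCrossedProduct μ ρ b (ρ q)
  induction p using TensorProduct.induction_on with
  | zero => simp only [map_zero, zero_mul]
  | add p p' hp hp' => simp only [map_add, add_mul, hp, hp']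
  | tmul f g =>
    induction q using TensorProduct.induction_on with
    | zero => simp only [map_zero, mul_zero]
    | add p p' hp hp' => simp only [map_add, mul_add, hp, hp']
    | tmul f' g' =>
      have h := hρ.mul_apply f (star g) f' (star g')
      rw [star_star, star_star] at h
      rw [h, map_smul, α.compactToCrossedProduct_apply hρ, α.compactToCrossedProduct_apply hρ,
        α.compactToCrossedProduct_apply hρ, kernelToCrossedProduct_tmul,
        kernelToCrossedProduct_tmul, kernelToCrossedProduct_tmul, ← map_mul,
        (α.kernelSystem_kernelElementₗ μ).mul_apply, map_smul]

theorem compactToCrossedProduct_star (hρ : CompactModel μ ρ) (a : A) (k : K) :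
    α.compactToCrossedProduct μ ρ (star a) (star k) =
      star (α.compactToCrossedProduct μ ρ a k) := by
  refine hρ.denseRange.induction_on
    (p := fun k => α.compactToCrossedProduct μ ρ (star a) (star k) =
      star (α.compactToCrossedProduct μ ρ a k)) k
    (isClosed_eq ((α.compactToCrossedProduct μ ρ (star a)).continuous.comp continuous_star)
      (α.compactToCrossedProduct μ ρ a).continuous.star) fun p => ?_
  induction p using TensorProduct.induction_on with
  | zero => simp only [map_zero, star_zero]
  | add p p' hp hp' => simp only [map_add, star_add, hp, hp']
  | tmul f g =>
    have h := hρ.star_apply f (star g)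
    rw [star_star] at h
    rw [h, α.compactToCrossedProduct_apply hρ, α.compactToCrossedProduct_apply hρ,
      kernelToCrossedProduct_tmul, kernelToCrossedProduct_tmul, ← map_star,
      (α.kernelSystem_kernelElementₗ μ).star_apply, star_star]

theorem compactToCrossedProduct_add (hρ : CompactModel μ ρ) (a b : A) :
    α.compactToCrossedProduct μ ρ (a + b) =
      α.compactToCrossedProduct μ ρ a + α.compactToCrossedProduct μ ρ b := by
  refine DFunLike.coe_injective (hρ.denseRange.equalizer
    (ContinuousLinearMap.continuous _) (ContinuousLinearMap.continuous _) (funext fun p => ?_))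
  change α.compactToCrossedProduct μ ρ (a + b) (ρ p) =
    α.compactToCrossedProduct μ ρ a (ρ p) + α.compactToCrossedProduct μ ρ b (ρ p)
  simp only [α.compactToCrossedProduct_apply hρ, kernelToCrossedProduct_apply,
    TensorProduct.tmul_add, map_add]

theorem compactToCrossedProduct_smul (hρ : CompactModel μ ρ) (c : ℂ) (a : A) :
    α.compactToCrossedProduct μ ρ (c • a) = c • α.compactToCrossedProduct μ ρ a := by
  refine DFunLike.coe_injective (hρ.denseRange.equalizer
    (ContinuousLinearMap.continuous _) (ContinuousLinearMap.continuous _) (funext fun p => ?_))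
  change α.compactToCrossedProduct μ ρ (c • a) (ρ p) =
    c • α.compactToCrossedProduct μ ρ a (ρ p)
  simp only [α.compactToCrossedProduct_apply hρ, kernelToCrossedProduct_apply,
    TensorProduct.tmul_smul, map_smul]

theorem exists_hom_from_cstarTensor (hρ : CompactModel μ ρ) :
    ∃ Ψ : CStarTensor A K →⋆ₙₐ[ℂ] α.shiftTensor.CrossedProduct μ,
      ∀ x, Ψ (tensorToElem A ρ x) = α.shiftTensor.funToCrossedProduct μ (α.tensorToConv G x) := by
  obtain ⟨Ψ, hΨ⟩ := exists_cstarTensor_hom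
    (LinearMap.mk₂ ℂ (fun a k => α.compactToCrossedProduct μ ρ a k)
      (fun a b k => by rw [α.compactToCrossedProduct_add hρ]; rfl)
      (fun c a k => by rw [α.compactToCrossedProduct_smul hρ]; rfl)
      (fun a k l => map_add _ _ _) (fun c a k => map_smul _ _ _))
    (α.compactToCrossedProduct_mul hρ) (α.compactToCrossedProduct_star hρ)
    (α.norm_compactToCrossedProduct_le hρ)
  refine ⟨Ψ, fun x => ?_⟩
  induction x using TensorProduct.induction_on with
  | zero => simp only [map_zero]
  | add x y hx hy => simp only [map_add, hx, hy]
  | tmul p a => exact (hΨ a (ρ p)).trans (α.compactToCrossedProduct_apply hρ a p)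

theorem exists_equiv_cstarTensor [T2Space G] (hρ : CompactModel μ ρ) :
    ∃ Φ : α.shiftTensor.CrossedProduct μ ≃⋆ₐ[ℂ] CStarTensor A K,
      ∀ x, Φ (α.shiftTensor.funToCrossedProduct μ (α.tensorToConv G x)) = tensorToElem A ρ x := by
  obtain ⟨Φ, hΦ⟩ := α.exists_hom_to_cstarTensor hρ
  obtain ⟨Ψ, hΨ⟩ := α.exists_hom_from_cstarTensor hρ
  have hΨΦ : Ψ.comp Φ = NonUnitalStarAlgHom.id ℂ _ :=
    crossedProduct_hom_ext (α.tensorToConv G) α.denseRange_tensorToConv fun x => by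
      rw [NonUnitalStarAlgHom.comp_apply, hΦ, hΨ]
      rfl
  have hΦΨ : (fun y => Φ (Ψ y)) = id :=
    (denseRange_tensorToElem hρ.denseRange).equalizer
      ((homL Φ).continuous.comp (homL Ψ).continuous) continuous_id
      (funext fun x => (congrArg Φ (hΨ x)).trans (hΦ x))
  exact ⟨{ toFun := Φ
           invFun := Ψ
           left_inv := DFunLike.congr_fun hΨΦ
           right_inv := congrFun hΦΨ
           map_mul' := map_mul Φ
           map_add' := map_add Φ
           map_star' := map_star Φ
           map_smul' := map_smul Φ }, hΦ⟩

variable (μ) [T2Space G]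

theorem exists_equiv_rankOne {H : Type*} [NormedAddCommGroup H] [InnerProductSpace ℂ H]
    [CompleteSpace H] (Λ : C(G, ℂ) →ₗ[ℂ] H) (hd : DenseRange Λ)
    (hΛ : ∀ f g, inner ℂ (Λ f) (Λ g) = funInner μ f g) :
    ∃ Φ : α.shiftTensor.CrossedProduct μ ≃⋆ₐ[ℂ] CStarTensor A (compacts H), ∀ a ξ η,
      Φ (α.shiftTensor.toCrossedProduct μ (α.kernelElement μ a ξ η)) =
        elemTensor a (rankOneCompact (Λ ξ) (Λ η)) := by
  obtain ⟨Φ, hΦ⟩ := α.exists_equiv_cstarTensor (compactModel_tensorToCompact hd hΛ)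
  refine ⟨Φ, fun a ξ η => ?_⟩
  have hfun : α.shiftTensor.funToCrossedProduct μ (α.tensorToConv G ((ξ ⊗ₜ star η) ⊗ₜ a)) =
      α.shiftTensor.toCrossedProduct μ (α.kernelElement μ a ξ η) := by
    rw [funToCrossedProduct_tensorToConv_tmul, star_star]
    rfl
  rw [← hfun, hΦ, tensorToElem_tmul, tensorToCompact_tmul]

variable {α μ} in
theorem kernelElement_hom_ext {D : Type*} [NonUnitalCStarAlgebra D]
    {T T' : α.shiftTensor.CrossedProduct μ →⋆ₙₐ[ℂ] D}
    (h : ∀ a ξ η, T (α.shiftTensor.toCrossedProduct μ (α.kernelElement μ a ξ η)) =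
      T' (α.shiftTensor.toCrossedProduct μ (α.kernelElement μ a ξ η))) : T = T' := by
  refine crossedProduct_hom_ext (α.tensorToConv G) α.denseRange_tensorToConv fun x => ?_
  induction x using triple_tensor_induction with
  | hadd x y hx hy => rw [map_add, map_add, map_add, map_add, hx, hy]
  | htmul f g a =>
    rw [funToCrossedProduct_tensorToConv_tmul]
    exact h a f (star g)

theorem exists_isCanonicalIso : ∃ Φ, α.IsCanonicalIso μ Φ :=
  α.exists_equiv_rankOne μ (H := Lp ℂ 2 μ)
    (ContinuousMap.toLp 2 μ ℂ : C(G, ℂ) →L[ℂ] Lp ℂ 2 μ)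
    (ContinuousMap.toLp_denseRange ℂ μ ℂ (by norm_num)) fun _ _ => rfl

theorem existsUnique_isCanonicalIso : ∃! Φ, α.IsCanonicalIso μ Φ :=
  existsUnique_of_exists_of_unique (α.exists_isCanonicalIso μ) fun Φ Φ' h h' => by
    have heq :
        (Φ : α.shiftTensor.CrossedProduct μ →⋆ₙₐ[ℂ] CStarTensor A (compacts (Lp ℂ 2 μ))) = Φ' :=
      kernelElement_hom_ext fun a ξ η => (h a ξ η).trans (h' a ξ η).symm
    exact StarAlgEquiv.ext fun x => DFunLike.congr_fun heq x

variable {α} in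
theorem RokhlinProperty.sequentiallySplit_crossedProductMap_secondFactor
    [TopologicalSpace.SeparableSpace A] (hα : α.RokhlinProperty) :
    SequentiallySplit (crossedProductMap μ (secondFactor G A) α.secondFactor_equivariant) := by
  obtain ⟨ψ, hψ, hψ'⟩ := hα.exists_hom
  exact sequentiallySplit_crossedProductMap μ α.secondFactor_equivariant hψ' hψ

include μ in
variable {α} in
theorem RokhlinProperty.sequentiallySplit_fixedPointsInclusion
    [TopologicalSpace.SeparableSpace A] (hα : α.RokhlinProperty) :
    SequentiallySplit α.fixedPointsInclusion := by
  obtain ⟨ψ, hψ, hψ'⟩ := hα.exists_hom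
  exact α.sequentiallySplit_fixedPointsInclusion μ hψ hψ'

end CStarAction

end RokhlinSplit

end

theorem theorem4p8 {G A : Type*} [Group G] [TopologicalSpace G] [IsTopologicalGroup G]
    [CompactSpace G] [T2Space G] [SecondCountableTopology G] [MeasurableSpace G] [BorelSpace G]
    [NonUnitalCStarAlgebra A] [TopologicalSpace.SeparableSpace A]
    (μ : MeasureTheory.Measure G) [μ.IsHaarMeasure] [MeasureTheory.IsProbabilityMeasure μ]
    (α : RokhlinSplit.CStarAction G A) (hα : α.RokhlinProperty) :
    RokhlinSplit.SequentiallySplit α.fixedPointsInclusion ∧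
      (∃! Φ, α.IsCanonicalIso μ Φ) ∧
      ∀ Φ, α.IsCanonicalIso μ Φ →
        RokhlinSplit.SequentiallySplit (α.crossedProductEmbedding μ Φ) := by
  exact ⟨hα.sequentiallySplit_fixedPointsInclusion μ, α.existsUnique_isCanonicalIso μ,
    fun Φ _ => (hα.sequentiallySplit_crossedProductMap_secondFactor μ).equiv_comp Φ⟩
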